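/- **Model.** A user sits at the origin of the plane. Terrestrial base stations (TBSs) form a homogeneous Poisson process $\Phi_T=\{x_i\}$ of density $\lambda_T$. Line-of-sight and non-line-of-sight aerial base stations have height $h$, and their horizontal positions form Poisson processes $\Phi_L$, $\Phi_N$ of intensities $\lambda_A P_L(|y|)\,dy$ and $\lambda_A P_N(|y|)\,dy$, where $P_L(x)=\bigl(1+a\,e^{-b\frac{180}{\pi}\arctan(h/x-a)}\bigr)^{-1}$ and $P_N=1-P_L$. TBS $i$ has a channel gain $H_i\sim\mathrm{Gamma}(m_T,\tfrac1{m_T})$ (shape, scale), with $m_T\ge1$ an integer, and an interference gain $G_i$ equal to $G_M>0$ with probability $p_M=\frac{\theta_a}{2\pi}\frac{\theta_d}{\pi}$ and to $G_m\ge0$ with probability $p_m=1-p_M$, where $0\le\theta_a\le2\pi$, $0\le\theta_d\le\pi$. $\Phi_T,\Phi_L,\Phi_N$ and all $H_i$, $G_i$ are mutually independent. The parameters $\lambda_T,\lambda_A,h,R_B,a,b,\alpha_\bullet,C_\bullet,P_T,P_A,a_n,\sigma_T^2$ are positive. Put $\eta_T=G_MP_TC_T$, $\eta_L=a_nP_AC_L$,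 $\eta_N=a_nP_AC_N$, and let $R_{T,0},R_{L,0},R_{N,0}$ be the distances from the user to the nearest base station of each kind. The user is associated with the mmWave tier on the event $$B_T=\bigl\{\eta_TR_{T,0}^{-\alpha_T}\mathbf 1(R_{T,0}\le R_B)>\max(\eta_LR_{L,0}^{-\alpha_L},\eta_NR_{N,0}^{-\alpha_N})\bigr\},\qquad A_T=\mathbb P(B_T).$$ It is then served by the nearest TBS $x_0$, and its SINR is $$\gamma_T=\frac{\eta_TR_{T,0}^{-\alpha_T}H_{T,0}}{I_T+\sigma_T^2},\qquad I_T=\sum_{x_i\in\Phi_T,\ x_i\ne x_0,\ |x_i|\le R_B}G_iP_TC_T|x_i|^{-\alpha_T}H_i ,$$ where $H_{T,0}$ is the channel gain of $x_0$. Let $\bar F_{\gamma_T}(z)=\mathbb P(\gamma_T>z\mid B_T)$ and $R_T=\mathbb E[\log_2(1+\gamma_T)\mid B_T]$. With $\tau_{\bullet}(r)=\max\bigl(h,(\eta_\bullet/\eta_T)^{1/\alpha_\bullet}r^{\alpha_T/\alpha_\bullet}\bigr)$ for $\bullet\in\{L,N\}$ put, for $0\le r\le R_B$, $$f_{\hat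 R_{T,0}}(r)=\frac{2\pi\lambda_Tre^{-\pi\lambda_Tr^2}}{A_T}\prod_{\bullet\in\{L,N\}}\exp\Bigl(-2\pi\lambda_A\int_0^{\sqrt{\tau_\bullet(r)^2-h^2}}xP_\bullet(x)\,dx\Bigr)$$ and $f_{\hat R_{T,0}}(r)=0$ for all other $r$. Put $$L_{I_T}(s;r)=\exp\Bigl(-2\pi\lambda_T\sum_{j\in\{M,m\}}p_j\int_r^{R_B}\Bigl(1-\bigl(1+\tfrac{sP_TC_TG_j}{m_Tx^{\alpha_T}}\bigr)^{-m_T}\Bigr)x\,dx\Bigr),\qquad b_T=m_T(m_T!)^{-1/m_T}.$$ For $c>0$, $z\ge0$ define $$A_c(z)=\int_0^{R_B}\Bigl(\sum_{k=1}^{m_T}(-1)^{k+1}\binom{m_T}{k}e^{-kc\frac{zr^{\alpha_T}\sigma_T^2}{G_MP_TC_T}}L_{I_T}\Bigl(kc\tfrac{zr^{\alpha_T}}{G_MP_TC_T};r\Bigr)\Bigr)f_{\hat R_{T,0}}(r)\,dr .$$ **Theorem.** $A_T>0$. Given $B_T$, $f_{\hat R_{T,0}}$ is the density of $R_{T,0}$,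 and $L_{I_T}(s;R_{T,0})$ is, for all $s\ge0$, the conditional expectation of $e^{-sI_T}$ given $R_{T,0}$. The random variable $\log_2(1+\gamma_T)$ is integrable given $B_T$, the integral below converges, and the ergodic rate of the mmWave tier is $$R_T=\frac1{\ln2}\int_0^\infty\frac{\bar F_{\gamma_T}(z)}{1+z}\,dz .$$ The function $\bar F_{\gamma_T}$ is approximated by $A_{b_T}$ in the following sense. Write $\tau_z=\frac{zR_{T,0}^{\alpha_T}(I_T+\sigma_T^2)}{G_MP_TC_T}$ and let $\bar F_H$ be the tail of $\mathrm{Gamma}(m_T,\frac1{m_T})$. For all $z\ge0$: 1. $\bar F_{\gamma_T}(z)=\mathbb E[\bar F_H(\tau_z)\mid B_T]$ and $A_{b_T}(z)=\mathbb E[1-(1-e^{-b_T\tau_z})^{m_T}\mid B_T]$, so that $A_{b_T}$ arises by replacing $\bar F_H(\tau)$ by $1-(1-e^{-b_T\tau})^{m_T}$; 2. $A_{m_T}(z)\le\bar F_{\gamma_T}(z)\le A_{b_T}(z)$ (with equality throughout if $m_T=1$). Moreover $\dfrac{1-A_{b_T}(z)}{1-\bar F_{\gamma_T}(z)}\to1$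 as $z\to0^+$. -/

import Mathlib

open MeasureTheory ProbabilityTheory Set Filter Topology

noncomputable section

namespace HetNet

/-- The horizontal plane; the typical user sits at the origin. -/
abbrev Plane := EuclideanSpace ℝ (Fin 2)

/-- The points `X 0, X 1, …` enumerate a Poisson point process with intensity measure `Λ`:
the number of points in a set of finite intensity is Poisson distributed, and the numbers of
points in disjoint sets are independent. -/
structure IsPoissonProcess {Ω : Type*} [MeasurableSpace Ω] (μ : Measure Ω)
    (X : ℕ → Ω → Plane) (Λ : Measure Plane) : Prop where
  measurable : ∀ i, Measurable (X i)
  count_law : ∀ B : Set Plane, MeasurableSet B → Λ B ≠ ⊤ → ∀ n : ℕ,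
    μ {ω | {i | X i ω ∈ B}.encard = (n : ℕ∞)} =
      ENNReal.ofReal (Real.exp (-(Λ B).toReal) * (Λ B).toReal ^ n / (n.factorial : ℝ))
  count_indep : ∀ (n : ℕ) (B : Fin n → Set Plane), (∀ j, MeasurableSet (B j)) →
    (∀ j k, j ≠ k → Disjoint (B j) (B k)) →
      iIndepFun (fun j ω => {i | X i ω ∈ B j}.encard) μ

/-- Parameters of the two-tier network. Index `T`: terrestrial base stations (mmWave);
index `L`, `N`: aerial base stations with a line-of-sight, resp. non-line-of-sight, link. -/
structure Params where
  /-- densities of the terrestrial and of the aerial base stations -/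
  lamT : ℝ
  lamA : ℝ
  /-- height of the aerial base stations, radius of the mmWave line-of-sight ball -/
  h : ℝ
  RB : ℝ
  /-- S-curve parameters of the line-of-sight probability -/
  a : ℝ
  b : ℝ
  /-- path loss exponents -/
  alphaT : ℝ
  alphaL : ℝ
  alphaN : ℝ
  /-- additive losses -/
  CT : ℝ
  CL : ℝ
  CN : ℝ
  /-- transmit powers, and the power allocation factor of the near user -/
  PT : ℝ
  PA : ℝ
  an : ℝ
  /-- main-lobe and side-lobe gain, azimuth and elevation beamwidths -/
  GM : ℝ
  Gm : ℝ
  thetaA : ℝ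
  thetaD : ℝ
  /-- Nakagami parameter and noise power of the mmWave tier -/
  mT : ℕ
  sigma2T : ℝ
  lamT_pos : 0 < lamT
  lamA_pos : 0 < lamA
  h_pos : 0 < h
  RB_pos : 0 < RB
  a_pos : 0 < a
  b_pos : 0 < b
  alphaT_pos : 0 < alphaT
  alphaL_pos : 0 < alphaL
  alphaN_pos : 0 < alphaN
  CT_pos : 0 < CT
  CL_pos : 0 < CL
  CN_pos : 0 < CN
  PT_pos : 0 < PT
  PA_pos : 0 < PA
  an_pos : 0 < an
  GM_pos : 0 < GM
  Gm_nonneg : 0 ≤ Gm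
  thetaA_mem : thetaA ∈ Icc 0 (2 * Real.pi)
  thetaD_mem : thetaD ∈ Icc 0 Real.pi
  one_le_mT : 1 ≤ mT
  sigma2T_pos : 0 < sigma2T

namespace Params

variable (p : Params)

/-- Probability that an interferer is received through its main lobe. -/
def pM : ℝ := p.thetaA / (2 * Real.pi) * (p.thetaD / Real.pi)

/-- Line-of-sight probability of an aerial link at horizontal distance `x`. -/
def PL (x : ℝ) : ℝ :=
  1 / (1 + p.a * Real.exp (-p.b * (180 / Real.pi) * Real.arctan (p.h / x - p.a)))

/-- Non-line-of-sight probability of an aerial link at horizontal distance `x`. -/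
def PN (x : ℝ) : ℝ := 1 - p.PL x

def etaT : ℝ := p.GM * p.PT * p.CT
def etaL : ℝ := p.an * p.PA * p.CL
def etaN : ℝ := p.an * p.PA * p.CN

/-- Intensity measures of the three Poisson processes of base stations. -/
def intensityT : Measure Plane := ENNReal.ofReal p.lamT • volume
def intensityL : Measure Plane :=
  volume.withDensity fun y => ENNReal.ofReal (p.lamA * p.PL ‖y‖)
def intensityN : Measure Plane :=
  volume.withDensity fun y => ENNReal.ofReal (p.lamA * p.PN ‖y‖)

/-- Law of the random directivity gain of an interferer. -/
def gainLaw : Measure ℝ :=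
  ENNReal.ofReal p.pM • Measure.dirac p.GM + ENNReal.ofReal (1 - p.pM) • Measure.dirac p.Gm

/-- Law of a channel gain: Gamma with shape `mT` and scale `1 / mT` (that is, rate `mT`). -/
def fadingLaw : Measure ℝ := gammaMeasure p.mT p.mT

/-- Minimum distances of the interfering line-of-sight / non-line-of-sight aerial base stations
when the user is served by a terrestrial base station at distance `r`. -/
def tauL (r : ℝ) : ℝ :=
  max p.h ((p.etaL / p.etaT) ^ (1 / p.alphaL) * r ^ (p.alphaT / p.alphaL))
def tauN (r : ℝ) : ℝ :=
  max p.h ((p.etaN / p.etaT) ^ (1 / p.alphaN) * r ^ (p.alphaT / p.alphaN))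

/-- Density of the distance to the nearest terrestrial base station, cut off at `RB`. -/
def fT (r : ℝ) : ℝ :=
  if 0 ≤ r ∧ r ≤ p.RB then
    2 * Real.pi * p.lamT * r * Real.exp (-Real.pi * p.lamT * r ^ 2) else 0

/-- Density of the distance to the serving base station, given association with the mmWave tier,
where `AT` is the probability of this association. -/
def fHatT (AT r : ℝ) : ℝ :=
  p.fT r / AT *
    Real.exp (-2 * Real.pi * p.lamA * ∫ x in (0)..√(p.tauL r ^ 2 - p.h ^ 2), x * p.PL x) *
    Real.exp (-2 * Real.pi * p.lamA * ∫ x in (0)..√(p.tauN r ^ 2 - p.h ^ 2), x * p.PN x)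

/-- The summand of the exponent of the Laplace transform that belongs to the gain `G`. -/
def laplaceTerm (G s r : ℝ) : ℝ :=
  ∫ x in r..p.RB, (1 - ((1 + s * p.PT * p.CT * G / (p.mT * x ^ p.alphaT)) ^ p.mT)⁻¹) * x

/-- Laplace transform at `s` of the mmWave interference, for a serving distance `r`. -/
def laplaceI (s r : ℝ) : ℝ :=
  Real.exp (-2 * Real.pi * p.lamT *
    (p.pM * p.laplaceTerm p.GM s r + (1 - p.pM) * p.laplaceTerm p.Gm s r))

/-- The constant `m (m!)^(-1/m)`. -/
def bT : ℝ := p.mT * (p.mT.factorial : ℝ) ^ (-(1 / (p.mT : ℝ)))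

/-- The approximation of the complementary distribution function of the SINR, as a function of
the constant `c` in the exponentials. -/
def approxCCDF (AT c z : ℝ) : ℝ :=
  ∫ r in (0)..p.RB,
    (∑ k ∈ Finset.Icc 1 p.mT, (-1 : ℝ) ^ (k + 1) * (p.mT.choose k : ℝ) *
        Real.exp (-(k * c * (z * r ^ p.alphaT * p.sigma2T / (p.GM * p.PT * p.CT)))) *
        p.laplaceI (k * c * (z * r ^ p.alphaT / (p.GM * p.PT * p.CT))) r) *
      p.fHatT AT r

end Params

/-- The random network: terrestrial base stations `X i` with interference gains `G i` and channel
gains `H i`, and horizontal positions of the aerial base stations, `YL i` (line-of-sight) and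
`YN i` (non-line-of-sight). -/
structure Network (p : Params) {Ω : Type*} [MeasurableSpace Ω] (μ : Measure Ω) where
  X : ℕ → Ω → Plane
  YL : ℕ → Ω → Plane
  YN : ℕ → Ω → Plane
  G : ℕ → Ω → ℝ
  H : ℕ → Ω → ℝ
  poissonT : IsPoissonProcess μ X p.intensityT
  poissonL : IsPoissonProcess μ YL p.intensityL
  poissonN : IsPoissonProcess μ YN p.intensityN
  measurable_G : ∀ i, Measurable (G i)
  measurable_H : ∀ i, Measurable (H i)
  law_G : ∀ i, μ.map (G i) = p.gainLaw
  law_H : ∀ i, μ.map (H i) = p.fadingLaw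
  indep_G : iIndepFun G μ
  indep_H : iIndepFun H μ
  /-- the three point processes and the two sequences of marks are mutually independent -/
  indep : iIndep ![MeasurableSpace.comap (fun ω i => X i ω) inferInstance,
    MeasurableSpace.comap (fun ω i => YL i ω) inferInstance,
    MeasurableSpace.comap (fun ω i => YN i ω) inferInstance,
    MeasurableSpace.comap (fun ω i => G i ω) inferInstance,
    MeasurableSpace.comap (fun ω i => H i ω) inferInstance] μ

namespace Network

variable {p : Params} {Ω : Type*} [MeasurableSpace Ω] {μ : Measure Ω} (N : Network p μ)

/-- Distances from the user to the nearest base station of each kind. -/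
def RT (ω : Ω) : ℝ := ⨅ i, ‖N.X i ω‖
def RL (ω : Ω) : ℝ := ⨅ i, √(‖N.YL i ω‖ ^ 2 + p.h ^ 2)
def RN (ω : Ω) : ℝ := ⨅ i, √(‖N.YN i ω‖ ^ 2 + p.h ^ 2)

/-- Index of the nearest terrestrial base station. -/
def serving (ω : Ω) : ℕ := sInf {i | ∀ j, ‖N.X i ω‖ ≤ ‖N.X j ω‖}

/-- Long-term averaged received powers. -/
def powerT (ω : Ω) : ℝ := if N.RT ω ≤ p.RB then p.etaT * N.RT ω ^ (-p.alphaT) else 0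
def powerL (ω : Ω) : ℝ := p.etaL * N.RL ω ^ (-p.alphaL)
def powerN (ω : Ω) : ℝ := p.etaN * N.RN ω ^ (-p.alphaN)

/-- The event that the user is associated with the mmWave tier. -/
def assocT : Set Ω := {ω | N.powerL ω < N.powerT ω ∧ N.powerN ω < N.powerT ω}

/-- The association probability of the mmWave tier. -/
def AT : ℝ := μ.real N.assocT

/-- Interference: all terrestrial base stations in the line-of-sight ball but the serving one. -/
def interference (ω : Ω) : ℝ :=
  ∑' i, if i ≠ N.serving ω ∧ ‖N.X i ω‖ ≤ p.RB then
    N.G i ω * p.PT * p.CT * ‖N.X i ω‖ ^ (-p.alphaT) * N.H i ω else 0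

/-- The SINR of a user that is associated with the mmWave tier. -/
def sinr (ω : Ω) : ℝ :=
  p.GM * p.PT * p.CT * N.RT ω ^ (-p.alphaT) * N.H (N.serving ω) ω /
    (N.interference ω + p.sigma2T)

/-- Conditional probability given association with the mmWave tier. -/
def condT : Measure Ω := ProbabilityTheory.cond μ N.assocT

/-- Complementary distribution function of the SINR of a user of the mmWave tier. -/
def ccdf (z : ℝ) : ℝ := N.condT.real {ω | z < N.sinr ω}

/-- Ergodic rate of the mmWave tier. -/
def rate : ℝ := ∫ ω, Real.logb 2 (1 + N.sinr ω) ∂N.condT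

/-- The SINR exceeds `z` when the channel gain of the serving base station exceeds this. -/
def threshold (z : ℝ) (ω : Ω) : ℝ :=
  z * N.RT ω ^ p.alphaT * (N.interference ω + p.sigma2T) / (p.GM * p.PT * p.CT)

end Network

end HetNet

end

/-! The SINR exceeds `z` exactly when the gain `H` of the serving station exceeds the threshold τ_z
= z·r^α·(I+σ²)/η, with r the serving distance, I the interference and η = `etaT`. The interference
omits the serving station, so `H` is independent of (r, I) on the association event
(`lintegral_serving`), and the tail of the SINR is the mean of the gamma tail at τ_z (`ccdf_eq`).
The approximation is the mean of 1 - (1 - e^{-cτ_z})^m. By the binomial theorem that is a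
combination of exponentials e^{-kcτ_z}, and each mean is a Laplace transform of I at an argument
depending on r (`integral_exp_thr`, `approxCCDF_eq`).

Two facts carry the proof. The first is a deterministic inequality of Alzer type: the gamma
distribution function lies between (1 - e^{-bt})^m and (1 - e^{-mt})^m
(`pow_le_gammaMeasure_real_Iic`, `gammaMeasure_real_Iic_le_pow`). Integrated at τ_z, it gives both
bounds.

The second is the joint law of r and I (`lintegral_assocT`). For fixed positions, averaging the
marks turns e^{-sI} into a product over the stations other than the nearest (`lintegral_marks`). The
generating functional of the Poisson process (`integral_finprod`), applied to a function that
vanishes inside a disc, then gives the nearest distance and the product jointly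
(`lintegral_nearestDist_finprod`). The aerial tiers contribute only void probabilities, because
association says that their nearest stations are far enough away (`mem_assocT`, `measure_crit_lt`).

The rate formula is the layer-cake formula for log(1+γ). Integrability holds because the factor r in
the density of the serving distance makes 1/r integrable. For the limit at 0, τ_z = z·τ_1, and by
the choice of b both (1 - e^{-bt})^m and the gamma distribution function are at most (bt)^m. Hence
both outage probabilities are at most z^m·E[(bτ_1)^m], and the approximate one attains this order;
the moment is finite since r^α·I is at most a constant times a sum of gains over a Poisson number of
stations. -/

namespace HetNet

/-! ### Exponential bounds for the gamma distribution function. -/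

/-- Comparison of two functions that agree at `0` and at infinity, when the difference of their
derivatives changes sign at most once. -/
lemma le_of_deriv_sign {F₁ F₂ d₁ d₂ : ℝ → ℝ}
    (h₁ : ∀ t, 0 ≤ t → HasDerivAt F₁ (d₁ t) t) (h₂ : ∀ t, 0 ≤ t → HasDerivAt F₂ (d₂ t) t)
    (h0 : F₂ 0 = F₁ 0) {l : ℝ} (l₁ : Tendsto F₁ atTop (𝓝 l)) (l₂ : Tendsto F₂ atTop (𝓝 l))
    (hs : ∀ t₁ t₂, 0 < t₁ → t₁ < t₂ → d₂ t₂ < d₁ t₂ → d₂ t₁ ≤ d₁ t₁) {t : ℝ} (ht : 0 ≤ t) :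
    F₂ t ≤ F₁ t := by
  by_contra! hlt
  have hD : ∀ t, 0 ≤ t → HasDerivAt (fun t => F₁ t - F₂ t) (d₁ t - d₂ t) t :=
    fun t ht => (h₁ t ht).sub (h₂ t ht)
  have ht0 : 0 < t := by
    rcases ht.eq_or_lt with rfl | h
    · exact absurd h0 hlt.ne'
    · exact h
  -- If `F₁ - F₂` were negative at `t`, it would have to fall somewhere on `(0, t)` and, since it
  -- tends to `0`, rise somewhere later. The sign condition allows only the opposite order.
  obtain ⟨t₁, ht₁, e₁⟩ := exists_hasDerivAt_eq_slope (fun t => F₁ t - F₂ t) (fun t => d₁ t - d₂ t)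
    ht0 (fun x hx => (hD x hx.1).continuousAt.continuousWithinAt) (fun x hx => hD x hx.1.le)
  have hlim : Tendsto (fun t => F₁ t - F₂ t) atTop (𝓝 0) := by simpa using l₁.sub l₂
  obtain ⟨Y, hY, hYt⟩ := ((hlim.eventually (lt_mem_nhds (sub_neg.2 hlt))).and
    (eventually_gt_atTop t)).exists
  obtain ⟨t₂, ht₂, e₂⟩ := exists_hasDerivAt_eq_slope (fun t => F₁ t - F₂ t) (fun t => d₁ t - d₂ t)
    hYt (fun x hx => (hD x (ht.trans hx.1)).continuousAt.continuousWithinAt)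
    (fun x hx => hD x (ht.trans hx.1.le))
  have n₁ : d₁ t₁ - d₂ t₁ < 0 := by
    rw [e₁]; apply div_neg_of_neg_of_pos <;> linarith
  have n₂ : 0 < d₁ t₂ - d₂ t₂ := by
    rw [e₂]; apply div_pos <;> linarith
  have := hs t₁ t₂ ht₁.1 (ht₁.2.trans ht₂.1) (by linarith)
  linarith

/-- The quotient (1 - e^{-v})/v is the mean of e^{-vx} over x in [0,1], so this is Jensen's
inequality for the concave power `θ`. -/
lemma one_sub_exp_div_le_rpow {u θ : ℝ} (hu : 0 < u) (h0 : 0 < θ) (h1 : θ ≤ 1) :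
    (1 - Real.exp (-(θ * u))) / (θ * u) ≤ ((1 - Real.exp (-u)) / u) ^ θ := by
  have key : ∀ v : ℝ, 0 < v → ∫ x in (0 : ℝ)..1, Real.exp (-(v * x)) = (1 - Real.exp (-v)) / v := by
    intro v hv
    have : ∀ x ∈ uIcc (0 : ℝ) 1, HasDerivAt (fun x => -Real.exp (-(v * x)) / v)
        (Real.exp (-(v * x))) x := by
      intro x _
      have := ((((hasDerivAt_id x).const_mul v).neg.exp).neg).div_const v
      refine this.congr_deriv ?_
      simp; field_simp
    rw [intervalIntegral.integral_eq_sub_of_hasDerivAt this (by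
      apply Continuous.intervalIntegrable; fun_prop)]
    simp; ring
  have hμ : IsProbabilityMeasure (volume.restrict (Ioc (0 : ℝ) 1)) := ⟨by simp⟩
  have hint : ∀ v : ℝ, Integrable (fun x : ℝ => Real.exp (-(v * x))) (volume.restrict (Ioc 0 1)) :=
    fun v => (Continuous.integrableOn_Icc (by fun_prop)).mono_set Ioc_subset_Icc_self
  have e : ∀ x, Real.exp (-(θ * u * x)) = Real.exp (-(u * x)) ^ θ := by
    intro x; rw [← Real.exp_mul]; ring_nf
  have := (Real.concaveOn_rpow h0.le h1).le_map_integral (μ := volume.restrict (Ioc (0 : ℝ) 1))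
    (f := fun x => Real.exp (-(u * x))) (continuousOn_id.rpow_const fun x hx => Or.inr h0.le)
    isClosed_Ici (ae_of_all _ fun x => (Real.exp_pos _).le) (hint u) (by
      have := hint (θ * u); simp only [e] at this; exact this)
  rw [← key _ (by positivity), ← key _ hu, intervalIntegral.integral_of_le zero_le_one,
    intervalIntegral.integral_of_le zero_le_one]
  simp only [e]
  exact this

lemma mul_one_sub_exp_le {u θ : ℝ} (h0 : 0 ≤ θ) (h1 : θ ≤ 1) :
    θ * (1 - Real.exp (-u)) ≤ 1 - Real.exp (-(θ * u)) := by
  have := convexOn_exp.2 (mem_univ (-u)) (mem_univ 0) h0 (sub_nonneg.2 h1) (by ring)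
  simp at this
  linarith

/-- The distribution function of the gamma law with integer shape `m` and mean one. -/
lemma gammaMeasure_real_Iic {m : ℕ} (hm : 1 ≤ m) {t : ℝ} (ht : 0 ≤ t) :
    (gammaMeasure m m).real (Iic t) =
      ∫ x in (0 : ℝ)..t, (m : ℝ) ^ m / ((m - 1).factorial : ℝ) * x ^ (m - 1) *
        Real.exp (-(m * x)) := by
  have hm0 : (0 : ℝ) < m := by exact_mod_cast hm
  have : IsProbabilityMeasure (gammaMeasure m m) := isProbabilityMeasure_gammaMeasure hm0 hm0
  rw [← cdf_eq_real, cdf_gammaMeasure_eq_integral hm0 hm0, intervalIntegral.integral_of_le ht]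
  have hi : Integrable (gammaPDFReal m m) := by
    refine ⟨(measurable_gammaPDFReal _ _).aestronglyMeasurable, ?_⟩
    rw [hasFiniteIntegral_iff_ofReal (ae_of_all _ fun x => gammaPDFReal_nonneg hm0 hm0 x)]
    have := lintegral_gammaPDF_eq_one hm0 hm0
    simp only [gammaPDF] at this
    rw [this]; simp
  rw [← Iic_union_Ioc_eq_Iic ht, setIntegral_union (Iic_disjoint_Ioc le_rfl) measurableSet_Ioc
    hi.integrableOn hi.integrableOn]
  have z : ∫ x in Iic (0 : ℝ), gammaPDFReal m m x = 0 := by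
    rw [integral_Iic_eq_integral_Iio]
    apply setIntegral_eq_zero_of_forall_eq_zero
    intro x hx
    simp only [gammaPDFReal, if_neg (not_le.2 (mem_Iio.1 hx))]
  rw [z, zero_add]
  apply setIntegral_congr_fun measurableSet_Ioc
  intro x hx
  have e1 : Real.Gamma m = ((m - 1).factorial : ℝ) := by
    rw [← Real.Gamma_nat_eq_factorial]; congr 1
    rw [Nat.cast_sub hm]; simp
  have e2 : x ^ ((m : ℝ) - 1) = x ^ (m - 1) := by
    rw [← Real.rpow_natCast, Nat.cast_sub hm]; simp
  simp only [gammaPDFReal, if_pos hx.1.le, e1, e2, Real.rpow_natCast]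

lemma hasDerivAt_gamma_integral (m : ℕ) (t : ℝ) :
    HasDerivAt (fun t => ∫ x in (0 : ℝ)..t, (m : ℝ) ^ m / ((m - 1).factorial : ℝ) * x ^ (m - 1) *
        Real.exp (-(m * x)))
      ((m : ℝ) ^ m / ((m - 1).factorial : ℝ) * t ^ (m - 1) * Real.exp (-(m * t))) t :=
  intervalIntegral.integral_hasDerivAt_right (by apply Continuous.intervalIntegrable; fun_prop)
    (Continuous.stronglyMeasurableAtFilter (by fun_prop) _ _)
    (Continuous.continuousAt (by fun_prop))

lemma tendsto_gamma_integral {m : ℕ} (hm : 1 ≤ m) :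
    Tendsto (fun t => ∫ x in (0 : ℝ)..t, (m : ℝ) ^ m / ((m - 1).factorial : ℝ) * x ^ (m - 1) *
        Real.exp (-(m * x))) atTop (𝓝 1) := by
  have hm0 : (0 : ℝ) < m := by exact_mod_cast hm
  have : IsProbabilityMeasure (gammaMeasure m m) := isProbabilityMeasure_gammaMeasure hm0 hm0
  refine (tendsto_cdf_atTop (gammaMeasure m m)).congr' ?_
  filter_upwards [eventually_ge_atTop 0] with t ht
  rw [cdf_eq_real, gammaMeasure_real_Iic hm ht]

lemma hasDerivAt_one_sub_exp_pow (c : ℝ) (m : ℕ) (t : ℝ) :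
    HasDerivAt (fun t => (1 - Real.exp (-(c * t))) ^ m)
      (m * (1 - Real.exp (-(c * t))) ^ (m - 1) * (c * Real.exp (-(c * t)))) t := by
  have := ((((hasDerivAt_id t).const_mul c).neg.exp).const_sub 1).pow m
  refine this.congr_deriv ?_
  simp; ring_nf; tauto

lemma tendsto_one_sub_exp_pow {c : ℝ} (hc : 0 < c) (m : ℕ) :
    Tendsto (fun t => (1 - Real.exp (-(c * t))) ^ m) atTop (𝓝 1) := by
  have : Tendsto (fun t : ℝ => Real.exp (-(c * t))) atTop (𝓝 0) :=
    Real.tendsto_exp_neg_atTop_nhds_zero.comp (tendsto_id.const_mul_atTop hc)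
  simpa using (this.const_sub 1).pow m

/-- After cancelling e^{-mt}, comparing the derivatives means comparing ((1 - e^{-mt})/t)^{m-1} with
a constant. By `mul_one_sub_exp_le` this quotient decreases in t, so the sign changes at most once.
-/
lemma gammaMeasure_real_Iic_le_pow {m : ℕ} (hm : 1 ≤ m) {t : ℝ} (ht : 0 ≤ t) :
    (gammaMeasure m m).real (Iic t) ≤ (1 - Real.exp (-(m * t))) ^ m := by
  have hm0 : (0 : ℝ) < m := by exact_mod_cast hm
  rw [gammaMeasure_real_Iic hm ht]
  refine le_of_deriv_sign (fun t _ => hasDerivAt_one_sub_exp_pow m m t)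
    (fun t _ => hasDerivAt_gamma_integral m t) (by simp [show m ≠ 0 by omega]) (tendsto_one_sub_exp_pow hm0 m)
    (tendsto_gamma_integral hm) ?_ ht
  intro t₁ t₂ h₁ h₂ h
  set K := (m : ℝ) ^ m / ((m - 1).factorial : ℝ)
  have hK : 0 ≤ K := by positivity
  have e₂ := Real.exp_pos (-(m * t₂))
  have e₁ := Real.exp_pos (-(m * t₁))
  have h' : K * t₂ ^ (m - 1) < m * m * (1 - Real.exp (-(m * t₂))) ^ (m - 1) := by nlinarith
  have h₃ : 0 < t₂ := h₁.trans h₂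
  have hc := mul_one_sub_exp_le (u := m * t₂) (θ := t₁ / t₂) (by positivity)
    (by rw [div_le_one] <;> linarith)
  have hθ : t₁ / t₂ * (m * t₂) = m * t₁ := by field_simp
  rw [hθ] at hc
  have hp : 0 ≤ 1 - Real.exp (-(m * t₂)) := by
    rw [sub_nonneg, Real.exp_le_one_iff]; nlinarith
  have hc' := pow_le_pow_left₀ (mul_nonneg (by positivity) hp) hc (m - 1)
  rw [mul_pow] at hc'
  have : K * t₁ ^ (m - 1) ≤ m * m * (1 - Real.exp (-(m * t₁))) ^ (m - 1) := by
    calc K * t₁ ^ (m - 1) = (t₁ / t₂) ^ (m - 1) * (K * t₂ ^ (m - 1)) := by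
          rw [div_pow]; field_simp
      _ ≤ (t₁ / t₂) ^ (m - 1) * (m * m * (1 - Real.exp (-(m * t₂))) ^ (m - 1)) := by gcongr
      _ = m * m * ((t₁ / t₂) ^ (m - 1) * (1 - Real.exp (-(m * t₂))) ^ (m - 1)) := by ring
      _ ≤ _ := by gcongr
  nlinarith

lemma Params.bT_pos (p : Params) : 0 < p.bT := by
  have : (0 : ℝ) < p.mT := by exact_mod_cast p.one_le_mT
  unfold Params.bT; positivity

/-- This identity explains the choice of b: near 0 the gamma distribution function behaves like m^m
t^m / m! and (1 - e^{-bt})^m like (bt)^m, so the leading terms agree. -/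
lemma Params.bT_pow (p : Params) :
    p.bT ^ p.mT = (p.mT : ℝ) ^ p.mT / (p.mT.factorial : ℝ) := by
  have : (p.mT : ℝ) ≠ 0 := by exact_mod_cast (by have := p.one_le_mT; omega)
  have hf : (0 : ℝ) < p.mT.factorial := by positivity
  rw [Params.bT, mul_pow, ← Real.rpow_natCast (_ ^ (-(1 / (p.mT : ℝ)))), ← Real.rpow_mul hf.le]
  rw [show -(1 / (p.mT : ℝ)) * p.mT = -1 by field_simp, Real.rpow_neg_one]; rfl

lemma factorial_pred_cast {m : ℕ} (hm : 1 ≤ m) :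
    ((m.factorial : ℕ) : ℝ) = m * ((m - 1).factorial : ℝ) := by
  rw [← Nat.mul_factorial_pred (by omega)]; push_cast; ring

/-- Bound the factor e^{-mx} of the density by 1. This controls the denominator of the outage ratio
at small thresholds. -/
lemma gammaMeasure_real_Iic_le_mul_pow (p : Params) {t : ℝ} (ht : 0 ≤ t) :
    (gammaMeasure p.mT p.mT).real (Iic t) ≤ (p.bT * t) ^ p.mT := by
  have hm := p.one_le_mT
  have hm0 : (0 : ℝ) < p.mT := by exact_mod_cast hm
  rw [gammaMeasure_real_Iic hm ht, mul_pow, p.bT_pow, factorial_pred_cast hm]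
  calc _ ≤ ∫ x in (0 : ℝ)..t, (p.mT : ℝ) ^ p.mT / ((p.mT - 1).factorial : ℝ) * x ^ (p.mT - 1) := by
        apply intervalIntegral.integral_mono_on ht
          (by apply Continuous.intervalIntegrable; fun_prop)
          (by apply Continuous.intervalIntegrable; fun_prop)
        intro x hx
        apply mul_le_of_le_one_right
        · have := hx.1; positivity
        · rw [Real.exp_le_one_iff]; nlinarith [hx.1]
    _ = _ := by
        rw [intervalIntegral.integral_const_mul, integral_pow, ← Nat.cast_succ,
          show (p.mT - 1).succ = p.mT by omega, show p.mT - 1 + 1 = p.mT by omega,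
          zero_pow (by omega)]
        field_simp; ring

/-- Divided by m·b·(bs)^{m-1}·e^{-bs}, the comparison of derivatives reads q(bs)^{m-1} ≤ e^{(b-m)s}
with q(v) = (1 - e^{-v})/v. Passing from t₂ to t₁ = θt₂ raises the right side to the power θ
exactly, while the left side becomes at most its θ-th power by `one_sub_exp_div_le_rpow`. The
inequality thus propagates to smaller arguments. -/
lemma pow_le_gammaMeasure_real_Iic (p : Params) {t : ℝ} (ht : 0 ≤ t) :
    (1 - Real.exp (-(p.bT * t))) ^ p.mT ≤ (gammaMeasure p.mT p.mT).real (Iic t) := by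
  have hm := p.one_le_mT
  have hb := p.bT_pos
  have hbp := p.bT_pow
  rw [gammaMeasure_real_Iic hm ht]
  rw [factorial_pred_cast hm] at hbp
  set m := p.mT
  set b := p.bT
  have hm0 : (0 : ℝ) < m := by exact_mod_cast hm
  refine le_of_deriv_sign (fun t _ => hasDerivAt_gamma_integral m t)
    (fun t _ => hasDerivAt_one_sub_exp_pow b m t)
    (by simp [show m ≠ 0 by omega]) (tendsto_gamma_integral hm) (tendsto_one_sub_exp_pow hb m) ?_ ht
  have hK : (m : ℝ) ^ m / ((m - 1).factorial : ℝ) = m * b * b ^ (m - 1) := by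
    rw [mul_assoc, ← pow_succ', show m - 1 + 1 = m by omega, hbp]; field_simp
  rw [hK]
  -- both derivatives, divided by a common positive factor
  have cmp : ∀ s : ℝ, 0 < s →
      (m * (1 - Real.exp (-(b * s))) ^ (m - 1) * (b * Real.exp (-(b * s)))
        ≤ m * b * b ^ (m - 1) * s ^ (m - 1) * Real.exp (-(m * s)) ↔
      ((1 - Real.exp (-(b * s))) / (b * s)) ^ (m - 1) ≤ Real.exp ((b - m) * s)) := by
    intro s hs
    have e : Real.exp (-(m * s)) = Real.exp ((b - m) * s) * Real.exp (-(b * s)) := by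
      rw [← Real.exp_add]; ring_nf
    rw [e, div_pow, div_le_iff₀ (by positivity), mul_pow]
    have hE := Real.exp_pos (-(b * s))
    have hmb : 0 < m * b * Real.exp (-(b * s)) := by positivity
    rw [← mul_le_mul_iff_right₀ hmb (b := (1 - Real.exp (-(b * s))) ^ (m - 1))]
    ring_nf
  intro t₁ t₂ h₁ h₂ h
  have h₂' : 0 < t₂ := h₁.trans h₂
  rw [cmp t₁ h₁]
  have h' := (cmp t₂ h₂').1 h.le
  have hθ : t₁ / t₂ * (b * t₂) = b * t₁ := by field_simp
  have hc := one_sub_exp_div_le_rpow (u := b * t₂) (θ := t₁ / t₂) (by positivity) (by positivity)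
    (by rw [div_le_one] <;> linarith)
  rw [hθ] at hc
  have pos : ∀ v : ℝ, 0 < v → 0 ≤ (1 - Real.exp (-v)) / v := fun v hv =>
    div_nonneg (by rw [sub_nonneg, Real.exp_le_one_iff]; linarith) hv.le
  have hq := pos (b * t₂) (by positivity)
  calc _ ≤ (((1 - Real.exp (-(b * t₂))) / (b * t₂)) ^ (t₁ / t₂)) ^ (m - 1) :=
        pow_le_pow_left₀ (pos _ (by positivity)) hc _
    _ = (((1 - Real.exp (-(b * t₂))) / (b * t₂)) ^ (m - 1)) ^ (t₁ / t₂) := by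
        rw [← Real.rpow_natCast, ← Real.rpow_natCast, ← Real.rpow_mul hq, ← Real.rpow_mul hq,
          mul_comm (t₁ / t₂)]
    _ ≤ (Real.exp ((b - m) * t₂)) ^ (t₁ / t₂) :=
        Real.rpow_le_rpow (by positivity) h' (by positivity)
    _ = _ := by rw [← Real.exp_mul]; congr 1; field_simp

/-! ### Laplace transform and moments of the gamma law. -/

lemma measurable_gammaPDF (a r : ℝ) : Measurable (gammaPDF a r) :=
  (measurable_gammaPDFReal a r).ennreal_ofReal

/-- Exponential tilting: e^{-tx} times the density of rate m is the constant on the right times the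
density of rate m + t, which has mass one. -/
lemma lintegral_exp_neg_gammaMeasure {m : ℕ} (hm : 1 ≤ m) {t : ℝ} (ht : 0 ≤ t) :
    ∫⁻ x, ENNReal.ofReal (Real.exp (-(t * x))) ∂(gammaMeasure m m) =
      ENNReal.ofReal (((1 + t / m) ^ m)⁻¹) := by
  have hm0 : (0 : ℝ) < m := by exact_mod_cast hm
  have hmt : (0 : ℝ) < m + t := by linarith
  rw [gammaMeasure, lintegral_withDensity_eq_lintegral_mul _
    (measurable_gammaPDF _ _) (by fun_prop)]
  rw [← mul_one (ENNReal.ofReal (((1 + t / m) ^ m)⁻¹)), ← lintegral_gammaPDF_eq_one hm0 hmt,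
    ← lintegral_const_mul _ (measurable_gammaPDF _ _)]
  congr 1; ext x
  simp only [Pi.mul_apply, gammaPDF]
  rw [← ENNReal.ofReal_mul (gammaPDFReal_nonneg hm0 hm0 x), ← ENNReal.ofReal_mul (by positivity)]
  congr 1
  unfold gammaPDFReal
  split_ifs
  · rw [Real.rpow_natCast, Real.rpow_natCast, show -((m + t) * x) = -(m * x) + -(t * x) by ring,
      Real.exp_add, show (m : ℝ) + t = m * (1 + t / m) by field_simp, mul_pow]
    have : (0 : ℝ) < 1 + t / m := by positivity
    field_simp
  · simp

/-- For x > 0, x^k times the density is a constant multiple of the gamma density of shape m + k. -/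
lemma lintegral_pow_gammaMeasure_lt_top {m : ℕ} (hm : 1 ≤ m) (k : ℕ) :
    ∫⁻ x, ENNReal.ofReal x ^ k ∂(gammaMeasure m m) < ⊤ := by
  have hm0 : (0 : ℝ) < m := by exact_mod_cast hm
  have hmk : (0 : ℝ) < m + k := by positivity
  rw [gammaMeasure, lintegral_withDensity_eq_lintegral_mul _
    (measurable_gammaPDF _ _) (by fun_prop)]
  set K := (m : ℝ) ^ (m : ℝ) / Real.Gamma m / ((m : ℝ) ^ ((m : ℝ) + k) / Real.Gamma (m + k)) with hKd
  have g1 := Real.Gamma_pos_of_pos hm0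
  have g2 := Real.Gamma_pos_of_pos hmk
  have hK : 0 ≤ K := by positivity
  calc _ ≤ ∫⁻ x, ENNReal.ofReal K * gammaPDF (m + k) m x := ?_
    _ = ENNReal.ofReal K := by
      rw [lintegral_const_mul _ (measurable_gammaPDF _ _),
        lintegral_gammaPDF_eq_one hmk hm0, mul_one]
    _ < ⊤ := ENNReal.ofReal_lt_top
  refine lintegral_mono_ae ?_
  -- Splitting the real power x^{m-1+k} requires x > 0, so the origin is discarded.
  have : ∀ᵐ x : ℝ, x ≠ 0 := by simp [ae_iff]
  filter_upwards [this] with x hx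
  rcases lt_or_gt_of_ne hx with h | h
  · simp [gammaPDF_of_neg h]
  simp only [Pi.mul_apply, gammaPDF]
  rw [← ENNReal.ofReal_pow h.le, ← ENNReal.ofReal_mul (gammaPDFReal_nonneg hm0 hm0 x),
    ← ENNReal.ofReal_mul hK]
  apply le_of_eq
  congr 1
  simp only [gammaPDFReal, if_pos h.le]
  rw [show (m : ℝ) + k - 1 = (m - 1) + k by ring, Real.rpow_add h (m - 1) k, Real.rpow_natCast _ k, hKd]
  field_simp

lemma ae_nonneg_gammaMeasure (a r : ℝ) : ∀ᵐ x ∂(gammaMeasure a r), 0 ≤ x := by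
  rw [ae_iff]
  simp only [not_le]
  change gammaMeasure a r (Iio 0) = 0
  rw [gammaMeasure, withDensity_apply _ measurableSet_Iio, lintegral_gammaPDF_of_nonpos le_rfl]

/-! ### The generating functional of a Poisson process. -/

namespace IsPoissonProcess

variable {Ω : Type*} [MeasurableSpace Ω] {μ : Measure Ω} {X : ℕ → Ω → Plane} {Λ : Measure Plane}

lemma measurable_count (h : IsPoissonProcess μ X Λ) {B : Set Plane} (hB : MeasurableSet B) :
    Measurable fun ω => {i | X i ω ∈ B}.encard := by
  refine measurable_encard.comp (measurable_set_iff.2 fun i => ?_)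
  exact measurableSet_setOfPred.1 (h.measurable i hB)

/-- `count_law` speaks only of finite values, but these Poisson weights already sum to one. -/
lemma ae_count_ne_top [IsProbabilityMeasure μ] (h : IsPoissonProcess μ X Λ) {B : Set Plane}
    (hB : MeasurableSet B) (hΛ : Λ B ≠ ⊤) : ∀ᵐ ω ∂μ, {i | X i ω ∈ B}.encard ≠ ⊤ := by
  have hm := h.measurable_count hB
  have hu : {ω | {i | X i ω ∈ B}.encard ≠ ⊤} =
      ⋃ n : ℕ, {ω | {i | X i ω ∈ B}.encard = (n : ℕ∞)} := by
    ext ω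
    simp only [mem_ofPred_eq, mem_iUnion, ENat.ne_top_iff_exists, eq_comm]
  have hms : ∀ n : ℕ, MeasurableSet {ω | {i | X i ω ∈ B}.encard = (n : ℕ∞)} := fun n =>
    hm (measurableSet_singleton (n : ℕ∞))
  change {ω | {i | X i ω ∈ B}.encard ≠ ⊤} ∈ ae μ
  rw [mem_ae_iff_prob_eq_one (hu ▸ MeasurableSet.iUnion hms), hu,
    measure_iUnion _ hms]
  · simp_rw [h.count_law B hB hΛ]
    have hs : HasSum (fun n : ℕ => Real.exp (-(Λ B).toReal) * (Λ B).toReal ^ n / (n.factorial : ℝ))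
        1 := by
      have := (NormedSpace.expSeries_div_hasSum_exp (Λ B).toReal).mul_left
        (Real.exp (-(Λ B).toReal))
      rw [← Real.exp_eq_exp_ℝ, ← Real.exp_add, neg_add_cancel, Real.exp_zero] at this
      simpa only [mul_div_assoc] using this
    rw [← ENNReal.ofReal_tsum_of_nonneg (fun n => by positivity) hs.summable, hs.tsum_eq,
      ENNReal.ofReal_one]
  · intro m n hmn
    rw [Function.onFun, Set.disjoint_left]
    intro ω h1 h2
    simp only [mem_ofPred_eq] at h1 h2
    rw [h1] at h2
    exact hmn (by exact_mod_cast h2)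

lemma lintegral_count [IsProbabilityMeasure μ] (h : IsPoissonProcess μ X Λ) {B : Set Plane}
    (hB : MeasurableSet B) (hΛ : Λ B ≠ ⊤) (f : ℕ → ENNReal) :
    ∫⁻ ω, f ({i | X i ω ∈ B}.encard.toNat) ∂μ = ∑' n, f n *
      ENNReal.ofReal (Real.exp (-(Λ B).toReal) * (Λ B).toReal ^ n / (n.factorial : ℝ)) := by
  have hm : Measurable fun ω => {i | X i ω ∈ B}.encard.toNat :=
    (Measurable.of_discrete (f := ENat.toNat)).comp (h.measurable_count hB)
  rw [← lintegral_map (f := f) Measurable.of_discrete hm, lintegral_countable']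
  congr 1; ext n
  congr 1
  rw [Measure.map_apply hm (measurableSet_singleton n), ← h.count_law B hB hΛ n]
  apply measure_congr
  filter_upwards [h.ae_count_ne_top hB hΛ] with ω hω
  apply propext
  change {i | X i ω ∈ B}.encard.toNat = n ↔ {i | X i ω ∈ B}.encard = n
  conv_rhs => rw [← ENat.natCast_toNat hω]
  exact_mod_cast Iff.rfl

/-- The generating function of a Poisson variable. Since `0 ^ 0 = 1`, the case `v = 0` is the void
probability, which is what later lets a test function vanish on a disc. -/
lemma integral_pow_count [IsProbabilityMeasure μ] (h : IsPoissonProcess μ X Λ) {B : Set Plane}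
    (hB : MeasurableSet B) (hΛ : Λ B ≠ ⊤) {v : ℝ} (hv : 0 ≤ v) :
    ∫ ω, v ^ ({i | X i ω ∈ B}.encard.toNat) ∂μ = Real.exp (-(Λ.real B * (1 - v))) := by
  have hm : Measurable fun ω => {i | X i ω ∈ B}.encard.toNat :=
    (Measurable.of_discrete (f := ENat.toNat)).comp (h.measurable_count hB)
  rw [integral_eq_lintegral_of_nonneg_ae (ae_of_all _ fun ω => by positivity)
    (measurable_const.pow hm).aestronglyMeasurable,
    h.lintegral_count hB hΛ fun n => ENNReal.ofReal (v ^ n)]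
  simp_rw [← ENNReal.ofReal_mul (pow_nonneg hv _)]
  set l := (Λ B).toReal
  have hs : HasSum (fun n : ℕ => v ^ n * (Real.exp (-l) * l ^ n / (n.factorial : ℝ)))
      (Real.exp (-(l * (1 - v)))) := by
    have := (NormedSpace.expSeries_div_hasSum_exp (v * l)).mul_left (Real.exp (-l))
    rw [← Real.exp_eq_exp_ℝ, ← Real.exp_add] at this
    rw [show -(l * (1 - v)) = -l + v * l by ring]
    refine this.congr_fun fun n => ?_
    rw [mul_pow]; ring
  have hl : 0 ≤ l := ENNReal.toReal_nonneg
  rw [← ENNReal.ofReal_tsum_of_nonneg (fun n => by positivity) hs.summable, hs.tsum_eq,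
    ENNReal.toReal_ofReal (Real.exp_pos _).le]
  rfl

lemma finprod_mem_simpleFunc {s : Set ℕ} (hs : s.Finite) (y : ℕ → Plane) (φ : SimpleFunc Plane ℝ)
    {B : Set Plane} (hsB : s = {i | y i ∈ B}) :
    ∏ᶠ i ∈ s, φ (y i) = ∏ v ∈ φ.range, v ^ ({i | y i ∈ B ∩ φ ⁻¹' {v}}.encard.toNat) := by
  classical
  rw [finprod_mem_eq_finite_toFinset_prod _ hs, ← Finset.prod_fiberwise_of_maps_to
    (t := φ.range) (g := fun i => φ (y i)) (fun i _ => φ.mem_range_self _)]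
  refine Finset.prod_congr rfl fun v _ => ?_
  rw [Finset.prod_congr rfl (g := fun _ => v) (fun i hi => (Finset.mem_filter.1 hi).2),
    Finset.prod_const]
  congr 1
  have : {i | y i ∈ B ∩ φ ⁻¹' {v}} = ((hs.toFinset.filter fun i => φ (y i) = v : Finset ℕ) : Set ℕ) := by
    ext i; simp [hsB]
  rw [this, Set.encard_coe_eq_coe_finsetCard]; simp

/-- The fibres of `φ` cut `B` into disjoint sets with independent Poisson counts. Each contributes
exp(-Λ(fibre)(1 - v)), and the exponents add up to the integral of 1 - φ. -/
lemma simpleFunc_laplace [IsProbabilityMeasure μ] (h : IsPoissonProcess μ X Λ) {B : Set Plane}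
    (hB : MeasurableSet B) (hΛ : Λ B ≠ ⊤) (φ : SimpleFunc Plane ℝ) (hφ : ∀ y, 0 ≤ φ y) :
    ∫ ω, ∏ v ∈ φ.range, v ^ ({i | X i ω ∈ B ∩ φ ⁻¹' {v}}.encard.toNat) ∂μ =
      Real.exp (-∫ y in B, (1 - φ y) ∂Λ) := by
  classical
  let e := φ.range.equivFin
  let D : Fin φ.range.card → Set Plane := fun j => B ∩ φ ⁻¹' {(e.symm j : ℝ)}
  have hD : ∀ j, MeasurableSet (D j) := fun j => hB.inter (φ.measurableSet_fiber _)
  have hdisj : ∀ j k, j ≠ k → Disjoint (D j) (D k) := by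
    intro j k hjk
    rw [Set.disjoint_left]
    rintro y ⟨_, h1⟩ ⟨_, h2⟩
    simp only [mem_preimage, mem_singleton_iff] at h1 h2
    exact hjk (e.symm.injective (Subtype.ext (h1.symm.trans h2)))
  have hΛD : ∀ j, Λ (D j) ≠ ⊤ := fun j => measure_ne_top_of_subset inter_subset_left hΛ
  have hrange : ∀ F : ℝ → ℝ, ∏ v ∈ φ.range, F v = ∏ j, F (e.symm j) := by
    intro F
    rw [← Finset.prod_coe_sort]
    exact (Equiv.prod_comp e.symm fun v => F v).symm
  have hrange' : ∀ F : ℝ → ℝ, ∑ v ∈ φ.range, F v = ∑ j, F (e.symm j) := by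
    intro F
    rw [← Finset.sum_coe_sort]
    exact (Equiv.sum_comp e.symm fun v => F v).symm
  simp_rw [hrange]
  have := (h.count_indep _ D hD hdisj).integral_fun_prod_comp
    (f := fun j n => (e.symm j : ℝ) ^ (ENat.toNat n))
    (fun j => (h.measurable_count (hD j)).aemeasurable)
    (fun j => Measurable.of_discrete.aestronglyMeasurable)
  refine this.trans ?_
  have hv : ∀ j, (0 : ℝ) ≤ e.symm j := by
    intro j
    obtain ⟨y, hy⟩ := SimpleFunc.mem_range.1 (e.symm j).2
    rw [← hy]; exact hφ y
  rw [Finset.prod_congr rfl fun j _ => h.integral_pow_count (hD j) (hΛD j) (hv j),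
    ← Real.exp_sum]
  congr 1
  rw [Finset.sum_neg_distrib]
  congr 1
  have hfin : IsFiniteMeasure (Λ.restrict B) := ⟨by simpa using hΛ.lt_top⟩
  have hr : ∀ v, (Λ.restrict B).real (φ ⁻¹' {v}) = Λ.real (B ∩ φ ⁻¹' {v}) := by
    intro v
    rw [measureReal_restrict_apply (φ.measurableSet_fiber _), inter_comm]
  have hone : ∑ v ∈ φ.range, (Λ.restrict B).real (φ ⁻¹' {v}) = (Λ.restrict B).real univ := by
    rw [sum_measureReal_preimage_singleton _ fun v _ => φ.measurableSet_fiber v]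
    congr 1
    ext y; simp
  rw [integral_sub (integrable_const _) (SimpleFunc.integrable_of_isFiniteMeasure φ),
    integral_const, ← hone,
    φ.integral_eq_sum (SimpleFunc.integrable_of_isFiniteMeasure φ), smul_eq_mul, mul_one, ← Finset.sum_sub_distrib,
    hrange' fun v => _]
  refine Finset.sum_congr rfl fun j _ => ?_
  rw [hr, smul_eq_mul]; ring

/-- The product of a function over the points of a Poisson process in a set of finite intensity is
the limit of bounded measurable functions of the numbers of points. -/
lemma exists_approx_finprod [IsProbabilityMeasure μ] (h : IsPoissonProcess μ X Λ) {B : Set Plane}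
    (hB : MeasurableSet B) (hΛ : Λ B ≠ ⊤) {φ : Plane → ℝ} (hφ : Measurable φ)
    (hφI : ∀ y, φ y ∈ Icc (0 : ℝ) 1) :
    ∃ F : ℕ → Ω → ℝ, (∀ n, Measurable (F n)) ∧ (∀ n ω, ‖F n ω‖ ≤ 1) ∧
      (∀ᵐ ω ∂μ, Tendsto (fun n => F n ω) atTop (𝓝 (∏ᶠ i ∈ {i | X i ω ∈ B}, φ (X i ω)))) ∧
      Tendsto (fun n => ∫ ω, F n ω ∂μ) atTop (𝓝 (Real.exp (-∫ y in B, (1 - φ y) ∂Λ))) := by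
  have hfin : IsFiniteMeasure (Λ.restrict B) := ⟨by simpa using hΛ.lt_top⟩
  -- The approximants take values in [0,1], so the products are bounded by 1 and dominated
  -- convergence applies. The products converge only where the count is finite, hence almost surely.
  let f : ℕ → SimpleFunc Plane ℝ := SimpleFunc.approxOn φ hφ (Icc (0 : ℝ) 1) 0 (by simp)
  have hfI : ∀ n y, f n y ∈ Icc (0 : ℝ) 1 := fun n y => SimpleFunc.approxOn_mem hφ _ n y
  have hlim : ∀ y, Tendsto (fun n => f n y) atTop (𝓝 (φ y)) := fun y =>
    SimpleFunc.tendsto_approxOn hφ _ (subset_closure (hφI y))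
  refine ⟨fun n ω => ∏ v ∈ (f n).range, v ^ ({i | X i ω ∈ B ∩ f n ⁻¹' {v}}.encard.toNat),
    fun n => ?_, fun n ω => ?_, ?_, ?_⟩
  · refine Finset.measurable_fun_prod _ fun v _ => ?_
    exact (Measurable.of_discrete (f := fun n : ℕ∞ => v ^ n.toNat)).comp
      (h.measurable_count (hB.inter ((f n).measurableSet_fiber v)))
  · rw [Real.norm_eq_abs, Finset.abs_prod]
    refine Finset.prod_le_one (fun _ _ => abs_nonneg _) fun v hv => ?_
    obtain ⟨y, rfl⟩ := SimpleFunc.mem_range.1 hv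
    rw [abs_of_nonneg (pow_nonneg (hfI n y).1 _)]
    exact pow_le_one₀ (hfI n y).1 (hfI n y).2
  · filter_upwards [h.ae_count_ne_top hB hΛ] with ω hω
    have hs := Set.encard_ne_top_iff.1 hω
    change Tendsto _ _ (𝓝 (∏ᶠ i ∈ {i | X i ω ∈ B}, φ (X i ω)))
    rw [finprod_mem_eq_finite_toFinset_prod _ hs]
    refine Tendsto.congr (fun n => (finprod_mem_eq_finite_toFinset_prod _ hs).symm.trans
      (finprod_mem_simpleFunc hs (fun i => X i ω) (f n) rfl)) ?_
    exact tendsto_finsetProd _ fun i _ => hlim _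
  · simp_rw [fun n => h.simpleFunc_laplace hB hΛ (f n) fun y => (hfI n y).1]
    refine (Real.continuous_exp.tendsto _).comp (Tendsto.neg ?_)
    refine tendsto_integral_of_dominated_convergence (fun _ => 1) (fun n => ?_)
      (integrable_const _) (fun n => ?_) ?_
    · exact (measurable_const.sub (f n).measurable).aestronglyMeasurable
    · refine ae_of_all _ fun y => ?_
      rw [Real.norm_eq_abs, abs_of_nonneg (sub_nonneg.2 (hfI n y).2)]
      linarith [(hfI n y).1]
    · exact ae_of_all _ fun y => (hlim y).const_sub 1

lemma aemeasurable_finprod [IsProbabilityMeasure μ] (h : IsPoissonProcess μ X Λ) {B : Set Plane}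
    (hB : MeasurableSet B) (hΛ : Λ B ≠ ⊤) {φ : Plane → ℝ} (hφ : Measurable φ)
    (hφI : ∀ y, φ y ∈ Icc (0 : ℝ) 1) :
    AEMeasurable (fun ω => ∏ᶠ i ∈ {i | X i ω ∈ B}, φ (X i ω)) μ := by
  obtain ⟨F, hF, -, hl, -⟩ := h.exists_approx_finprod hB hΛ hφ hφI
  exact aemeasurable_of_tendsto_metrizable_ae _ (fun n => (hF n).aemeasurable) hl

/-- The probability generating functional of a Poisson process. -/
theorem integral_finprod [IsProbabilityMeasure μ] (h : IsPoissonProcess μ X Λ) {B : Set Plane}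
    (hB : MeasurableSet B) (hΛ : Λ B ≠ ⊤) {φ : Plane → ℝ} (hφ : Measurable φ)
    (hφI : ∀ y, φ y ∈ Icc (0 : ℝ) 1) :
    ∫ ω, ∏ᶠ i ∈ {i | X i ω ∈ B}, φ (X i ω) ∂μ = Real.exp (-∫ y in B, (1 - φ y) ∂Λ) := by
  obtain ⟨F, hF, hb, hl, hi⟩ := h.exists_approx_finprod hB hΛ hφ hφI
  exact tendsto_nhds_unique (tendsto_integral_of_dominated_convergence (fun _ => 1)
    (fun n => (hF n).aestronglyMeasurable) (integrable_const _) (fun n => ae_of_all _ (hb n)) hl) hi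

end IsPoissonProcess

/-! ### Radial integrals and elementary facts on the parameters. -/

lemma integral_fun_norm_plane (f : ℝ → ℝ) :
    ∫ y : Plane, f ‖y‖ = 2 * Real.pi * ∫ x in Ioi (0 : ℝ), x * f x := by
  rw [integral_fun_norm_addHaar volume f]
  have hb : (volume : Measure Plane).real (Metric.ball 0 1) = Real.pi := by
    rw [measureReal_def, InnerProductSpace.volume_ball_of_dim_even (k := 1) (by simp)]
    simp [Real.pi_nonneg]
  rw [hb]
  simp
  ring

lemma setIntegral_closedBall_norm {R : ℝ} (hR : 0 ≤ R) (f : ℝ → ℝ) :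
    ∫ y in Metric.closedBall (0 : Plane) R, f ‖y‖ = 2 * Real.pi * ∫ x in (0 : ℝ)..R, x * f x := by
  rw [← integral_indicator measurableSet_closedBall]
  have : (Metric.closedBall (0 : Plane) R).indicator (fun y => f ‖y‖) =
      fun y => (Iic R).indicator f ‖y‖ := by
    ext y; simp [indicator]
  rw [this, integral_fun_norm_plane, intervalIntegral.integral_of_le hR,
    ← integral_indicator measurableSet_Ioi, ← integral_indicator measurableSet_Ioc]
  congr 2
  ext x
  by_cases h1 : 0 < x <;> by_cases h2 : x ≤ R <;> simp [indicator, h1, h2]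

namespace Params
variable (p : Params)

lemma PL_mem (x : ℝ) : p.PL x ∈ Icc (0 : ℝ) 1 := by
  have h : 0 < p.a * Real.exp (-p.b * (180 / Real.pi) * Real.arctan (p.h / x - p.a)) :=
    mul_pos p.a_pos (Real.exp_pos _)
  unfold PL
  refine ⟨by positivity, ?_⟩
  rw [div_le_one (by positivity)]; linarith

lemma PN_mem (x : ℝ) : p.PN x ∈ Icc (0 : ℝ) 1 := by
  have := p.PL_mem x
  unfold PN
  exact ⟨by linarith [this.2], by linarith [this.1]⟩

lemma measurable_PL : Measurable p.PL := by unfold PL; fun_prop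
lemma measurable_PN : Measurable p.PN := measurable_const.sub p.measurable_PL

lemma etaT_pos : 0 < p.etaT := mul_pos (mul_pos p.GM_pos p.PT_pos) p.CT_pos
lemma etaL_pos : 0 < p.etaL := mul_pos (mul_pos p.an_pos p.PA_pos) p.CL_pos
lemma etaN_pos : 0 < p.etaN := mul_pos (mul_pos p.an_pos p.PA_pos) p.CN_pos

lemma pM_mem : p.pM ∈ Icc (0 : ℝ) 1 := by
  have h1 := p.thetaA_mem
  have h2 := p.thetaD_mem
  have hp := Real.pi_pos
  unfold pM
  refine ⟨mul_nonneg (div_nonneg h1.1 (by positivity)) (div_nonneg h2.1 hp.le), ?_⟩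
  refine mul_le_one₀ ?_ (div_nonneg h2.1 hp.le) ?_
  · rw [div_le_one (by positivity)]; exact h1.2
  · rw [div_le_one (by positivity)]; exact h2.2

end Params

/-- Intensity of a ball for a process with radial intensity `lam * P |y|`. -/
lemma withDensity_closedBall {lam : ℝ} (hl : 0 ≤ lam) {P : ℝ → ℝ} (hP : Measurable P)
    (hPI : ∀ x, P x ∈ Icc (0 : ℝ) 1) {R : ℝ} (hR : 0 ≤ R) :
    (volume.withDensity fun y : Plane => ENNReal.ofReal (lam * P ‖y‖)) (Metric.closedBall 0 R) =
      ENNReal.ofReal (2 * Real.pi * lam * ∫ x in (0 : ℝ)..R, x * P x) := by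
  have hfin : IsFiniteMeasure ((volume : Measure Plane).restrict (Metric.closedBall 0 R)) :=
    ⟨by
      rw [Measure.restrict_apply_univ]; exact measure_closedBall_lt_top⟩
  rw [withDensity_apply _ measurableSet_closedBall, ← ofReal_integral_eq_lintegral_ofReal]
  · rw [integral_const_mul, setIntegral_closedBall_norm hR]
    congr 1; ring
  · refine (Integrable.of_bound (C := 1) (hP.comp measurable_norm).aestronglyMeasurable (ae_of_all _ fun y => ?_)).const_mul lam
    rw [Function.comp_apply, Real.norm_eq_abs, abs_of_nonneg (hPI _).1]; exact (hPI _).2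
  · exact ae_of_all _ fun y => mul_nonneg hl (hPI _).1

lemma intensityT_closedBall_ne_top (p : Params) (R : ℝ) :
    p.intensityT (Metric.closedBall 0 R) ≠ ⊤ := by
  simp only [Params.intensityT, Measure.smul_apply, smul_eq_mul]
  exact ENNReal.mul_ne_top ENNReal.ofReal_ne_top measure_closedBall_lt_top.ne

/-! ### The nearest point of a sequence and void probabilities. -/

/-- Sequences of points without accumulation points. -/
def LocallyFinite (x : ℕ → Plane) : Prop := ∀ R : ℝ, {i | x i ∈ Metric.closedBall 0 R}.Finite

/-- Distance of the nearest point of a sequence, and its first index. -/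
noncomputable def nearestDist (x : ℕ → Plane) : ℝ := ⨅ i, ‖x i‖
noncomputable def nearestIdx (x : ℕ → Plane) : ℕ := sInf {i | ∀ j, ‖x i‖ ≤ ‖x j‖}

lemma nearestDist_le (x : ℕ → Plane) (i : ℕ) : nearestDist x ≤ ‖x i‖ :=
  ciInf_le ⟨0, by rintro _ ⟨j, rfl⟩; exact norm_nonneg _⟩ i

lemma nearestDist_nonneg (x : ℕ → Plane) : 0 ≤ nearestDist x :=
  Real.iInf_nonneg fun _ => norm_nonneg _

lemma le_nearestDist {x : ℕ → Plane} {u : ℝ} : u ≤ nearestDist x ↔ ∀ i, u ≤ ‖x i‖ :=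
  ⟨fun h i => h.trans (nearestDist_le x i), fun h => le_ciInf h⟩

lemma LocallyFinite.exists_nearest {x : ℕ → Plane} (hx : LocallyFinite x) :
    ∃ i, ∀ j, ‖x i‖ ≤ ‖x j‖ := by
  have hne : (hx ‖x 0‖).toFinset.Nonempty := ⟨0, by simp⟩
  obtain ⟨i, hi, hmin⟩ := Finset.exists_min_image _ (fun i => ‖x i‖) hne
  refine ⟨i, fun j => ?_⟩
  by_cases hj : ‖x j‖ ≤ ‖x 0‖
  · exact hmin j (by simpa using hj)
  · have : ‖x i‖ ≤ ‖x 0‖ := by simpa using hi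
    linarith

lemma LocallyFinite.norm_nearestIdx {x : ℕ → Plane} (hx : LocallyFinite x) :
    ‖x (nearestIdx x)‖ = nearestDist x :=
  le_antisymm (le_nearestDist.2 (Nat.sInf_mem (s := {i | ∀ j, ‖x i‖ ≤ ‖x j‖}) hx.exists_nearest))
    (nearestDist_le _ _)

/-- The strict inequality needs the infimum to be attained, hence local finiteness; `le_nearestDist`
does not. -/
lemma LocallyFinite.lt_nearestDist {x : ℕ → Plane} (hx : LocallyFinite x) {u : ℝ} :
    u < nearestDist x ↔ ∀ i, u < ‖x i‖ :=
  ⟨fun h i => h.trans_le (nearestDist_le x i), fun h => hx.norm_nearestIdx ▸ h _⟩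

lemma measurable_nearestDist : Measurable nearestDist := by
  unfold nearestDist
  exact Measurable.iInf fun i => (measurable_pi_apply i).norm

lemma measurable_nearestIdx : Measurable nearestIdx := by
  have hS : ∀ k, MeasurableSet {x : ℕ → Plane | ∀ j, ‖x k‖ ≤ ‖x j‖} := fun k => by
    rw [ofPred_forall]
    exact MeasurableSet.iInter fun j =>
      measurableSet_le (measurable_pi_apply k).norm (measurable_pi_apply j).norm
  refine measurable_to_countable' fun k => ?_
  -- Either `k` is the first minimiser, or no minimiser exists and `sInf ∅ = 0` forces `k = 0`.
  have : nearestIdx ⁻¹' {k} = ({x : ℕ → Plane | ∀ j, ‖x k‖ ≤ ‖x j‖} ∩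
      ⋂ l, ⋂ _ : l < k, {x : ℕ → Plane | ∀ j, ‖x l‖ ≤ ‖x j‖}ᶜ) ∪
      ({x : ℕ → Plane | k = 0} ∩ ⋂ l, {x : ℕ → Plane | ∀ j, ‖x l‖ ≤ ‖x j‖}ᶜ) := by
    ext x
    simp only [mem_preimage, mem_singleton_iff, mem_union, mem_inter_iff, mem_iInter,
      mem_compl_iff, mem_ofPred_eq]
    constructor
    · rintro rfl
      by_cases hne : {i | ∀ j, ‖x i‖ ≤ ‖x j‖}.Nonempty
      · exact Or.inl ⟨Nat.sInf_mem hne, fun l hl => Nat.notMem_of_lt_sInf hl⟩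
      · rw [not_nonempty_iff_eq_empty] at hne
        refine Or.inr ⟨by simp [nearestIdx, hne], fun l hl => ?_⟩
        have : l ∈ {i | ∀ j, ‖x i‖ ≤ ‖x j‖} := hl
        simp [hne] at this
    · rintro (⟨h1, h2⟩ | ⟨rfl, h2⟩)
      · refine le_antisymm (Nat.sInf_le h1) ?_
        by_contra! hlt
        exact h2 _ hlt (Nat.sInf_mem (s := {i | ∀ j, ‖x i‖ ≤ ‖x j‖}) ⟨k, h1⟩)
      · have : {i | ∀ j, ‖x i‖ ≤ ‖x j‖} = ∅ := by
          ext l; simpa using h2 l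
        simp [nearestIdx, this]
  rw [this]
  refine ((hS k).inter ?_).union (MeasurableSet.inter (MeasurableSet.const _) ?_)
  · exact MeasurableSet.iInter fun l => MeasurableSet.iInter fun _ => (hS l).compl
  · exact MeasurableSet.iInter fun l => (hS l).compl

namespace IsPoissonProcess

variable {Ω : Type*} [MeasurableSpace Ω] {μ : Measure Ω} {X : ℕ → Ω → Plane} {Λ : Measure Plane}

lemma ae_locallyFinite [IsProbabilityMeasure μ] (h : IsPoissonProcess μ X Λ)
    (hΛ : ∀ R, Λ (Metric.closedBall 0 R) ≠ ⊤) : ∀ᵐ ω ∂μ, LocallyFinite fun i => X i ω := by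
  have : ∀ᵐ ω ∂μ, ∀ n : ℕ, {i | X i ω ∈ Metric.closedBall 0 (n : ℝ)}.encard ≠ ⊤ :=
    ae_all_iff.2 fun n => h.ae_count_ne_top measurableSet_closedBall (hΛ n)
  filter_upwards [this] with ω hω R
  obtain ⟨n, hn⟩ := exists_nat_ge R
  exact (Set.encard_ne_top_iff.1 (hω n)).subset fun i hi => Metric.closedBall_subset_closedBall hn hi

lemma measurable_seq (h : IsPoissonProcess μ X Λ) : Measurable fun ω i => X i ω :=
  measurable_pi_iff.2 h.measurable

lemma measure_lt_nearestDist [IsProbabilityMeasure μ] (h : IsPoissonProcess μ X Λ)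
    (hΛ : ∀ R, Λ (Metric.closedBall 0 R) ≠ ⊤) (R : ℝ) :
    μ {ω | R < nearestDist fun i => X i ω} =
      ENNReal.ofReal (Real.exp (-(Λ (Metric.closedBall 0 R)).toReal)) := by
  have := h.count_law _ measurableSet_closedBall (hΛ R) 0
  simp only [pow_zero, mul_one, Nat.factorial_zero, Nat.cast_one, div_one] at this
  rw [← this]
  apply measure_congr
  filter_upwards [h.ae_locallyFinite hΛ] with ω hω
  apply propext
  change (R < nearestDist fun i => X i ω) ↔ {i | X i ω ∈ Metric.closedBall 0 R}.encard = ((0 : ℕ) : ℕ∞)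
  rw [hω.lt_nearestDist, Nat.cast_zero, Set.encard_eq_zero, Set.eq_empty_iff_forall_notMem]
  simp

/-- Distance to the nearest station when the stations are at height `h` above the points. -/
lemma measure_lt_iInf_sqrt [IsProbabilityMeasure μ] (hX : IsPoissonProcess μ X Λ)
    (hΛ : ∀ R, Λ (Metric.closedBall 0 R) ≠ ⊤) (h0 : Λ {0} = 0) {h : ℝ} (hh : 0 < h) (c : ℝ) :
    μ {ω | c < ⨅ i, √(‖X i ω‖ ^ 2 + h ^ 2)} =
      ENNReal.ofReal (Real.exp (-(Λ (Metric.closedBall 0 √(max h c ^ 2 - h ^ 2))).toReal)) := by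
  rcases lt_or_ge c h with hc | hc
  -- Below the height the event is certain, and on the right the ball shrinks to the origin, which
  -- has no mass: both sides equal 1.
  · have : {ω | c < ⨅ i, √(‖X i ω‖ ^ 2 + h ^ 2)} = univ := by
      ext ω
      simp only [mem_ofPred_eq, mem_univ, iff_true]
      refine hc.trans_le (le_ciInf fun i => Real.le_sqrt_of_sq_le (by nlinarith [sq_nonneg ‖X i ω‖]))
    rw [this, max_eq_left hc.le]
    simp [h0]
  · rw [max_eq_right hc, ← hX.measure_lt_nearestDist hΛ]
    apply measure_congr
    filter_upwards [hX.ae_locallyFinite hΛ] with ω hω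
    apply propext
    change (c < ⨅ i, √(‖X i ω‖ ^ 2 + h ^ 2)) ↔ √(c ^ 2 - h ^ 2) < nearestDist fun i => X i ω
    have hnn := nearestDist_nonneg fun i => X i ω
    have e : ⨅ i, √(‖X i ω‖ ^ 2 + h ^ 2) = √((nearestDist fun i => X i ω) ^ 2 + h ^ 2) := by
      apply le_antisymm
      · rw [← hω.norm_nearestIdx]
        exact ciInf_le ⟨0, by rintro _ ⟨j, rfl⟩; exact Real.sqrt_nonneg _⟩ _
      · refine le_ciInf fun i => Real.sqrt_le_sqrt ?_
        have := nearestDist_le (fun i => X i ω) i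
        gcongr
    rw [e, Real.lt_sqrt (hh.le.trans hc), Real.sqrt_lt (by nlinarith) hnn, sub_lt_iff_lt_add]

end IsPoissonProcess

/-! ### Joint law of the nearest distance and a product over the other points. -/

/-- Exponent of the generating functional of the points between distances `r` and `R`. -/
noncomputable def radialExponent (R : ℝ) (ψ : ℝ → ℝ) (r : ℝ) : ℝ := ∫ x in r..R, (1 - ψ x) * x

section radial

variable {R : ℝ} {ψ : ℝ → ℝ}

lemma intervalIntegrable_radial (hψ : Measurable ψ) (hI : ∀ x, ψ x ∈ Icc (0 : ℝ) 1) (a b : ℝ) :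
    IntervalIntegrable (fun x => (1 - ψ x) * x) volume a b := by
  refine (continuous_id.intervalIntegrable a b).mono_fun
    ((measurable_const.sub hψ).mul measurable_id).aestronglyMeasurable (ae_of_all _ fun x => ?_)
  have := hI x
  simp only [norm_mul, id, Real.norm_eq_abs]
  rw [abs_of_nonneg (by linarith [this.2])]
  exact mul_le_of_le_one_left (abs_nonneg _) (by linarith [this.1])

lemma continuous_radialExponent (hψ : Measurable ψ) (hI : ∀ x, ψ x ∈ Icc (0 : ℝ) 1) :
    Continuous (radialExponent R ψ) := by
  have : radialExponent R ψ = fun r => -∫ x in R..r, (1 - ψ x) * x := by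
    ext r; rw [radialExponent, intervalIntegral.integral_symm]
  rw [this]
  exact (intervalIntegral.continuous_primitive (intervalIntegrable_radial hψ hI) R).neg

lemma hasDerivAt_radialExponent (hψ : Measurable ψ) (hI : ∀ x, ψ x ∈ Icc (0 : ℝ) 1)
    (hc : ContinuousOn ψ (Ioi 0)) {r : ℝ} (hr : 0 < r) :
    HasDerivAt (radialExponent R ψ) (-((1 - ψ r) * r)) r := by
  refine intervalIntegral.integral_hasDerivAt_left (intervalIntegrable_radial hψ hI r R) ?_ ?_
  · exact ((measurable_const.sub hψ).mul measurable_id).stronglyMeasurable.stronglyMeasurableAtFilter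
  · exact (continuousAt_const.sub (hc.continuousAt (Ioi_mem_nhds hr))).mul continuousAt_id

/-- The void probability contributes 2πλr to the logarithmic derivative and the radial exponent
contributes -2πλ(1 - ψ(r))r. What remains is 2πλrψ(r), where ψ(r) is the factor of the nearest point
itself. -/
lemma hasDerivAt_exp_radial (lam : ℝ) (hψ : Measurable ψ) (hI : ∀ x, ψ x ∈ Icc (0 : ℝ) 1)
    (hc : ContinuousOn ψ (Ioi 0)) {r : ℝ} (hr : 0 < r) :
    HasDerivAt (fun r => -(Real.exp (-Real.pi * lam * r ^ 2) *
        Real.exp (-2 * Real.pi * lam * radialExponent R ψ r)))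
      (ψ r * (2 * Real.pi * lam * r * Real.exp (-Real.pi * lam * r ^ 2) *
        Real.exp (-2 * Real.pi * lam * radialExponent R ψ r))) r := by
  have h1 := ((hasDerivAt_pow 2 r).const_mul (-Real.pi * lam)).exp
  have h2 := ((hasDerivAt_radialExponent (R := R) hψ hI hc hr).const_mul
    (-2 * Real.pi * lam)).exp
  refine (h1.mul h2).neg.congr_deriv ?_
  simp; ring

end radial

lemma mul_mul_inv_cancel {a b w : ENNReal} (h0 : a ≠ 0) (ht : a ≠ ⊤) :
    a * b * (w * a⁻¹) = w * b := by
  calc a * b * (w * a⁻¹) = (a * a⁻¹) * (w * b) := by ring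
    _ = w * b := by rw [ENNReal.mul_inv_cancel h0 ht, one_mul]

namespace IsPoissonProcess

variable {Ω : Type*} [MeasurableSpace Ω] {μ : Measure Ω} [IsProbabilityMeasure μ]
  {X : ℕ → Ω → Plane} {lam : ℝ}

lemma homogeneous_closedBall_ne_top (lam R : ℝ) :
    (ENNReal.ofReal lam • volume : Measure Plane) (Metric.closedBall 0 R) ≠ ⊤ := by
  simp only [Measure.smul_apply, smul_eq_mul]
  exact ENNReal.mul_ne_top ENNReal.ofReal_ne_top measure_closedBall_lt_top.ne

/-- Replace `ψ` by 0 on distances below `u`. The product then vanishes as soon as a point lies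
closer than `u`, so the generating functional of the modified function restricts to the event by
itself. -/
lemma setLIntegral_finprod_le_nearestDist (hl : 0 ≤ lam)
    (h : IsPoissonProcess μ X (ENNReal.ofReal lam • volume)) {R : ℝ} {ψ : ℝ → ℝ}
    (hψ : Measurable ψ) (hI : ∀ x, ψ x ∈ Icc (0 : ℝ) 1) {u : ℝ} (hu : 0 ≤ u) (huR : u ≤ R) :
    ∫⁻ ω in {ω | u ≤ nearestDist fun i => X i ω},
        ENNReal.ofReal (∏ᶠ i ∈ {i | X i ω ∈ Metric.closedBall 0 R}, ψ ‖X i ω‖) ∂μ =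
      ENNReal.ofReal (Real.exp (-Real.pi * lam * u ^ 2) *
        Real.exp (-2 * Real.pi * lam * radialExponent R ψ u)) := by
  have hfin := homogeneous_closedBall_ne_top lam
  have hmeas : MeasurableSet {ω | u ≤ nearestDist fun i => X i ω} :=
    (measurable_nearestDist.comp h.measurable_seq) measurableSet_Ici
  let φ : ℝ → ℝ := fun x => if x < u then 0 else ψ x
  have hφ : Measurable φ := Measurable.ite measurableSet_Iio measurable_const hψ
  have hφI : ∀ x, φ x ∈ Icc (0 : ℝ) 1 := fun x => by
    by_cases hx : x < u <;> simp only [φ, hx, if_true, if_false]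
    · simp
    · exact hI x
  have key := h.integral_finprod measurableSet_closedBall (hfin R)
    (φ := fun y => φ ‖y‖) (hφ.comp measurable_norm) fun y => hφI _
  have hae := h.aemeasurable_finprod measurableSet_closedBall (hfin R)
    (φ := fun y => φ ‖y‖) (hφ.comp measurable_norm) fun y => hφI _
  have hexp : -∫ y in Metric.closedBall (0 : Plane) R, (1 - φ ‖y‖) ∂(ENNReal.ofReal lam • volume) =
      -Real.pi * lam * u ^ 2 + -2 * Real.pi * lam * radialExponent R ψ u := by
    rw [Measure.restrict_smul, integral_smul_measure, ENNReal.toReal_ofReal hl,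
      setIntegral_closedBall_norm (hu.trans huR) (fun x => 1 - φ x)]
    have hint : ∀ a b, IntervalIntegrable (fun x => x * (1 - φ x)) volume a b := fun a b => by
      simpa only [mul_comm] using intervalIntegrable_radial hφ hφI a b
    rw [← intervalIntegral.integral_add_adjacent_intervals (hint 0 u) (hint u R)]
    have e1 : ∫ x in (0 : ℝ)..u, x * (1 - φ x) = u ^ 2 / 2 := by
      have : ∫ x in (0 : ℝ)..u, x * (1 - φ x) = ∫ x in (0 : ℝ)..u, x := by
        refine intervalIntegral.integral_congr_ae ?_
        have hne : ∀ᵐ x : ℝ, x ≠ u := by simp [ae_iff]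
        filter_upwards [hne] with x hxu hx
        rw [uIoc_of_le hu] at hx
        simp [φ, lt_of_le_of_ne hx.2 hxu]
      rw [this, integral_id]; ring
    have e2 : ∫ x in u..R, x * (1 - φ x) = radialExponent R ψ u := by
      refine intervalIntegral.integral_congr fun x hx => ?_
      rw [uIcc_of_le huR] at hx
      simp [φ, not_lt.2 hx.1, mul_comm]
    rw [e1, e2, smul_eq_mul]; ring
  rw [← Real.exp_add, ← hexp, ← key, ofReal_integral_eq_lintegral_ofReal, ← lintegral_indicator hmeas]
  · apply lintegral_congr_ae
    refine (h.ae_locallyFinite hfin).mono fun ω hω => ?_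
    by_cases hn : u ≤ nearestDist fun i => X i ω
    · rw [indicator_of_mem (by exact hn)]
      congr 1
      refine finprod_mem_congr rfl fun i _ => ?_
      simp [φ, not_lt.2 (le_nearestDist.1 hn i)]
    · rw [indicator_of_notMem (by exact hn)]
      rw [le_nearestDist] at hn
      push Not at hn
      obtain ⟨i, hi⟩ := hn
      have : ∏ᶠ i ∈ {i | X i ω ∈ Metric.closedBall 0 R}, φ ‖X i ω‖ = 0 := by
        rw [finprod_mem_eq_finite_toFinset_prod _ (hω R)]
        refine Finset.prod_eq_zero (i := i) ?_ (by simp [φ, hi])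
        simpa using hi.le.trans huR
      simp only [this, ENNReal.ofReal_zero]
  · refine Integrable.of_bound (C := 1) hae.aestronglyMeasurable ?_
    refine (h.ae_locallyFinite hfin).mono fun ω hω => ?_
    rw [finprod_mem_eq_finite_toFinset_prod _ (hω R), Real.norm_eq_abs, Finset.abs_prod]
    refine Finset.prod_le_one (fun _ _ => abs_nonneg _) fun i _ => ?_
    rw [abs_of_nonneg (hφI _).1]; exact (hφI _).2
  · exact ae_of_all _ fun ω => finprod_nonneg fun i => finprod_nonneg fun _ => (hφI _).1

/-- Joint law of the distance of the nearest point and of a product over the points within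
distance `R`. -/
lemma map_nearestDist_finprod (hl : 0 ≤ lam)
    (h : IsPoissonProcess μ X (ENNReal.ofReal lam • volume)) {R : ℝ} (hR : 0 < R) {ψ : ℝ → ℝ}
    (hψ : Measurable ψ) (hI : ∀ x, ψ x ∈ Icc (0 : ℝ) 1) (hc : ContinuousOn ψ (Ioi 0)) :
    ((μ.withDensity fun ω => ENNReal.ofReal
        (∏ᶠ i ∈ {i | X i ω ∈ Metric.closedBall 0 R}, ψ ‖X i ω‖)).map
          fun ω => nearestDist fun i => X i ω).restrict (Iic R) =
      (volume.restrict (Ioc 0 R)).withDensity fun r => ENNReal.ofReal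
        (ψ r * (2 * Real.pi * lam * r * Real.exp (-Real.pi * lam * r ^ 2) *
          Real.exp (-2 * Real.pi * lam * radialExponent R ψ r))) := by
  have hfin := homogeneous_closedBall_ne_top lam
  have hmn : Measurable fun ω => nearestDist fun i => X i ω :=
    measurable_nearestDist.comp h.measurable_seq
  set E : ℝ → ℝ := fun r => Real.exp (-Real.pi * lam * r ^ 2) *
        Real.exp (-2 * Real.pi * lam * radialExponent R ψ r) with hE
  set D : ℝ → ℝ := fun r => ψ r * (2 * Real.pi * lam * r * Real.exp (-Real.pi * lam * r ^ 2) *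
          Real.exp (-2 * Real.pi * lam * radialExponent R ψ r)) with hD
  set P : Ω → ENNReal := fun ω => ENNReal.ofReal
    (∏ᶠ i ∈ {i | X i ω ∈ Metric.closedBall 0 R}, ψ ‖X i ω‖) with hP
  have hP1 : ∀ᵐ ω ∂μ, P ω ≤ 1 := by
    filter_upwards [h.ae_locallyFinite hfin] with ω hω
    rw [hP]
    simp only
    rw [finprod_mem_eq_finite_toFinset_prod _ (hω R), ENNReal.ofReal_le_one]
    exact Finset.prod_le_one (fun _ _ => (hI _).1) fun _ _ => (hI _).2
  have hD0 : ∀ r, 0 ≤ r → 0 ≤ D r := fun r hr => by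
    have := (hI r).1
    have := Real.pi_pos
    simp only [hD]; positivity
  have hDm : Measurable D := by
    have := (continuous_radialExponent (R := R) hψ hI).measurable
    simp only [hD]; fun_prop
  have hDle : ∀ r, 0 ≤ r → D r ≤ 2 * Real.pi * lam * r * Real.exp (-Real.pi * lam * r ^ 2) *
      Real.exp (-2 * Real.pi * lam * radialExponent R ψ r) := fun r hr =>
    mul_le_of_le_one_left (by have := Real.pi_pos; positivity) (hI r).2
  have hDi : ∀ a b, 0 ≤ a → a ≤ b → IntervalIntegrable D volume a b := by
    intro a b ha hab
    have hcont : Continuous fun r => 2 * Real.pi * lam * r * Real.exp (-Real.pi * lam * r ^ 2) *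
        Real.exp (-2 * Real.pi * lam * radialExponent R ψ r) := by
      have := continuous_radialExponent (R := R) hψ hI
      fun_prop
    refine (hcont.intervalIntegrable a b).mono_fun hDm.aestronglyMeasurable ?_
    refine (ae_restrict_iff' measurableSet_uIoc).2 (ae_of_all _ fun r hr => ?_)
    rw [uIoc_of_le hab] at hr
    have hr0 := ha.trans hr.1.le
    simp only [Real.norm_eq_abs]
    rw [abs_of_nonneg (hD0 r hr0)]
    exact (hDle r hr0).trans (le_abs_self _)
  have hER : ENNReal.ofReal (E R) = μ {ω | R < nearestDist fun i => X i ω} := by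
    rw [h.measure_lt_nearestDist hfin R, hE]
    have := setIntegral_closedBall_norm hR.le fun _ => 1
    simp only [integral_const, smul_eq_mul, mul_one, measureReal_restrict_apply_univ, integral_id] at this
    simp only [radialExponent, intervalIntegral.integral_same, mul_zero, Real.exp_zero, mul_one,
      Measure.smul_apply, smul_eq_mul, ENNReal.toReal_mul, ENNReal.toReal_ofReal hl]
    rw [← measureReal_def, this]
    congr 2; ring
  -- If the nearest point lies beyond `R`, the product is empty and equals 1, so that event
  -- contributes `E R`. Removing it from the preceding lemma leaves `E u - E R`, which is the
  -- integral of `D` since `-E` has derivative `D`.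
  have tail : ∀ u, 0 ≤ u → u ≤ R →
      ∫⁻ ω in {ω | u ≤ (nearestDist fun i => X i ω) ∧ (nearestDist fun i => X i ω) ≤ R}, P ω ∂μ =
      ∫⁻ r in Icc u R, ENNReal.ofReal (D r) := by
    intro u hu huR
    have e1 := h.setLIntegral_finprod_le_nearestDist hl hψ hI hu huR
    have e2 : ∫⁻ ω in {ω | R < nearestDist fun i => X i ω}, P ω ∂μ = ENNReal.ofReal (E R) := by
      rw [hER, ← setLIntegral_one]
      refine setLIntegral_congr_fun (hmn measurableSet_Ioi) fun ω hω => ?_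
      have hω' : ∀ i, R < ‖X i ω‖ := fun i => lt_of_lt_of_le hω (nearestDist_le (fun i => X i ω) i)
      have : {i | X i ω ∈ Metric.closedBall 0 R} = ∅ := by
        ext i; simp [hω' i]
      simp only [hP, this, finprod_mem_empty, ENNReal.ofReal_one]
    have e3 : {ω | u ≤ nearestDist fun i => X i ω} =
        {ω | u ≤ (nearestDist fun i => X i ω) ∧ (nearestDist fun i => X i ω) ≤ R} ∪
          {ω | R < nearestDist fun i => X i ω} := by
      ext ω
      simp only [mem_ofPred_eq, mem_union]
      constructor
      · intro h
        rcases le_or_gt (nearestDist fun i => X i ω) R with h' | h'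
        · exact Or.inl ⟨h, h'⟩
        · exact Or.inr h'
      · rintro (h | h)
        · exact h.1
        · exact huR.trans h.le
    have hmR : MeasurableSet {ω | R < nearestDist fun i => X i ω} := hmn measurableSet_Ioi
    rw [e3, lintegral_union hmR] at e1
    · rw [e2] at e1
      have ftc : ∫ r in u..R, D r = E u - E R := by
        have := intervalIntegral.integral_eq_sub_of_hasDerivAt_of_le huR (f := fun r => - E r)
          (f' := D) ?_ (fun r hr => hasDerivAt_exp_radial lam hψ hI hc (hu.trans_lt hr.1))
          (hDi u R hu huR)
        · rw [this]; ring
        · have := continuous_radialExponent (R := R) hψ hI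
          simp only [hE]
          exact Continuous.continuousOn (by fun_prop)
      have hle : 0 ≤ E u - E R := by
        rw [← ftc]
        exact intervalIntegral.integral_nonneg huR fun r hr => hD0 r (hu.trans hr.1)
      rw [setLIntegral_congr Ioc_ae_eq_Icc.symm, ← ofReal_integral_eq_lintegral_ofReal
        (hDi u R hu huR).1 ((ae_restrict_iff' measurableSet_Ioc).2
          (ae_of_all _ fun r hr => hD0 r (hu.trans hr.1.le))),
        ← intervalIntegral.integral_of_le huR, ftc]
      have hERne : ENNReal.ofReal (E R) ≠ ⊤ := ENNReal.ofReal_ne_top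
      rw [← ENNReal.add_left_inj hERne, e1, ← ENNReal.ofReal_add hle (by positivity)]
      congr 1
      simp only [hE]; ring
    · rw [Set.disjoint_left]
      rintro ω h1 h2
      exact absurd h1.2 (not_le.2 h2)
  have hpre : ∀ u, {ω | u ≤ (nearestDist fun i => X i ω) ∧ (nearestDist fun i => X i ω) ≤ R} =
      (fun ω => nearestDist fun i => X i ω) ⁻¹' (Ici u ∩ Iic R) := fun u => rfl
  -- Finiteness, which follows from the product being at most 1 almost surely, allows identifying
  -- the two measures on half-lines.
  have hfm : IsFiniteMeasure (μ.withDensity P) := by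
    refine isFiniteMeasure_withDensity (ne_of_lt ((lintegral_mono_ae hP1).trans_lt ?_))
    simp
  refine Measure.ext_of_Ici _ _ fun u => ?_
  rw [Measure.restrict_apply measurableSet_Ici, Measure.map_apply hmn
    (measurableSet_Ici.inter measurableSet_Iic), withDensity_apply _ 
    (hmn (measurableSet_Ici.inter measurableSet_Iic)), withDensity_apply _ measurableSet_Ici,
    Measure.restrict_restrict measurableSet_Ici]
  rcases lt_or_ge R u with huR | huR
  · have h1 : Ici u ∩ Iic R = ∅ := by
      ext x; simp; intro hx; linarith
    have h2 : Ici u ∩ Ioc 0 R = ∅ := by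
      ext x; simp; intro hx _; linarith
    rw [h1, h2]; simp
  · have h1 : (fun ω => nearestDist fun i => X i ω) ⁻¹' (Ici u ∩ Iic R) =
        (fun ω => nearestDist fun i => X i ω) ⁻¹' (Ici (max u 0) ∩ Iic R) := by
      ext ω
      have := nearestDist_nonneg fun i => X i ω
      simp [this]
    rw [h1, ← hpre, tail _ (le_max_right _ _) (max_le huR hR.le)]
    refine setLIntegral_congr ?_
    rcases le_or_gt u 0 with hu | hu
    · rw [max_eq_right hu, show Ici u ∩ Ioc 0 R = Ioc 0 R from
        inter_eq_right.2 fun x hx => hu.trans hx.1.le]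
      exact Ioc_ae_eq_Icc.symm
    · rw [max_eq_left hu.le, show Ici u ∩ Ioc 0 R = Icc u R by
        ext x; simp only [mem_inter_iff, mem_Ici, mem_Ioc, mem_Icc]
        exact ⟨fun h => ⟨h.1, h.2.2⟩, fun h => ⟨h.1, hu.trans_le h.1, h.2⟩⟩]
      exact ae_eq_refl _

/-- Integral of a function of the distance of the nearest point times a product over the
other points within distance `R`. -/
theorem lintegral_nearestDist_finprod (hl : 0 ≤ lam)
    (h : IsPoissonProcess μ X (ENNReal.ofReal lam • volume)) {R : ℝ} (hR : 0 < R) {ψ : ℝ → ℝ}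
    (hψ : Measurable ψ) (hI : ∀ x, ψ x ∈ Ioc (0 : ℝ) 1) (hc : ContinuousOn ψ (Ioi 0))
    {w : ℝ → ENNReal} (hw : Measurable w) :
    ∫⁻ ω in {ω | (nearestDist fun i => X i ω) ≤ R}, w (nearestDist fun i => X i ω) * ENNReal.ofReal
        (∏ᶠ i ∈ {i | i ≠ nearestIdx (fun i => X i ω) ∧ ‖X i ω‖ ≤ R}, ψ ‖X i ω‖) ∂μ =
      ∫⁻ r in Ioc 0 R, w r * ENNReal.ofReal
        (2 * Real.pi * lam * r * Real.exp (-Real.pi * lam * r ^ 2) *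
          Real.exp (-2 * Real.pi * lam * radialExponent R ψ r)) := by
  have hfin := homogeneous_closedBall_ne_top lam
  have hmn : Measurable fun ω => nearestDist fun i => X i ω :=
    measurable_nearestDist.comp h.measurable_seq
  have hI' : ∀ x, ψ x ∈ Icc (0 : ℝ) 1 := fun x => ⟨(hI x).1.le, (hI x).2⟩
  have hmap := h.map_nearestDist_finprod hl hR hψ hI' hc
  -- The full product contains the factor of the nearest point; integrating `w / ψ` instead of `w`
  -- divides it out. This is why `ψ` has to be strictly positive here.
  have hwψ : Measurable fun r => w r * (ENNReal.ofReal (ψ r))⁻¹ := hw.mul hψ.ennreal_ofReal.inv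
  have hPm := h.aemeasurable_finprod measurableSet_closedBall (hfin R)
    (φ := fun y => ψ ‖y‖) (hψ.comp measurable_norm) fun y => hI' _
  have hDm : Measurable fun r => ENNReal.ofReal
        (ψ r * (2 * Real.pi * lam * r * Real.exp (-Real.pi * lam * r ^ 2) *
          Real.exp (-2 * Real.pi * lam * radialExponent R ψ r))) := by
    have := (continuous_radialExponent (R := R) hψ hI').measurable
    fun_prop
  have e := congrArg (fun ν : Measure ℝ => ∫⁻ r, w r * (ENNReal.ofReal (ψ r))⁻¹ ∂ν) hmap
  beta_reduce at e
  rw [lintegral_withDensity_eq_lintegral_mul _ hDm hwψ, Measure.restrict_map hmn measurableSet_Iic,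
    lintegral_map hwψ hmn, restrict_withDensity (hmn measurableSet_Iic),
    lintegral_withDensity_eq_lintegral_mul₀ hPm.ennreal_ofReal.restrict
      (g := fun ω => w (nearestDist fun i => X i ω) *
        (ENNReal.ofReal (ψ (nearestDist fun i => X i ω)))⁻¹) (hwψ.comp hmn).aemeasurable] at e
  refine Eq.trans ?_ (e.trans ?_)
  · refine lintegral_congr_ae ?_
    refine (ae_restrict_iff' (hmn measurableSet_Iic)).2 ?_
    refine (h.ae_locallyFinite hfin).mono fun ω hω hωR => ?_
    have hωR' : (nearestDist fun i => X i ω) ≤ R := hωR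
    have hfs : {i | X i ω ∈ Metric.closedBall 0 R}.Finite := hω R
    have hmem : nearestIdx (fun i => X i ω) ∈ hfs.toFinset := by
      have := hω.norm_nearestIdx
      rw [Set.Finite.mem_toFinset]
      exact mem_closedBall_zero_iff.2 (this.trans_le hωR')
    have hs : {i | i ≠ nearestIdx (fun i => X i ω) ∧ ‖X i ω‖ ≤ R} =
        ((hfs.toFinset.erase (nearestIdx fun i => X i ω) : Finset ℕ) : Set ℕ) := by
      ext i; simp [and_comm]
    simp only [Pi.mul_apply]
    rw [hs, finprod_mem_coe_finset, finprod_mem_eq_finite_toFinset_prod _ hfs,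
      ← Finset.mul_prod_erase _ _ hmem, hω.norm_nearestIdx, ENNReal.ofReal_mul (hI _).1.le]
    have h0 : ENNReal.ofReal (ψ (nearestDist fun i => X i ω)) ≠ 0 := by
      simpa using (hI _).1
    exact (mul_mul_inv_cancel h0 ENNReal.ofReal_ne_top).symm
  · refine setLIntegral_congr_fun measurableSet_Ioc fun r hr => ?_
    have h0 : ENNReal.ofReal (ψ r) ≠ 0 := by simpa using (hI _).1
    simp only [Pi.mul_apply]
    rw [ENNReal.ofReal_mul (hI r).1.le]
    exact mul_mul_inv_cancel h0 ENNReal.ofReal_ne_top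

end IsPoissonProcess

/-! ### Independence, and averaging over gains and fading. -/

/-- Fubini for a function of two independent random variables. -/
lemma lintegral_comp_of_indepFun {Ω α β : Type*} [MeasurableSpace Ω] [MeasurableSpace α]
    [MeasurableSpace β] {μ : Measure Ω} [IsProbabilityMeasure μ] {f : Ω → α} {g : Ω → β}
    (hf : Measurable f) (hg : Measurable g) (hfg : IndepFun f g μ) {F : α → β → ENNReal}
    (hF : Measurable fun z : α × β => F z.1 z.2) :
    ∫⁻ ω, F (f ω) (g ω) ∂μ = ∫⁻ ω, ∫⁻ ω', F (f ω) (g ω') ∂μ ∂μ := by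
  have : IsProbabilityMeasure (μ.map g) := Measure.isProbabilityMeasure_map hg.aemeasurable
  have e := (indepFun_iff_map_prod_eq_prod_map_map hf.aemeasurable hg.aemeasurable).1 hfg
  calc ∫⁻ ω, F (f ω) (g ω) ∂μ = ∫⁻ z, F z.1 z.2 ∂(μ.map fun ω => (f ω, g ω)) := by
        rw [lintegral_map hF (hf.prodMk hg)]
    _ = ∫⁻ a, ∫⁻ b, F a b ∂(μ.map g) ∂(μ.map f) := by
        rw [e, lintegral_prod _ hF.aemeasurable]
    _ = _ := by
        rw [lintegral_map (f := fun a => ∫⁻ b, F a b ∂(μ.map g)) hF.lintegral_prod_right' hf]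
        refine lintegral_congr fun ω => ?_
        exact lintegral_map (hF.comp measurable_prodMk_left) hg

lemma measurable_lintegral_snd {Ω α β : Type*} [MeasurableSpace Ω] [MeasurableSpace α]
    [MeasurableSpace β] {μ : Measure Ω} [SFinite μ] {g : Ω → β} (hg : Measurable g)
    {F : α → β → ENNReal} (hF : Measurable fun z : α × β => F z.1 z.2) :
    Measurable fun a => ∫⁻ ω, F a (g ω) ∂μ :=
  Measurable.lintegral_prod_right' (f := fun z : α × Ω => F z.1 (g z.2))
    (hF.comp (measurable_fst.prodMk (hg.comp measurable_snd)))

lemma indepFun_of_iIndep {Ω ι α β : Type*} [MeasurableSpace Ω] [MeasurableSpace α]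
    [MeasurableSpace β] {μ : Measure Ω} {m : ι → MeasurableSpace Ω} (hle : ∀ i, m i ≤ ‹_›)
    (h : iIndep m μ) {S T : Set ι} (hST : Disjoint S T) {f : Ω → α} {g : Ω → β}
    (hf : Measurable[⨆ i ∈ S, m i] f) (hg : Measurable[⨆ i ∈ T, m i] g) : IndepFun f g μ :=
  (IndepFun_iff_Indep _ _ _).2 (indep_of_indep_of_le_left (indep_of_indep_of_le_right
    (indep_iSup_of_disjoint hle h hST) hg.comap_le) hf.comap_le)

namespace Params
variable (p : Params)

/-- Laplace transform of the power received from an interferer at distance `r`. -/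
noncomputable def gainLaplace (s r : ℝ) : ℝ :=
  p.pM * ((1 + s * p.PT * p.CT * p.GM / (p.mT * r ^ p.alphaT)) ^ p.mT)⁻¹ +
    (1 - p.pM) * ((1 + s * p.PT * p.CT * p.Gm / (p.mT * r ^ p.alphaT)) ^ p.mT)⁻¹

/-- Interference at the origin for given positions and marks. -/
noncomputable def interferenceENN (x : ℕ → Plane) (g h : ℕ → ℝ) : ENNReal :=
  ∑' i, if i ≠ nearestIdx x ∧ ‖x i‖ ≤ p.RB then
    ENNReal.ofReal (g i * p.PT * p.CT * ‖x i‖ ^ (-p.alphaT) * h i) else 0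

lemma measurable_interferenceENN : Measurable fun q : ((ℕ → Plane) × (ℕ → ℝ)) × (ℕ → ℝ) =>
    p.interferenceENN q.1.1 q.1.2 q.2 := by
  unfold interferenceENN
  refine Measurable.tsum fun i => ?_
  have hx : Measurable fun q : ((ℕ → Plane) × (ℕ → ℝ)) × (ℕ → ℝ) => ‖q.1.1 i‖ := by fun_prop
  refine Measurable.ite (MeasurableSet.inter ?_ (hx measurableSet_Iic)) ?_ measurable_const
  · have : Measurable fun q : ((ℕ → Plane) × (ℕ → ℝ)) × (ℕ → ℝ) => nearestIdx q.1.1 :=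
      measurable_nearestIdx.comp (measurable_fst.comp measurable_fst)
    exact (this (measurableSet_singleton i).compl : MeasurableSet _).congr (by
      ext q; simp only [mem_preimage, mem_compl_iff, mem_singleton_iff, eq_comm]; rfl)
  · fun_prop

lemma one_add_gain_pos {s G r : ℝ} (hs : 0 ≤ s) (hG : 0 ≤ G) (hr : 0 ≤ r) :
    1 ≤ 1 + s * p.PT * p.CT * G / (p.mT * r ^ p.alphaT) := by
  have := p.PT_pos
  have := p.CT_pos
  have : 0 ≤ s * p.PT * p.CT * G / (p.mT * r ^ p.alphaT) := by positivity
  linarith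

lemma inv_pow_gain_mem {s G r : ℝ} (hs : 0 ≤ s) (hG : 0 ≤ G) (hr : 0 ≤ r) :
    ((1 + s * p.PT * p.CT * G / (p.mT * r ^ p.alphaT)) ^ p.mT)⁻¹ ∈ Ioc (0 : ℝ) 1 := by
  have := p.one_add_gain_pos hs hG hr
  exact ⟨by positivity, inv_le_one_of_one_le₀ (one_le_pow₀ this)⟩

lemma gainLaplace_mem {s r : ℝ} (hs : 0 ≤ s) (hr : 0 ≤ r) : p.gainLaplace s r ∈ Ioc (0 : ℝ) 1 := by
  have h1 := p.inv_pow_gain_mem hs p.GM_pos.le hr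
  have h2 := p.inv_pow_gain_mem hs p.Gm_nonneg hr
  have hp := p.pM_mem
  unfold gainLaplace
  have := convex_Ioc (𝕜 := ℝ) (0 : ℝ) 1 h1 h2 hp.1 (sub_nonneg.2 hp.2) (by ring)
  simpa using this

lemma lintegral_gainLaw (f : ℝ → ℝ) (hf : Measurable f) (h1 : 0 ≤ f p.GM) (h2 : 0 ≤ f p.Gm) :
    ∫⁻ x, ENNReal.ofReal (f x) ∂p.gainLaw =
      ENNReal.ofReal (p.pM * f p.GM + (1 - p.pM) * f p.Gm) := by
  have hp := p.pM_mem
  have hp' := sub_nonneg.2 hp.2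
  rw [gainLaw, lintegral_add_measure, lintegral_smul_measure, lintegral_smul_measure,
    lintegral_dirac' _ hf.ennreal_ofReal, lintegral_dirac' _ hf.ennreal_ofReal,
    ENNReal.ofReal_add (mul_nonneg hp.1 h1) (mul_nonneg hp' h2), ENNReal.ofReal_mul hp.1,
    ENNReal.ofReal_mul hp']
  rfl

lemma ae_gainLaw : ∀ᵐ x ∂p.gainLaw, x = p.GM ∨ x = p.Gm := by
  rw [ae_iff, gainLaw]
  simp

end Params

namespace Network

variable {p : Params} {Ω : Type*} [MeasurableSpace Ω] {μ : Measure Ω} (N : Network p μ)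

lemma measurable_GSeq : Measurable fun ω i => N.G i ω := measurable_pi_iff.2 N.measurable_G
lemma measurable_HSeq : Measurable fun ω i => N.H i ω := measurable_pi_iff.2 N.measurable_H
lemma measurable_XSeq : Measurable fun ω i => N.X i ω := N.poissonT.measurable_seq
lemma measurable_YLSeq : Measurable fun ω i => N.YL i ω := N.poissonL.measurable_seq
lemma measurable_YNSeq : Measurable fun ω i => N.YN i ω := N.poissonN.measurable_seq

lemma comap_le (k : Fin 5) : (![MeasurableSpace.comap (fun ω i => N.X i ω) inferInstance,
    MeasurableSpace.comap (fun ω i => N.YL i ω) inferInstance,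
    MeasurableSpace.comap (fun ω i => N.YN i ω) inferInstance,
    MeasurableSpace.comap (fun ω i => N.G i ω) inferInstance,
    MeasurableSpace.comap (fun ω i => N.H i ω) inferInstance] : Fin 5 → MeasurableSpace Ω) k ≤ ‹_› := by
  fin_cases k
  · exact N.measurable_XSeq.comap_le
  · exact N.measurable_YLSeq.comap_le
  · exact N.measurable_YNSeq.comap_le
  · exact N.measurable_GSeq.comap_le
  · exact N.measurable_HSeq.comap_le

lemma indepFun_H : IndepFun (fun ω => ((fun i => N.X i ω, fun i => N.YL i ω, fun i => N.YN i ω),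
    fun i => N.G i ω)) (fun ω i => N.H i ω) μ := by
  refine indepFun_of_iIndep N.comap_le N.indep (S := {0, 1, 2, 3}) (T := {4}) (by simp) ?_ ?_
  · refine Measurable.prodMk (Measurable.prodMk ?_ (Measurable.prodMk ?_ ?_)) ?_
    · exact Measurable.mono (comap_measurable _)
        (le_iSup₂_of_le (0 : Fin 5) (by simp) le_rfl) le_rfl
    · exact Measurable.mono (comap_measurable _)
        (le_iSup₂_of_le (1 : Fin 5) (by simp) le_rfl) le_rfl
    · exact Measurable.mono (comap_measurable _)
        (le_iSup₂_of_le (2 : Fin 5) (by simp) le_rfl) le_rfl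
    · exact Measurable.mono (comap_measurable _)
        (le_iSup₂_of_le (3 : Fin 5) (by simp) le_rfl) le_rfl
  · exact Measurable.mono (comap_measurable _)
      (le_iSup₂_of_le (4 : Fin 5) (by simp) le_rfl) le_rfl

lemma indepFun_G : IndepFun (fun ω => (fun i => N.X i ω, fun i => N.YL i ω, fun i => N.YN i ω))
    (fun ω i => N.G i ω) μ := by
  refine indepFun_of_iIndep N.comap_le N.indep (S := {0, 1, 2}) (T := {3}) (by simp) ?_ ?_
  · refine Measurable.prodMk ?_ (Measurable.prodMk ?_ ?_)
    · exact Measurable.mono (comap_measurable _)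
        (le_iSup₂_of_le (0 : Fin 5) (by simp) le_rfl) le_rfl
    · exact Measurable.mono (comap_measurable _)
        (le_iSup₂_of_le (1 : Fin 5) (by simp) le_rfl) le_rfl
    · exact Measurable.mono (comap_measurable _)
        (le_iSup₂_of_le (2 : Fin 5) (by simp) le_rfl) le_rfl
  · exact Measurable.mono (comap_measurable _)
      (le_iSup₂_of_le (3 : Fin 5) (by simp) le_rfl) le_rfl

lemma indepFun_X : IndepFun (fun ω i => N.X i ω) (fun ω => (fun i => N.YL i ω, fun i => N.YN i ω))
    μ := by
  refine indepFun_of_iIndep N.comap_le N.indep (S := {0}) (T := {1, 2}) (by simp) ?_ ?_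
  · exact Measurable.mono (comap_measurable _)
        (le_iSup₂_of_le (0 : Fin 5) (by simp) le_rfl) le_rfl
  · refine Measurable.prodMk ?_ ?_
    · exact Measurable.mono (comap_measurable _)
        (le_iSup₂_of_le (1 : Fin 5) (by simp) le_rfl) le_rfl
    · exact Measurable.mono (comap_measurable _)
        (le_iSup₂_of_le (2 : Fin 5) (by simp) le_rfl) le_rfl

lemma indepFun_Y : IndepFun (fun ω i => N.YL i ω) (fun ω i => N.YN i ω) μ :=
  indepFun_of_iIndep N.comap_le N.indep (S := {1}) (T := {2}) (by simp)
    (Measurable.mono (comap_measurable _) (le_iSup₂_of_le (1 : Fin 5) (by simp) le_rfl) le_rfl)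
    (Measurable.mono (comap_measurable _) (le_iSup₂_of_le (2 : Fin 5) (by simp) le_rfl) le_rfl)

lemma ae_nonneg_H : ∀ᵐ ω ∂μ, ∀ i, 0 ≤ N.H i ω := by
  refine ae_all_iff.2 fun i => ?_
  refine ae_of_ae_map (N.measurable_H i).aemeasurable (p := fun x => 0 ≤ x) ?_
  rw [N.law_H i]
  exact ae_nonneg_gammaMeasure _ _

lemma ae_G : ∀ᵐ ω ∂μ, ∀ i, N.G i ω = p.GM ∨ N.G i ω = p.Gm := by
  refine ae_all_iff.2 fun i => ?_
  refine ae_of_ae_map (N.measurable_G i).aemeasurable (p := fun x => x = p.GM ∨ x = p.Gm) ?_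
  rw [N.law_G i]
  exact p.ae_gainLaw

lemma ae_nonneg_G : ∀ᵐ ω ∂μ, ∀ i, 0 ≤ N.G i ω := by
  filter_upwards [N.ae_G] with ω hω i
  rcases hω i with h | h <;> rw [h]
  exacts [p.GM_pos.le, p.Gm_nonneg]

lemma ae_locallyFinite_X [IsProbabilityMeasure μ] : ∀ᵐ ω ∂μ, LocallyFinite fun i => N.X i ω :=
  N.poissonT.ae_locallyFinite (intensityT_closedBall_ne_top p)

lemma interferenceENN_eq_sum {x : ℕ → Plane} {S : Finset ℕ}
    (hS : ∀ i, i ∈ S ↔ i ≠ nearestIdx x ∧ ‖x i‖ ≤ p.RB) (g h : ℕ → ℝ) :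
    p.interferenceENN x g h =
      ∑ i ∈ S, ENNReal.ofReal (g i * p.PT * p.CT * ‖x i‖ ^ (-p.alphaT) * h i) := by
  unfold Params.interferenceENN
  rw [tsum_eq_sum (s := S) fun i hi => by rw [if_neg (fun hc => hi ((hS i).2 hc))]]
  exact Finset.sum_congr rfl fun i hi => by rw [if_pos ((hS i).1 hi)]

lemma exp_interferenceENN {x : ℕ → Plane} {S : Finset ℕ}
    (hS : ∀ i, i ∈ S ↔ i ≠ nearestIdx x ∧ ‖x i‖ ≤ p.RB) {g h : ℕ → ℝ} (hg : ∀ i, 0 ≤ g i)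
    (hh : ∀ i, 0 ≤ h i) (s : ℝ) :
    ENNReal.ofReal (Real.exp (-(s * (p.interferenceENN x g h).toReal))) =
      ∏ i ∈ S, ENNReal.ofReal (Real.exp (-(s * p.PT * p.CT * ‖x i‖ ^ (-p.alphaT) * g i * h i))) := by
  rw [interferenceENN_eq_sum hS, ENNReal.toReal_sum fun _ _ => ENNReal.ofReal_ne_top,
    ← ENNReal.ofReal_prod_of_nonneg fun _ _ => (Real.exp_pos _).le, ← Real.exp_sum,
    Finset.mul_sum, ← Finset.sum_neg_distrib]
  congr 2
  refine Finset.sum_congr rfl fun i _ => ?_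
  have := hg i
  have := hh i
  have := p.PT_pos
  have := p.CT_pos
  rw [ENNReal.toReal_ofReal (by positivity)]
  ring

/-- Averaging over the marks for fixed positions. -/
lemma lintegral_marks [IsProbabilityMeasure μ] {x : ℕ → Plane} (hx : LocallyFinite x) {s : ℝ}
    (hs : 0 ≤ s) :
    ∫⁻ ω, ∫⁻ ω', ENNReal.ofReal (Real.exp (-(s * (p.interferenceENN x (fun i => N.G i ω)
        (fun i => N.H i ω')).toReal))) ∂μ ∂μ =
      ENNReal.ofReal (∏ᶠ i ∈ {i | i ≠ nearestIdx x ∧ ‖x i‖ ≤ p.RB}, p.gainLaplace s ‖x i‖) := by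
  have hfs : {i | i ≠ nearestIdx x ∧ ‖x i‖ ≤ p.RB}.Finite :=
    (hx p.RB).subset fun i hi => mem_closedBall_zero_iff.2 hi.2
  set S := hfs.toFinset with hSd
  have hS : ∀ i, i ∈ S ↔ i ≠ nearestIdx x ∧ ‖x i‖ ≤ p.RB := fun i => by simp [hSd]
  have hPT := p.PT_pos
  have hCT := p.CT_pos
  -- The absolute value makes each factor a nonnegative function of the gain at every real argument;
  -- almost surely it changes nothing.
  have inner : ∀ᵐ ω ∂μ, ∫⁻ ω', ENNReal.ofReal (Real.exp (-(s * (p.interferenceENN x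
        (fun i => N.G i ω) (fun i => N.H i ω')).toReal))) ∂μ = ∏ i ∈ S, ENNReal.ofReal
      (((1 + s * p.PT * p.CT * |N.G i ω| / (p.mT * ‖x i‖ ^ p.alphaT)) ^ p.mT)⁻¹) := by
    filter_upwards [N.ae_nonneg_G] with ω hω
    have hmeas : ∀ i, Measurable fun y : ℝ => ENNReal.ofReal
        (Real.exp (-(s * p.PT * p.CT * ‖x i‖ ^ (-p.alphaT) * N.G i ω * y))) := fun i => by fun_prop
    have := lintegral_prod_eq_prod_lintegral_of_indepFun S (fun i ω' => ENNReal.ofReal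
      (Real.exp (-(s * p.PT * p.CT * ‖x i‖ ^ (-p.alphaT) * N.G i ω * N.H i ω'))))
      (N.indep_H.comp _ hmeas) (fun i => (hmeas i).comp (N.measurable_H i))
    rw [lintegral_congr_ae (N.ae_nonneg_H.mono fun ω' hω' => exp_interferenceENN hS hω hω' s), this]
    refine Finset.prod_congr rfl fun i _ => ?_
    have hGi := hω i
    rw [← lintegral_map (hmeas i) (N.measurable_H i), N.law_H i, Params.fadingLaw,
      lintegral_exp_neg_gammaMeasure p.one_le_mT (by positivity), abs_of_nonneg hGi,
      Real.rpow_neg (norm_nonneg _)]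
    congr 4
    ring
  have hmeas : ∀ i, Measurable fun y : ℝ => ENNReal.ofReal
      (((1 + s * p.PT * p.CT * |y| / (p.mT * ‖x i‖ ^ p.alphaT)) ^ p.mT)⁻¹) := fun i => by fun_prop
  have := lintegral_prod_eq_prod_lintegral_of_indepFun S (fun i ω => ENNReal.ofReal
      (((1 + s * p.PT * p.CT * |N.G i ω| / (p.mT * ‖x i‖ ^ p.alphaT)) ^ p.mT)⁻¹))
      (N.indep_G.comp _ hmeas) (fun i => (hmeas i).comp (N.measurable_G i))
  rw [lintegral_congr_ae inner, this, finprod_mem_eq_finite_toFinset_prod _ hfs,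
    ENNReal.ofReal_prod_of_nonneg fun i _ => (p.gainLaplace_mem hs (norm_nonneg _)).1.le]
  refine Finset.prod_congr rfl fun i _ => ?_
  rw [← lintegral_map (hmeas i) (N.measurable_G i), N.law_G i,
    p.lintegral_gainLaw (fun y => ((1 + s * p.PT * p.CT * |y| / (p.mT * ‖x i‖ ^ p.alphaT)) ^ p.mT)⁻¹)
      (by fun_prop) (by positivity) (by positivity),
    abs_of_nonneg p.GM_pos.le, abs_of_nonneg p.Gm_nonneg]
  rfl

end Network

/-! ### The association event and the joint law of serving distance and interference. -/

/-- Solving the comparison of received powers for the aerial distance `R` turns association into a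
lower bound on that distance; this produces `critL` and `critN`. -/
lemma power_lt_power_iff {η₁ η₂ R r α β : ℝ} (h₁ : 0 < η₁) (h₂ : 0 < η₂) (hR : 0 < R) (hr : 0 < r)
    (hα : 0 < α) : η₁ * R ^ (-α) < η₂ * r ^ (-β) ↔ (η₁ / η₂) ^ (1 / α) * r ^ (β / α) < R := by
  have e : (η₁ / η₂) ^ (1 / α) * r ^ (β / α) = (η₁ / η₂ * r ^ β) ^ α⁻¹ := by
    rw [Real.mul_rpow (by positivity) (by positivity), ← Real.rpow_mul hr.le, one_div, div_eq_mul_inv β]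
  have hrβ : 0 < r ^ β := Real.rpow_pos_of_pos hr _
  have hRα : 0 < R ^ α := Real.rpow_pos_of_pos hR _
  rw [e, Real.rpow_inv_lt_iff_of_pos (by positivity) hR.le hα, Real.rpow_neg hR.le,
    Real.rpow_neg hr.le, ← div_eq_mul_inv, ← div_eq_mul_inv, div_lt_div_iff₀ hRα hrβ,
    div_mul_eq_mul_div, div_lt_iff₀ h₂, mul_comm (R ^ α)]

/-- Distance from the origin to the nearest station at height `h` above the points `y i`. -/
noncomputable def heightDist (h : ℝ) (y : ℕ → Plane) : ℝ := ⨅ i, √(‖y i‖ ^ 2 + h ^ 2)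

lemma measurable_heightDist (h : ℝ) : Measurable (heightDist h) := by
  unfold heightDist
  exact Measurable.iInf fun i => by fun_prop

lemma le_heightDist (h : ℝ) (y : ℕ → Plane) : h ≤ heightDist h y :=
  le_ciInf fun i => Real.le_sqrt_of_sq_le (by nlinarith [sq_nonneg ‖y i‖])

namespace Params
variable (p : Params)

/-- Distances that aerial stations have to exceed for association with a terrestrial station at
distance `r`. -/
noncomputable def critL (r : ℝ) : ℝ := (p.etaL / p.etaT) ^ (1 / p.alphaL) * r ^ (p.alphaT / p.alphaL)
noncomputable def critN (r : ℝ) : ℝ := (p.etaN / p.etaT) ^ (1 / p.alphaN) * r ^ (p.alphaT / p.alphaN)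

/-- Probability of association with a terrestrial station at distance `r`. -/
noncomputable def assocProb (r : ℝ) : ℝ :=
  Real.exp (-2 * Real.pi * p.lamA * ∫ x in (0)..√(p.tauL r ^ 2 - p.h ^ 2), x * p.PL x) *
    Real.exp (-2 * Real.pi * p.lamA * ∫ x in (0)..√(p.tauN r ^ 2 - p.h ^ 2), x * p.PN x)

lemma assocProb_pos (r : ℝ) : 0 < p.assocProb r := by unfold assocProb; positivity

lemma fHatT_eq (A r : ℝ) : p.fHatT A r = p.fT r * p.assocProb r / A := by
  unfold fHatT assocProb; ring

lemma measurable_critL : Measurable p.critL := by unfold critL; fun_prop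
lemma measurable_critN : Measurable p.critN := by unfold critN; fun_prop

lemma measurable_assocProb : Measurable p.assocProb := by
  have hc : ∀ P : ℝ → ℝ, Measurable P → (∀ x, P x ∈ Icc (0 : ℝ) 1) →
      Continuous fun r => ∫ x in (0 : ℝ)..r, x * P x := by
    intro P hP hI
    refine intervalIntegral.continuous_primitive (fun a b => ?_) 0
    have := intervalIntegrable_radial (measurable_const (a := (1 : ℝ)).sub hP)
      (fun x => ⟨sub_nonneg.2 (hI x).2, sub_le_self _ (hI x).1⟩) a b
    refine this.congr ?_
    exact fun x _ => by simp [mul_comm]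
  have hL : Measurable fun r => ∫ x in (0 : ℝ)..√(p.tauL r ^ 2 - p.h ^ 2), x * p.PL x :=
    (hc _ p.measurable_PL p.PL_mem).measurable.comp (by
      have := p.measurable_critL
      have : Measurable p.tauL := measurable_const.max this
      fun_prop)
  have hN : Measurable fun r => ∫ x in (0 : ℝ)..√(p.tauN r ^ 2 - p.h ^ 2), x * p.PN x :=
    (hc _ p.measurable_PN p.PN_mem).measurable.comp (by
      have := p.measurable_critN
      have : Measurable p.tauN := measurable_const.max this
      fun_prop)
  unfold assocProb
  fun_prop

lemma measurable_gainLaplace (s : ℝ) : Measurable (p.gainLaplace s) := by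
  unfold gainLaplace; fun_prop

/-- At distance 0 the quotient by 0 takes the value 0, so continuity can fail there; only positive
distances enter the density argument. -/
lemma continuousOn_gainLaplace {s : ℝ} (hs : 0 ≤ s) :
    ContinuousOn (p.gainLaplace s) (Ioi 0) := by
  have hm : (0 : ℝ) < p.mT := by exact_mod_cast p.one_le_mT
  have : ∀ G : ℝ, 0 ≤ G → ContinuousOn (fun r : ℝ =>
      ((1 + s * p.PT * p.CT * G / (p.mT * r ^ p.alphaT)) ^ p.mT)⁻¹) (Ioi 0) := by
    intro G hG r hr
    have hr' : (0 : ℝ) < r := hr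
    refine ContinuousAt.continuousWithinAt (ContinuousAt.inv₀ (ContinuousAt.pow (continuousAt_const.add
      (continuousAt_const.div (continuousAt_const.mul
        (Real.continuousAt_rpow_const _ _ (Or.inl hr'.ne')))
        (mul_pos hm (Real.rpow_pos_of_pos hr' _)).ne')) _) ?_)
    have := p.one_add_gain_pos hs hG hr'.le
    positivity
  exact (continuousOn_const.mul (this _ p.GM_pos.le)).add
    (continuousOn_const.mul (this _ p.Gm_nonneg))

/-- The Poisson lemmas need values in (0,1] at every real argument, and real powers of negative
numbers may be negative; hence the even extension. -/
lemma gainFun_mem {s : ℝ} (hs : 0 ≤ s) (x : ℝ) : p.gainLaplace s |x| ∈ Ioc (0 : ℝ) 1 :=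
  p.gainLaplace_mem hs (abs_nonneg x)

lemma measurable_gainFun (s : ℝ) : Measurable fun x => p.gainLaplace s |x| :=
  (p.measurable_gainLaplace s).comp (by fun_prop)

/-- On [0, RB] the absolute value disappears and the two gain integrals combine by linearity. This
matches the closed form with the exponent delivered by the generating functional. -/
lemma laplaceI_eq {s r : ℝ} (hs : 0 ≤ s) (hr : 0 ≤ r) (hR : r ≤ p.RB) :
    p.laplaceI s r =
      Real.exp (-2 * Real.pi * p.lamT * radialExponent p.RB (fun x => p.gainLaplace s |x|) r) := by
  unfold laplaceI laplaceTerm radialExponent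
  have hint : ∀ G : ℝ, 0 ≤ G → IntervalIntegrable (fun x =>
      (1 - ((1 + s * p.PT * p.CT * G / (p.mT * x ^ p.alphaT)) ^ p.mT)⁻¹) * x) volume r p.RB := by
    intro G hG
    have := intervalIntegrable_radial (ψ := fun x =>
      ((1 + s * p.PT * p.CT * G / (p.mT * |x| ^ p.alphaT)) ^ p.mT)⁻¹) (by fun_prop)
      (fun x => Ioc_subset_Icc_self (p.inv_pow_gain_mem hs hG (abs_nonneg x))) r p.RB
    refine this.congr ?_
    intro x hx
    rw [uIoc_of_le hR] at hx
    simp only [abs_of_nonneg (hr.trans hx.1.le)]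
  rw [← intervalIntegral.integral_const_mul, ← intervalIntegral.integral_const_mul,
    ← intervalIntegral.integral_add ((hint _ p.GM_pos.le).const_mul _)
      ((hint _ p.Gm_nonneg).const_mul _)]
  congr 2
  refine intervalIntegral.integral_congr fun x hx => ?_
  rw [uIcc_of_le hR] at hx
  simp only [abs_of_nonneg (hr.trans hx.1), gainLaplace]
  ring

/-- The integrand of the Laplace transform of the interference. -/
noncomputable def expInterf (s : ℝ) (q : (ℕ → Plane) × (ℕ → ℝ)) (h : ℕ → ℝ) : ENNReal :=
  ENNReal.ofReal (Real.exp (-(s * (p.interferenceENN q.1 q.2 h).toReal)))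

lemma measurable_expInterf (s : ℝ) : Measurable fun q : ((ℕ → Plane) × (ℕ → ℝ)) × (ℕ → ℝ) =>
    p.expInterf s q.1 q.2 :=
  ((p.measurable_interferenceENN.ennreal_toReal.const_mul s).neg.exp).ennreal_ofReal

/-- Positions of all stations for which the user is associated with the terrestrial tier. -/
def assocSet : Set ((ℕ → Plane) × (ℕ → Plane) × (ℕ → Plane)) :=
  {y | (0 < nearestDist y.1 ∧ nearestDist y.1 ≤ p.RB) ∧
    p.critL (nearestDist y.1) < heightDist p.h y.2.1 ∧
    p.critN (nearestDist y.1) < heightDist p.h y.2.2}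

lemma measurableSet_assocSet : MeasurableSet p.assocSet := by
  have h1 : Measurable fun y : (ℕ → Plane) × (ℕ → Plane) × (ℕ → Plane) => nearestDist y.1 :=
    measurable_nearestDist.comp measurable_fst
  have h2 : Measurable fun y : (ℕ → Plane) × (ℕ → Plane) × (ℕ → Plane) => heightDist p.h y.2.1 :=
    (measurable_heightDist _).comp (measurable_fst.comp measurable_snd)
  have h3 : Measurable fun y : (ℕ → Plane) × (ℕ → Plane) × (ℕ → Plane) => heightDist p.h y.2.2 :=
    (measurable_heightDist _).comp (measurable_snd.comp measurable_snd)
  exact ((measurableSet_lt measurable_const h1).inter (measurableSet_le h1 measurable_const)).inter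
    ((measurableSet_lt (p.measurable_critL.comp h1) h2).inter
      (measurableSet_lt (p.measurable_critN.comp h1) h3))

end Params

namespace Network

variable {p : Params} {Ω : Type*} [MeasurableSpace Ω] {μ : Measure Ω} (N : Network p μ)

lemma measurable_RT : Measurable N.RT := measurable_nearestDist.comp N.measurable_XSeq
lemma measurable_RL : Measurable N.RL := (measurable_heightDist p.h).comp N.measurable_YLSeq
lemma measurable_RN : Measurable N.RN := (measurable_heightDist p.h).comp N.measurable_YNSeq

lemma mem_assocT {ω : Ω} : ω ∈ N.assocT ↔
    (0 < N.RT ω ∧ N.RT ω ≤ p.RB) ∧ p.critL (N.RT ω) < N.RL ω ∧ p.critN (N.RT ω) < N.RN ω := by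
  have hL : 0 < N.RL ω := p.h_pos.trans_le (le_heightDist p.h _)
  have hN : 0 < N.RN ω := p.h_pos.trans_le (le_heightDist p.h _)
  have hT : 0 ≤ N.RT ω := nearestDist_nonneg _
  change N.powerL ω < N.powerT ω ∧ N.powerN ω < N.powerT ω ↔ _
  have hLp : 0 < N.powerL ω := mul_pos p.etaL_pos (Real.rpow_pos_of_pos hL _)
  by_cases h1 : N.RT ω ≤ p.RB
  · rcases hT.eq_or_lt with h0 | h0
    -- In real powers `0 ^ (-α) = 0`, so a station at distance 0 would deliver no power and the
    -- event fails there; this is the source of the condition `0 < N.RT ω`.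
    · have : N.powerT ω = 0 := by
        rw [powerT, if_pos h1, ← h0, Real.zero_rpow (neg_ne_zero.2 p.alphaT_pos.ne'), mul_zero]
      rw [this, ← h0]
      simp [hLp.le]
    · have hp : N.powerT ω = p.etaT * N.RT ω ^ (-p.alphaT) := if_pos h1
      rw [hp, powerL, powerN, power_lt_power_iff p.etaL_pos p.etaT_pos hL h0 p.alphaL_pos,
        power_lt_power_iff p.etaN_pos p.etaT_pos hN h0 p.alphaN_pos]
      simp [h0, h1, Params.critL, Params.critN]
  · have : N.powerT ω = 0 := if_neg h1
    rw [this]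
    simp [hLp.le, h1]

lemma measurableSet_assocT : MeasurableSet N.assocT := by
  have : N.assocT = {ω | (0 < N.RT ω ∧ N.RT ω ≤ p.RB) ∧ p.critL (N.RT ω) < N.RL ω ∧
      p.critN (N.RT ω) < N.RN ω} := by
    ext ω; exact N.mem_assocT
  rw [this]
  have hT := N.measurable_RT
  exact ((measurableSet_lt measurable_const hT).inter (measurableSet_le hT measurable_const)).inter
    ((measurableSet_lt (p.measurable_critL.comp hT) N.measurable_RL).inter
      (measurableSet_lt (p.measurable_critN.comp hT) N.measurable_RN))

lemma measure_critL_lt [IsProbabilityMeasure μ] (r : ℝ) : μ {ω | p.critL r < N.RL ω} =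
    ENNReal.ofReal (Real.exp (-2 * Real.pi * p.lamA *
      ∫ x in (0)..√(p.tauL r ^ 2 - p.h ^ 2), x * p.PL x)) := by
  have hΛ : ∀ R, 0 ≤ R → p.intensityL (Metric.closedBall 0 R) = _ := fun R hR =>
    withDensity_closedBall p.lamA_pos.le p.measurable_PL p.PL_mem hR
  have h0 : p.intensityL {0} = 0 := withDensity_absolutelyContinuous _ _ (measure_singleton 0)
  have hΛ' : ∀ R, p.intensityL (Metric.closedBall 0 R) ≠ ⊤ := fun R => by
    rcases le_or_gt 0 R with h | h
    · rw [hΛ R h]; exact ENNReal.ofReal_ne_top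
    · rw [Metric.closedBall_eq_empty.2 h]; simp
  have hi : 0 ≤ ∫ x in (0)..√(p.tauL r ^ 2 - p.h ^ 2), x * p.PL x :=
    intervalIntegral.integral_nonneg (Real.sqrt_nonneg _) fun x hx => mul_nonneg hx.1 (p.PL_mem x).1
  refine (N.poissonL.measure_lt_iInf_sqrt hΛ' h0 p.h_pos (p.critL r)).trans ?_
  rw [hΛ _ (Real.sqrt_nonneg _), show max p.h (p.critL r) = p.tauL r from rfl, ENNReal.toReal_ofReal
    (mul_nonneg (mul_nonneg (by have := Real.pi_pos; positivity) p.lamA_pos.le) hi)]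
  congr 2; ring

lemma measure_critN_lt [IsProbabilityMeasure μ] (r : ℝ) : μ {ω | p.critN r < N.RN ω} =
    ENNReal.ofReal (Real.exp (-2 * Real.pi * p.lamA *
      ∫ x in (0)..√(p.tauN r ^ 2 - p.h ^ 2), x * p.PN x)) := by
  have hΛ : ∀ R, 0 ≤ R → p.intensityN (Metric.closedBall 0 R) = _ := fun R hR =>
    withDensity_closedBall p.lamA_pos.le p.measurable_PN p.PN_mem hR
  have h0 : p.intensityN {0} = 0 := withDensity_absolutelyContinuous _ _ (measure_singleton 0)
  have hΛ' : ∀ R, p.intensityN (Metric.closedBall 0 R) ≠ ⊤ := fun R => by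
    rcases le_or_gt 0 R with h | h
    · rw [hΛ R h]; exact ENNReal.ofReal_ne_top
    · rw [Metric.closedBall_eq_empty.2 h]; simp
  have hi : 0 ≤ ∫ x in (0)..√(p.tauN r ^ 2 - p.h ^ 2), x * p.PN x :=
    intervalIntegral.integral_nonneg (Real.sqrt_nonneg _) fun x hx => mul_nonneg hx.1 (p.PN_mem x).1
  refine (N.poissonN.measure_lt_iInf_sqrt hΛ' h0 p.h_pos (p.critN r)).trans ?_
  rw [hΛ _ (Real.sqrt_nonneg _), show max p.h (p.critN r) = p.tauN r from rfl, ENNReal.toReal_ofReal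
    (mul_nonneg (mul_nonneg (by have := Real.pi_pos; positivity) p.lamA_pos.le) hi)]
  congr 2; ring

lemma measure_crit_lt [IsProbabilityMeasure μ] (r : ℝ) :
    μ {ω | p.critL r < N.RL ω ∧ p.critN r < N.RN ω} = ENNReal.ofReal (p.assocProb r) := by
  have := N.indepFun_Y.measure_inter_preimage_eq_mul {y | p.critL r < heightDist p.h y}
    {y | p.critN r < heightDist p.h y}
    (measurableSet_lt measurable_const (measurable_heightDist _))
    (measurableSet_lt measurable_const (measurable_heightDist _))
  refine this.trans ?_
  rw [Params.assocProb, ENNReal.ofReal_mul (Real.exp_pos _).le, ← N.measure_critL_lt,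
    ← N.measure_critN_lt]
  rfl

/-- The interference, as a measurable random variable. -/
noncomputable def interf (ω : Ω) : ℝ :=
  (p.interferenceENN (fun i => N.X i ω) (fun i => N.G i ω) (fun i => N.H i ω)).toReal

lemma measurable_interf : Measurable N.interf :=
  (p.measurable_interferenceENN.comp ((N.measurable_XSeq.prodMk N.measurable_GSeq).prodMk
    N.measurable_HSeq)).ennreal_toReal

lemma interf_nonneg (ω : Ω) : 0 ≤ N.interf ω := ENNReal.toReal_nonneg

lemma interference_eq_of_nonneg {ω : Ω} (hG : ∀ i, 0 ≤ N.G i ω) (hH : ∀ i, 0 ≤ N.H i ω) :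
    N.interference ω = N.interf ω := by
  unfold interf Params.interferenceENN interference
  rw [ENNReal.tsum_toReal_eq fun i => by split_ifs <;> simp]
  refine tsum_congr fun i => ?_
  have := hG i
  have := hH i
  have := p.PT_pos
  have := p.CT_pos
  change (if i ≠ nearestIdx (fun i => N.X i ω) ∧ ‖N.X i ω‖ ≤ p.RB then _ else _) = _
  split_ifs
  · rw [ENNReal.toReal_ofReal (by positivity)]
  · simp

lemma interference_ae : N.interference =ᵐ[μ] N.interf := by
  filter_upwards [N.ae_nonneg_G, N.ae_nonneg_H] with ω hG hH
  exact N.interference_eq_of_nonneg hG hH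

/-- Positions of all stations. -/
def positions (ω : Ω) : (ℕ → Plane) × (ℕ → Plane) × (ℕ → Plane) :=
  (fun i => N.X i ω, fun i => N.YL i ω, fun i => N.YN i ω)

lemma measurable_positions : Measurable N.positions :=
  N.measurable_XSeq.prodMk (N.measurable_YLSeq.prodMk N.measurable_YNSeq)

/-- Averaging over the marks, for fixed positions `x` of the terrestrial stations. -/
noncomputable def avgH (s : ℝ) (q : (ℕ → Plane) × (ℕ → ℝ)) : ENNReal :=
  ∫⁻ ω, p.expInterf s q (fun i => N.H i ω) ∂μ
noncomputable def avgMarks (s : ℝ) (x : ℕ → Plane) : ENNReal :=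
  ∫⁻ ω, N.avgH s (x, fun i => N.G i ω) ∂μ

lemma measurable_avgH [IsProbabilityMeasure μ] (s : ℝ) : Measurable (N.avgH s) :=
  measurable_lintegral_snd N.measurable_HSeq (p.measurable_expInterf s)

lemma measurable_avgMarks [IsProbabilityMeasure μ] (s : ℝ) : Measurable (N.avgMarks s) :=
  measurable_lintegral_snd (F := fun x g => N.avgH s (x, g)) N.measurable_GSeq (N.measurable_avgH s)

/-- Association depends on the positions only, so the weight `θ` passes through Fubini twice: the
fading is integrated out for fixed positions and gains, then the gains for fixed positions. -/
lemma lintegral_positions_interf [IsProbabilityMeasure μ] (s : ℝ)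
    {θ : (ℕ → Plane) × (ℕ → Plane) × (ℕ → Plane) → ENNReal} (hθ : Measurable θ) :
    ∫⁻ ω, θ (N.positions ω) * ENNReal.ofReal (Real.exp (-(s * N.interf ω))) ∂μ =
      ∫⁻ ω, θ (N.positions ω) * N.avgMarks s (fun i => N.X i ω) ∂μ := by
  have h1 : Measurable fun z : (((ℕ → Plane) × (ℕ → Plane) × (ℕ → Plane)) × (ℕ → ℝ)) × (ℕ → ℝ) =>
      θ z.1.1 * p.expInterf s (z.1.1.1, z.1.2) z.2 := by
    have hm : Measurable fun z : (((ℕ → Plane) × (ℕ → Plane) × (ℕ → Plane)) × (ℕ → ℝ)) × (ℕ → ℝ) =>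
        ((z.1.1.1, z.1.2), z.2) := by fun_prop
    have hE := (p.measurable_expInterf s).comp hm
    have hT : Measurable fun z : (((ℕ → Plane) × (ℕ → Plane) × (ℕ → Plane)) × (ℕ → ℝ)) ×
        (ℕ → ℝ) => θ z.1.1 := hθ.comp (measurable_fst.comp measurable_fst)
    exact hT.mul hE
  have h2 : Measurable fun z : ((ℕ → Plane) × (ℕ → Plane) × (ℕ → Plane)) × (ℕ → ℝ) =>
      θ z.1 * N.avgH s (z.1.1, z.2) := by
    have hm : Measurable fun z : ((ℕ → Plane) × (ℕ → Plane) × (ℕ → Plane)) × (ℕ → ℝ) =>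
        (z.1.1, z.2) := by fun_prop
    have hE := (N.measurable_avgH s).comp hm
    have hT : Measurable fun z : ((ℕ → Plane) × (ℕ → Plane) × (ℕ → Plane)) × (ℕ → ℝ) => θ z.1 :=
      hθ.comp measurable_fst
    exact hT.mul hE
  have hH : ∀ q, Measurable fun ω => p.expInterf s q fun i => N.H i ω := by
    intro q
    have hm : Measurable fun ω => (q, fun i => N.H i ω) :=
      measurable_const.prodMk N.measurable_HSeq
    have := (p.measurable_expInterf s).comp hm
    exact this
  have hG : ∀ x : ℕ → Plane, Measurable fun ω => N.avgH s (x, fun i => N.G i ω) := by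
    intro x
    have hm : Measurable fun ω => (x, fun i => N.G i ω) :=
      measurable_const.prodMk N.measurable_GSeq
    have := (N.measurable_avgH s).comp hm
    exact this
  have e1 := lintegral_comp_of_indepFun (N.measurable_positions.prodMk N.measurable_GSeq)
    N.measurable_HSeq N.indepFun_H (F := fun z h => θ z.1 * p.expInterf s (z.1.1, z.2) h) h1
  have e2 := lintegral_comp_of_indepFun N.measurable_positions
    N.measurable_GSeq N.indepFun_G (F := fun z g => θ z * N.avgH s (z.1, g)) h2
  have e3 : ∀ ω, ∫⁻ ω', θ (N.positions ω) * p.expInterf s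
      ((N.positions ω).1, fun i => N.G i ω) (fun i => N.H i ω') ∂μ =
      θ (N.positions ω) * N.avgH s ((N.positions ω).1, fun i => N.G i ω) := fun ω =>
    lintegral_const_mul _ (hH _)
  have e4 : ∀ ω, ∫⁻ ω', θ (N.positions ω) * N.avgH s ((N.positions ω).1, fun i => N.G i ω') ∂μ =
      θ (N.positions ω) * N.avgMarks s (N.positions ω).1 := fun ω => lintegral_const_mul _ (hG _)
  simp only [e3] at e1
  simp only [e4] at e2
  exact e1.trans e2

/-- Averaging over the aerial stations. -/
lemma lintegral_assocT_eq [IsProbabilityMeasure μ] {w : ℝ → ENNReal} (hw : Measurable w)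
    {Z : (ℕ → Plane) → ENNReal} (hZ : Measurable Z) :
    ∫⁻ ω, p.assocSet.indicator (fun y => w (nearestDist y.1)) (N.positions ω) *
        Z (fun i => N.X i ω) ∂μ =
      ∫⁻ ω in {ω | (nearestDist fun i => N.X i ω) ≤ p.RB}, (Ioi 0).indicator (fun r =>
          w r * ENNReal.ofReal (p.assocProb r)) (N.RT ω) * Z (fun i => N.X i ω) ∂μ := by
  have hY2 : Measurable fun ω => ((fun i => N.YL i ω, fun i => N.YN i ω) :
    (ℕ → Plane) × (ℕ → Plane)) := N.measurable_YLSeq.prodMk N.measurable_YNSeq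
  have hθ : Measurable (p.assocSet.indicator fun y => w (nearestDist y.1)) :=
    (hw.comp (measurable_nearestDist.comp measurable_fst)).indicator p.measurableSet_assocSet
  have e := lintegral_comp_of_indepFun (F := fun x y => p.assocSet.indicator
    (fun y => w (nearestDist y.1)) (x, y) * Z x) N.measurable_XSeq
    hY2 N.indepFun_X (hθ.mul (hZ.comp measurable_fst))
  refine e.trans ?_
  have hRB : MeasurableSet {ω | (nearestDist fun i => N.X i ω) ≤ p.RB} :=
    N.measurable_RT measurableSet_Iic
  rw [← lintegral_indicator hRB]
  refine lintegral_congr fun ω => ?_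
  have hθω : Measurable fun ω' => p.assocSet.indicator (fun y => w (nearestDist y.1))
      (fun i => N.X i ω, fun i => N.YL i ω', fun i => N.YN i ω') :=
    hθ.comp (measurable_const.prodMk hY2)
  rw [lintegral_mul_const _ hθω]
  -- For fixed terrestrial positions the inner integral is `w` times the probability that both
  -- aerial tiers lie beyond their critical distances, which is `assocProb`.
  by_cases h : 0 < N.RT ω ∧ N.RT ω ≤ p.RB
  · rw [indicator_of_mem (by exact h.2), indicator_of_mem (by exact h.1),
      ← N.measure_crit_lt]
    congr 1
    have hm : MeasurableSet {ω' | p.critL (N.RT ω) < N.RL ω' ∧ p.critN (N.RT ω) < N.RN ω'} :=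
      (measurableSet_lt measurable_const N.measurable_RL).inter
        (measurableSet_lt measurable_const N.measurable_RN)
    rw [← setLIntegral_const, ← lintegral_indicator hm]
    refine lintegral_congr fun ω' => ?_
    by_cases h' : p.critL (N.RT ω) < N.RL ω' ∧ p.critN (N.RT ω) < N.RN ω'
    · rw [indicator_of_mem (a := ω') (by exact h'), indicator_of_mem]
      · rfl
      · exact ⟨h, h'⟩
    · rw [indicator_of_notMem (a := ω') (by exact h'), indicator_of_notMem]
      exact fun hc => h' hc.2
  · have h0 : ∀ ω', p.assocSet.indicator (fun y => w (nearestDist y.1))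
        (fun i => N.X i ω, fun i => N.YL i ω', fun i => N.YN i ω') = 0 :=
      fun ω' => indicator_of_notMem (fun hc => h hc.1) _
    simp only [h0, lintegral_zero, zero_mul]
    symm
    by_cases h2 : N.RT ω ≤ p.RB
    · rw [indicator_of_mem (by exact h2), indicator_of_notMem (s := Ioi 0) (fun hc => h ⟨hc, h2⟩), zero_mul]
    · exact indicator_of_notMem (by exact h2) _

/-- The joint law of the serving distance and the interference on the association event. -/
theorem lintegral_assocT [IsProbabilityMeasure μ] {s : ℝ} (hs : 0 ≤ s) {w : ℝ → ENNReal}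
    (hw : Measurable w) :
    ∫⁻ ω in N.assocT, w (N.RT ω) * ENNReal.ofReal (Real.exp (-(s * N.interf ω))) ∂μ =
      ∫⁻ r in Ioc 0 p.RB, w r * ENNReal.ofReal (p.fT r * p.assocProb r * p.laplaceI s r) := by
  have hθ : Measurable (p.assocSet.indicator fun y => w (nearestDist y.1)) :=
    (hw.comp (measurable_nearestDist.comp measurable_fst)).indicator p.measurableSet_assocSet
  calc ∫⁻ ω in N.assocT, w (N.RT ω) * ENNReal.ofReal (Real.exp (-(s * N.interf ω))) ∂μ
      = ∫⁻ ω, p.assocSet.indicator (fun y => w (nearestDist y.1)) (N.positions ω) *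
          ENNReal.ofReal (Real.exp (-(s * N.interf ω))) ∂μ := by
        rw [← lintegral_indicator N.measurableSet_assocT]
        refine lintegral_congr fun ω => ?_
        by_cases h : ω ∈ N.assocT
        · rw [indicator_of_mem h, indicator_of_mem]
          · rfl
          · exact N.mem_assocT.1 h
        · rw [indicator_of_notMem h, indicator_of_notMem, zero_mul]
          exact fun hc => h (N.mem_assocT.2 hc)
    _ = _ := (N.lintegral_positions_interf s hθ).trans
        (N.lintegral_assocT_eq hw (N.measurable_avgMarks s))
    _ = ∫⁻ r in Ioc 0 p.RB, (Ioi 0).indicator (fun r => w r * ENNReal.ofReal (p.assocProb r)) r *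
          ENNReal.ofReal (2 * Real.pi * p.lamT * r * Real.exp (-Real.pi * p.lamT * r ^ 2) *
          Real.exp (-2 * Real.pi * p.lamT *
            radialExponent p.RB (fun x => p.gainLaplace s |x|) r)) := by
        have hw' : Measurable ((Ioi (0 : ℝ)).indicator fun r =>
            w r * ENNReal.ofReal (p.assocProb r)) :=
          (hw.mul p.measurable_assocProb.ennreal_ofReal).indicator measurableSet_Ioi
        -- By `lintegral_marks` the averaged marks form a product over the interferers, so the
        -- Poisson identity applies with ψ equal to the Laplace transform of a single interferer's
        -- power.
        rw [← N.poissonT.lintegral_nearestDist_finprod p.lamT_pos.le p.RB_pos (p.measurable_gainFun s)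
          (p.gainFun_mem hs) ((p.continuousOn_gainLaplace hs).congr fun x hx => by
            rw [abs_of_pos hx]) hw']
        refine lintegral_congr_ae (ae_restrict_of_ae ?_)
        filter_upwards [N.ae_locallyFinite_X] with ω hω
        congr 1
        refine (N.lintegral_marks hω hs).trans ?_
        simp only [abs_norm]
        rfl
    _ = _ := by
        refine setLIntegral_congr_fun measurableSet_Ioc fun r hr => ?_
        have hf : p.fT r = 2 * Real.pi * p.lamT * r * Real.exp (-Real.pi * p.lamT * r ^ 2) :=
          if_pos ⟨hr.1.le, hr.2⟩
        rw [indicator_of_mem (by exact hr.1), p.laplaceI_eq hs hr.1.le hr.2, hf, mul_assoc,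
          ← ENNReal.ofReal_mul (p.assocProb_pos r).le]
        congr 2; ring

end Network

/-! ### Conditional laws, and Laplace arguments that depend on the distance. -/

namespace Params
variable (p : Params)

/-- The Laplace transform of the interference as a function that is continuous in the distance. -/
noncomputable def radialLaplace (s r : ℝ) : ℝ :=
  Real.exp (-2 * Real.pi * p.lamT * radialExponent p.RB (fun x => p.gainLaplace s |x|) r)

lemma radialLaplace_pos (s r : ℝ) : 0 < p.radialLaplace s r := Real.exp_pos _

lemma continuous_radialLaplace {s : ℝ} (hs : 0 ≤ s) : Continuous (p.radialLaplace s) := by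
  have := continuous_radialExponent (R := p.RB) (p.measurable_gainFun s)
    (fun x => Ioc_subset_Icc_self (p.gainFun_mem hs x))
  unfold radialLaplace
  fun_prop

lemma radialExponent_gain_nonneg {s r : ℝ} (hs : 0 ≤ s) (hr : 0 ≤ r) (hR : r ≤ p.RB) :
    0 ≤ radialExponent p.RB (fun x => p.gainLaplace s |x|) r :=
  intervalIntegral.integral_nonneg hR fun x hx =>
    mul_nonneg (sub_nonneg.2 (p.gainFun_mem hs x).2) (hr.trans hx.1)

lemma radialLaplace_le_one {s r : ℝ} (hs : 0 ≤ s) (hr : 0 ≤ r) (hR : r ≤ p.RB) :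
    p.radialLaplace s r ≤ 1 := by
  have := p.radialExponent_gain_nonneg hs hr hR
  have hl := p.lamT_pos
  have hp := Real.pi_pos
  rw [radialLaplace, Real.exp_le_one_iff]
  have : 0 ≤ 2 * Real.pi * p.lamT * radialExponent p.RB (fun x => p.gainLaplace s |x|) r := by
    positivity
  linarith

lemma radialLaplace_zero (r : ℝ) : p.radialLaplace 0 r = 1 := by
  have : ∀ x, p.gainLaplace 0 x = 1 := fun x => by simp [gainLaplace]
  simp [radialLaplace, radialExponent, this]

lemma tendsto_radialLaplace {s : ℝ} {u : ℕ → ℝ} (hu0 : ∀ n, 0 ≤ u n) (hs : 0 ≤ s)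
    (hu : Tendsto u atTop (𝓝 s)) (r : ℝ) :
    Tendsto (fun n => p.radialLaplace (u n) r) atTop (𝓝 (p.radialLaplace s r)) := by
  have : Tendsto (fun n => radialExponent p.RB (fun x => p.gainLaplace (u n) |x|) r) atTop
      (𝓝 (radialExponent p.RB (fun x => p.gainLaplace s |x|) r)) := by
    unfold radialExponent
    refine intervalIntegral.tendsto_integral_filter_of_dominated_convergence (fun x => |x|)
      (Eventually.of_forall fun n => ((measurable_const.sub (p.measurable_gainFun _)).mul
        measurable_id).aestronglyMeasurable) (Eventually.of_forall fun n => ae_of_all _ fun x _ => ?_)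
      (continuous_abs.intervalIntegrable _ _) (ae_of_all _ fun x _ => ?_)
    · have := p.gainFun_mem (hu0 n) x
      rw [norm_mul, Real.norm_eq_abs, Real.norm_eq_abs, abs_of_nonneg (sub_nonneg.2 this.2)]
      exact mul_le_of_le_one_left (abs_nonneg _) (by linarith [this.1])
    · refine (Tendsto.const_sub 1 ?_).mul_const x
      have hG : ∀ G : ℝ, 0 ≤ G → Tendsto (fun n =>
          ((1 + u n * p.PT * p.CT * G / (p.mT * |x| ^ p.alphaT)) ^ p.mT)⁻¹) atTop
          (𝓝 ((1 + s * p.PT * p.CT * G / (p.mT * |x| ^ p.alphaT)) ^ p.mT)⁻¹) := by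
        intro G hG
        have := p.one_add_gain_pos hs hG (abs_nonneg x)
        refine Tendsto.inv₀ (Tendsto.pow (Tendsto.const_add _ (Tendsto.div_const ?_ _)) _)
          (by positivity)
        exact ((hu.mul_const _).mul_const _).mul_const _
      exact ((hG _ p.GM_pos.le).const_mul _).add ((hG _ p.Gm_nonneg).const_mul _)
  unfold radialLaplace
  exact (Real.continuous_exp.tendsto _).comp (this.const_mul _)

/-- A function continuous in `s` and measurable in `r` is jointly measurable; `|s|` extends the
transform to all real arguments. -/
lemma measurable_radialLaplace_comp {σ : ℝ → ℝ} (hσ : Measurable σ) (hσ0 : ∀ r, 0 ≤ σ r) :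
    Measurable fun r => p.radialLaplace (σ r) r := by
  have h : Measurable (Function.uncurry fun s r => p.radialLaplace |s| r) := by
    refine measurable_uncurry_of_continuous_of_measurable (fun r => ?_) (fun s => ?_)
    · refine continuous_iff_seqContinuous.2 fun u s hu => ?_
      exact p.tendsto_radialLaplace (fun n => abs_nonneg _) (abs_nonneg _)
        ((continuous_abs.tendsto s).comp hu) r
    · exact (p.continuous_radialLaplace (abs_nonneg s)).measurable
  have h2 := h.comp (hσ.prodMk measurable_id)
  convert h2 using 1
  ext r
  simp [Function.uncurry, abs_of_nonneg (hσ0 r)]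

lemma fT_nonneg (r : ℝ) : 0 ≤ p.fT r := by
  have := p.lamT_pos
  have := Real.pi_pos
  unfold fT
  split_ifs with h
  · have := h.1
    positivity
  · exact le_rfl

lemma fT_pos {r : ℝ} (h : r ∈ Ioc 0 p.RB) : 0 < p.fT r := by
  have := p.lamT_pos
  have := Real.pi_pos
  have h0 := h.1
  rw [fT, if_pos ⟨h.1.le, h.2⟩]
  positivity

lemma fT_eq_zero {r : ℝ} (h : r ∉ Ioc 0 p.RB) : p.fT r = 0 := by
  unfold fT
  split_ifs with h'
  · rcases h'.1.eq_or_lt with h0 | h0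
    · rw [← h0]; simp
    · exact absurd ⟨h0, h'.2⟩ h
  · rfl

lemma measurable_fT : Measurable p.fT := by
  unfold fT
  exact Measurable.ite measurableSet_Icc (by fun_prop) measurable_const

lemma measurable_fHatT (A : ℝ) : Measurable (p.fHatT A) := by
  have h1 := p.measurable_fT
  have h2 := p.measurable_assocProb
  have : p.fHatT A = fun r => p.fT r * p.assocProb r / A := funext fun r => p.fHatT_eq A r
  rw [this]; fun_prop

lemma fHatT_nonneg {A : ℝ} (hA : 0 ≤ A) (r : ℝ) : 0 ≤ p.fHatT A r := by
  rw [fHatT_eq]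
  exact div_nonneg (mul_nonneg (p.fT_nonneg r) (p.assocProb_pos r).le) hA

lemma fHatT_eq_zero {r : ℝ} (h : r ∉ Ioc 0 p.RB) (A : ℝ) : p.fHatT A r = 0 := by
  rw [fHatT_eq, p.fT_eq_zero h]; simp

end Params

namespace Network

variable {p : Params} {Ω : Type*} [MeasurableSpace Ω] {μ : Measure Ω} (N : Network p μ)

lemma condT_absolutelyContinuous : N.condT ≪ μ := cond_absolutelyContinuous

lemma ae_condT_mem : ∀ᵐ ω ∂N.condT, ω ∈ N.assocT :=
  ae_cond_mem N.measurableSet_assocT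

lemma lintegral_condT (f : Ω → ENNReal) :
    ∫⁻ ω, f ω ∂N.condT = (μ N.assocT)⁻¹ * ∫⁻ ω in N.assocT, f ω ∂μ := by
  rw [condT, ProbabilityTheory.cond, lintegral_smul_measure, smul_eq_mul]

lemma exp_interf_mem {s : ℝ} (hs : 0 ≤ s) (ω : Ω) :
    Real.exp (-(s * N.interf ω)) ∈ Icc (0 : ℝ) 1 :=
  ⟨(Real.exp_pos _).le, Real.exp_le_one_iff.2 (neg_nonpos.2 (mul_nonneg hs (N.interf_nonneg ω)))⟩

lemma ae_RT_mem : ∀ᵐ ω ∂N.condT, N.RT ω ∈ Ioc 0 p.RB := by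
  filter_upwards [N.ae_condT_mem] with ω hω
  exact (N.mem_assocT.1 hω).1

lemma interference_ae_condT : N.interference =ᵐ[N.condT] N.interf :=
  N.condT_absolutelyContinuous.ae_eq N.interference_ae

lemma ae_laplaceI {s : ℝ} (hs : 0 ≤ s) :
    ∀ᵐ ω ∂N.condT, p.laplaceI s (N.RT ω) = p.radialLaplace s (N.RT ω) := by
  filter_upwards [N.ae_RT_mem] with ω hω
  exact p.laplaceI_eq hs hω.1.le hω.2

variable [IsProbabilityMeasure μ]

lemma measure_assocT : μ N.assocT = ∫⁻ r in Ioc 0 p.RB, ENNReal.ofReal (p.fT r * p.assocProb r) := by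
  have := N.lintegral_assocT (s := 0) le_rfl (w := fun _ => 1) measurable_const
  simp only [zero_mul, neg_zero, Real.exp_zero, ENNReal.ofReal_one, one_mul, lintegral_one,
    Measure.restrict_apply_univ] at this
  rw [this]
  refine setLIntegral_congr_fun measurableSet_Ioc fun r hr => ?_
  rw [p.laplaceI_eq le_rfl hr.1.le hr.2]
  change ENNReal.ofReal (_ * p.radialLaplace 0 r) = _
  rw [p.radialLaplace_zero, mul_one]

lemma measure_assocT_pos : 0 < μ N.assocT := by
  have hm : Measurable fun r => ENNReal.ofReal (p.fT r * p.assocProb r) :=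
    (p.measurable_fT.mul p.measurable_assocProb).ennreal_ofReal
  rw [N.measure_assocT, setLIntegral_pos_iff hm]
  have : Ioc 0 p.RB ⊆ Function.support (fun r => ENNReal.ofReal (p.fT r * p.assocProb r)) ∩
      Ioc 0 p.RB := fun r hr =>
    ⟨(ENNReal.ofReal_pos.2 (mul_pos (p.fT_pos hr) (p.assocProb_pos r))).ne', hr⟩
  refine lt_of_lt_of_le ?_ (measure_mono this)
  simp [p.RB_pos]

lemma AT_pos : 0 < N.AT := ENNReal.toReal_pos N.measure_assocT_pos.ne' (measure_ne_top _ _)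

instance isProbabilityMeasure_condT : IsProbabilityMeasure N.condT :=
  cond_isProbabilityMeasure N.measure_assocT_pos.ne'

/-- Conditional law of the serving distance and of the interference. -/
lemma lintegral_condT_laplace {s : ℝ} (hs : 0 ≤ s) {w : ℝ → ENNReal} (hw : Measurable w) :
    ∫⁻ ω, w (N.RT ω) * ENNReal.ofReal (Real.exp (-(s * N.interf ω))) ∂N.condT =
      ∫⁻ r, w r * ENNReal.ofReal (p.radialLaplace s r * p.fHatT N.AT r) := by
  rw [N.lintegral_condT, N.lintegral_assocT hs hw,
    ← lintegral_const_mul' _ _ (ENNReal.inv_ne_top.2 N.measure_assocT_pos.ne'),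
    ← lintegral_indicator measurableSet_Ioc]
  refine lintegral_congr fun r => ?_
  by_cases hr : r ∈ Ioc 0 p.RB
  · have e : (μ N.assocT)⁻¹ = ENNReal.ofReal (N.AT⁻¹) := by
      rw [ENNReal.ofReal_inv_of_pos N.AT_pos, AT, ofReal_measureReal]
    rw [indicator_of_mem hr, e, mul_left_comm, ← ENNReal.ofReal_mul (inv_nonneg.2 N.AT_pos.le),
      p.laplaceI_eq hs hr.1.le hr.2, p.fHatT_eq]
    congr 2
    rw [Params.radialLaplace]
    ring
  · rw [indicator_of_notMem hr, p.fHatT_eq_zero hr]; simp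

lemma lintegral_RT {w : ℝ → ENNReal} (hw : Measurable w) :
    ∫⁻ ω, w (N.RT ω) ∂N.condT = ∫⁻ r, w r * ENNReal.ofReal (p.fHatT N.AT r) := by
  simpa [p.radialLaplace_zero] using N.lintegral_condT_laplace le_rfl hw

theorem map_RT : N.condT.map N.RT =
    volume.withDensity (fun r => ENNReal.ofReal (p.fHatT N.AT r)) := by
  ext A hA
  rw [Measure.map_apply N.measurable_RT hA, withDensity_apply _ hA,
    ← lintegral_indicator_one (N.measurable_RT hA)]
  have := N.lintegral_RT (w := A.indicator 1) (measurable_one.indicator hA)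
  rw [← lintegral_indicator hA]
  refine Eq.trans ?_ (this.trans ?_)
  · rfl
  · refine lintegral_congr fun r => ?_
    by_cases hr : r ∈ A <;> simp [hr]

/-- It suffices to compare integrals over events {RT ∈ A}. Both sides come from the joint law with
the indicator of `A` in the weight, once at `s` and once with the transform itself in the weight. -/
theorem condExp_interference {s : ℝ} (hs : 0 ≤ s) :
    condExp (MeasurableSpace.comap N.RT inferInstance) N.condT
          (fun ω => Real.exp (-(s * N.interference ω)))
        =ᵐ[N.condT] fun ω => p.laplaceI s (N.RT ω) := by
  have hm : MeasurableSpace.comap N.RT inferInstance ≤ ‹MeasurableSpace Ω› :=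
    N.measurable_RT.comap_le
  have hLm := (p.continuous_radialLaplace hs).measurable
  have hJ := N.measurable_interf
  have hi : Integrable (fun ω => Real.exp (-(s * N.interf ω))) N.condT :=
    Integrable.of_bound (C := 1) (by fun_prop) (ae_of_all _ fun ω => by
      rw [Real.norm_eq_abs, abs_of_nonneg (N.exp_interf_mem hs ω).1]
      exact (N.exp_interf_mem hs ω).2)
  have hi' : Integrable (fun ω => p.radialLaplace s (N.RT ω)) N.condT := by
    refine Integrable.of_bound (C := 1) (hLm.comp N.measurable_RT).aestronglyMeasurable ?_
    filter_upwards [N.ae_RT_mem] with ω hω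
    rw [Real.norm_eq_abs, abs_of_nonneg (p.radialLaplace_pos _ _).le]
    exact p.radialLaplace_le_one hs hω.1.le hω.2
  have e1 : condExp (MeasurableSpace.comap N.RT inferInstance) N.condT
          (fun ω => Real.exp (-(s * N.interference ω))) =ᵐ[N.condT]
      condExp (MeasurableSpace.comap N.RT inferInstance) N.condT
          (fun ω => Real.exp (-(s * N.interf ω))) := by
    refine condExp_congr_ae ?_
    filter_upwards [N.interference_ae_condT] with ω hω
    rw [hω]
  refine e1.trans (EventuallyEq.symm ?_)
  refine EventuallyEq.trans (N.ae_laplaceI hs) ?_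
  refine ae_eq_condExp_of_forall_setIntegral_eq hm hi (fun _ _ _ => hi'.integrableOn) ?_ ?_
  · rintro _ ⟨A, hA, rfl⟩ -
    rw [integral_eq_lintegral_of_nonneg_ae (ae_of_all _ fun ω => (p.radialLaplace_pos _ _).le)
        hi'.1.restrict,
      integral_eq_lintegral_of_nonneg_ae (ae_of_all _ fun ω => (Real.exp_pos _).le) hi.1.restrict]
    congr 1
    rw [← lintegral_indicator (N.measurable_RT hA), ← lintegral_indicator (N.measurable_RT hA)]
    have h1 := N.lintegral_condT_laplace hs (w := A.indicator 1) (measurable_one.indicator hA)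
    have h2 := N.lintegral_RT (w := A.indicator fun r => ENNReal.ofReal (p.radialLaplace s r))
      (hLm.ennreal_ofReal.indicator hA)
    refine Eq.trans ?_ (h2.trans (Eq.trans ?_ (h1.symm.trans ?_)))
    · rfl
    · refine lintegral_congr fun r => ?_
      by_cases hr : r ∈ A
      · simp only [indicator_of_mem hr, Pi.one_apply, one_mul]
        rw [ENNReal.ofReal_mul (p.radialLaplace_pos _ _).le]
      · simp [hr]
    · refine lintegral_congr fun ω => ?_
      by_cases hr : N.RT ω ∈ A
      · rw [indicator_of_mem (s := N.RT ⁻¹' A) hr, indicator_of_mem hr, Pi.one_apply, one_mul]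
      · rw [indicator_of_notMem (s := N.RT ⁻¹' A) hr, indicator_of_notMem hr, zero_mul]
  · exact (hLm.comp (comap_measurable N.RT)).aestronglyMeasurable

/-- Laplace transform at an argument that depends on the serving distance. -/
lemma lintegral_condT_laplace_comp {σ : ℝ → ℝ} (hσ : Measurable σ) (hσ0 : ∀ r, 0 ≤ σ r)
    {w : ℝ → ENNReal} (hw : Measurable w) (hw1 : ∀ r, w r ≤ 1) :
    ∫⁻ ω, w (N.RT ω) * ENNReal.ofReal (Real.exp (-(σ (N.RT ω) * N.interf ω))) ∂N.condT =
      ∫⁻ r, w r * ENNReal.ofReal (p.radialLaplace (σ r) r * p.fHatT N.AT r) := by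
  have hJ := N.measurable_interf
  have hT := N.measurable_RT
  let f : ℕ → SimpleFunc ℝ ℝ := SimpleFunc.approxOn σ hσ (Ici 0) 0 (by simp)
  have hf0 : ∀ n r, 0 ≤ f n r := fun n r => SimpleFunc.approxOn_mem hσ (by simp) n r
  have hlim : ∀ r, Tendsto (fun n => f n r) atTop (𝓝 (σ r)) := fun r =>
    SimpleFunc.tendsto_approxOn hσ _ (subset_closure (hσ0 r))
  -- On a fibre of the simple function `f n` the Laplace argument is constant, so the fixed-argument
  -- formula applies with the fibre's indicator absorbed into the weight. Dominated convergence then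
  -- passes to `σ`.
  have split : ∀ (n : ℕ) (r : ℝ) (F : ℝ → ENNReal), w r * F (f n r) =
      ∑ v ∈ (f n).range, (f n ⁻¹' {v}).indicator w r * F v := by
    intro n r F
    rw [Finset.sum_eq_single (f n r)]
    · rw [indicator_of_mem (by simp)]
    · intro v _ hv
      rw [indicator_of_notMem (by simpa using hv.symm), zero_mul]
    · intro h; exact absurd ((f n).mem_range_self r) h
  have hwv : ∀ n v, Measurable ((f n ⁻¹' {v}).indicator w) := fun n v =>
    hw.indicator ((f n).measurableSet_fiber v)
  have hv0 : ∀ n, ∀ v ∈ (f n).range, 0 ≤ v := fun n v hv => by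
    obtain ⟨r, rfl⟩ := SimpleFunc.mem_range.1 hv
    exact hf0 n r
  have key : ∀ n, ∫⁻ ω, w (N.RT ω) * ENNReal.ofReal (Real.exp (-(f n (N.RT ω) * N.interf ω)))
      ∂N.condT = ∫⁻ r, w r * ENNReal.ofReal (p.radialLaplace (f n r) r * p.fHatT N.AT r) := by
    intro n
    simp_rw [fun ω => split n (N.RT ω) fun v => ENNReal.ofReal (Real.exp (-(v * N.interf ω))),
      fun r => split n r fun v => ENNReal.ofReal (p.radialLaplace v r * p.fHatT N.AT r)]
    rw [lintegral_finsetSum, lintegral_finsetSum]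
    · exact Finset.sum_congr rfl fun v hv => N.lintegral_condT_laplace (hv0 n v hv) (hwv n v)
    · intro v hv
      exact (hwv n v).mul ((p.continuous_radialLaplace (hv0 n v hv)).measurable.mul
        (p.measurable_fHatT _)).ennreal_ofReal
    · intro v hv
      exact ((hwv n v).comp hT).mul (by fun_prop)
  have l1 : Tendsto (fun n => ∫⁻ ω, w (N.RT ω) *
      ENNReal.ofReal (Real.exp (-(f n (N.RT ω) * N.interf ω))) ∂N.condT) atTop
      (𝓝 (∫⁻ ω, w (N.RT ω) * ENNReal.ofReal (Real.exp (-(σ (N.RT ω) * N.interf ω))) ∂N.condT)) := by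
    refine tendsto_lintegral_of_dominated_convergence (fun _ => 1) (fun n => ?_) (fun n => ?_)
      (by simp) (ae_of_all _ fun ω => ?_)
    · have := (f n).measurable
      exact (hw.comp hT).mul (by fun_prop)
    · refine ae_of_all _ fun ω => mul_le_one' (hw1 _) (ENNReal.ofReal_le_one.2 ?_)
      exact (N.exp_interf_mem (hf0 n _) ω).2
    · refine ENNReal.Tendsto.const_mul (ENNReal.tendsto_ofReal ?_) (Or.inr (ne_top_of_le_ne_top ENNReal.one_ne_top (hw1 _)))
      exact (Real.continuous_exp.tendsto _).comp ((hlim _).mul_const _).neg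
  have l2 : Tendsto (fun n => ∫⁻ r, w r *
      ENNReal.ofReal (p.radialLaplace (f n r) r * p.fHatT N.AT r)) atTop
      (𝓝 (∫⁻ r, w r * ENNReal.ofReal (p.radialLaplace (σ r) r * p.fHatT N.AT r))) := by
    refine tendsto_lintegral_of_dominated_convergence
      (fun r => ENNReal.ofReal (p.fHatT N.AT r)) (fun n => ?_) (fun n => ?_)
      ?_ (ae_of_all _ fun r => ?_)
    · exact hw.mul ((p.measurable_radialLaplace_comp (f n).measurable (hf0 n)).mul
        (p.measurable_fHatT _)).ennreal_ofReal
    · refine ae_of_all _ fun r => ?_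
      by_cases hr : r ∈ Ioc 0 p.RB
      · refine (mul_le_of_le_one_left (by positivity) (hw1 r)).trans (ENNReal.ofReal_le_ofReal ?_)
        exact mul_le_of_le_one_left (p.fHatT_nonneg N.AT_pos.le r)
          (p.radialLaplace_le_one (hf0 n r) hr.1.le hr.2)
      · simp only [p.fHatT_eq_zero hr]; simp
    · have := N.lintegral_RT (w := fun _ => 1) measurable_const
      simp only [one_mul] at this
      rw [← this]; simp
    · refine ENNReal.Tendsto.const_mul (ENNReal.tendsto_ofReal ?_) (Or.inr (ne_top_of_le_ne_top ENNReal.one_ne_top (hw1 _)))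
      exact (p.tendsto_radialLaplace (fun n => hf0 n r) (hσ0 r) (hlim r) r).mul_const _
  exact tendsto_nhds_unique (l1.congr key) l2

end Network

/-! ### The approximation as an expectation over the threshold. -/

lemma one_sub_one_sub_pow (m : ℕ) (e : ℝ) :
    1 - (1 - e) ^ m = ∑ k ∈ Finset.Icc 1 m, (-1 : ℝ) ^ (k + 1) * (m.choose k : ℝ) * e ^ k := by
  have h := add_pow (-e) 1 m
  rw [Finset.sum_range_succ'] at h
  rw [← Finset.Ico_add_one_right_eq_Icc, Finset.sum_Ico_eq_sum_range, Nat.add_sub_cancel,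
    show 1 - e = -e + 1 by ring, h]
  simp only [pow_zero, Nat.choose_zero_right, Nat.cast_one, one_pow, mul_one, sub_add_cancel_right,
    ← Finset.sum_neg_distrib]
  refine Finset.sum_congr rfl fun k _ => ?_
  rw [neg_pow e, add_comm 1 k]
  ring

namespace Network

variable {p : Params} {Ω : Type*} [MeasurableSpace Ω] {μ : Measure Ω} (N : Network p μ)

/-- The threshold of the channel gain, as a measurable random variable. -/
noncomputable def thr (z : ℝ) (ω : Ω) : ℝ :=
  z * N.RT ω ^ p.alphaT * (N.interf ω + p.sigma2T) / (p.GM * p.PT * p.CT)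

lemma measurable_thr (z : ℝ) : Measurable (N.thr z) := by
  have := N.measurable_RT
  have := N.measurable_interf
  unfold thr
  fun_prop

lemma RT_nonneg (ω : Ω) : 0 ≤ N.RT ω := Real.iInf_nonneg fun _ => norm_nonneg _

lemma thr_nonneg {z : ℝ} (hz : 0 ≤ z) (ω : Ω) : 0 ≤ N.thr z ω := by
  have := N.RT_nonneg ω
  have := N.interf_nonneg ω
  have := p.sigma2T_pos
  have := p.GM_pos
  have := p.PT_pos
  have := p.CT_pos
  unfold thr
  positivity

lemma thr_eq_mul (z : ℝ) (ω : Ω) : N.thr z ω = z * N.thr 1 ω := by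
  unfold thr; ring

lemma exp_thr_mem {κ z : ℝ} (hκ : 0 ≤ κ) (hz : 0 ≤ z) (ω : Ω) :
    Real.exp (-(κ * N.thr z ω)) ∈ Ioc (0 : ℝ) 1 :=
  ⟨Real.exp_pos _, Real.exp_le_one_iff.2 (neg_nonpos.2 (mul_nonneg hκ (N.thr_nonneg hz ω)))⟩

lemma threshold_ae (z : ℝ) : N.threshold z =ᵐ[N.condT] N.thr z := by
  filter_upwards [N.interference_ae_condT] with ω hω
  rw [threshold, thr, hω]

variable [IsProbabilityMeasure μ]

/-- Given the serving distance r, κ·thr equals s(I + σ²) with s = κzr^α/η. The noise gives a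
deterministic factor and the interference gives its Laplace transform at an argument that varies
with r. -/
lemma integral_exp_thr {κ z : ℝ} (hκ : 0 ≤ κ) (hz : 0 ≤ z) :
    IntervalIntegrable (fun r => Real.exp (-(κ * (z * r ^ p.alphaT * p.sigma2T /
        (p.GM * p.PT * p.CT)))) * p.laplaceI (κ * (z * r ^ p.alphaT / (p.GM * p.PT * p.CT))) r *
        p.fHatT N.AT r) volume 0 p.RB ∧
    ∫ ω, Real.exp (-(κ * N.thr z ω)) ∂N.condT =
      ∫ r in (0)..p.RB, Real.exp (-(κ * (z * r ^ p.alphaT * p.sigma2T /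
        (p.GM * p.PT * p.CT)))) * p.laplaceI (κ * (z * r ^ p.alphaT / (p.GM * p.PT * p.CT))) r *
        p.fHatT N.AT r := by
  have hs2 := p.sigma2T_pos
  have hGM := p.GM_pos
  have hPT := p.PT_pos
  have hCT := p.CT_pos
  have hRB := p.RB_pos
  have hJ := N.measurable_interf
  have hT := N.measurable_RT
  -- Taking `|r|` keeps the argument nonnegative on the whole line. The density vanishes off (0,
  -- RB], so the extension does not affect the integral.
  set σ : ℝ → ℝ := fun r => κ * (z * |r| ^ p.alphaT / (p.GM * p.PT * p.CT)) with hσd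
  have hσ : Measurable σ := by fun_prop
  have hσ0 : ∀ r, 0 ≤ σ r := fun r => by positivity
  set v : ℝ → ℝ := fun r => Real.exp (-(σ r * p.sigma2T)) with hvd
  have hv : Measurable v := by fun_prop
  have hv0 : ∀ r, 0 ≤ v r := fun r => (Real.exp_pos _).le
  have hv1 : ∀ r, v r ≤ 1 := fun r =>
    Real.exp_le_one_iff.2 (neg_nonpos.2 (mul_nonneg (hσ0 r) hs2.le))
  set g : ℝ → ℝ := fun r => v r * (p.radialLaplace (σ r) r * p.fHatT N.AT r) with hgd
  have hg : Measurable g :=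
    hv.mul ((p.measurable_radialLaplace_comp hσ hσ0).mul (p.measurable_fHatT _))
  have hg0 : ∀ r, 0 ≤ g r := fun r =>
    mul_nonneg (hv0 r) (mul_nonneg (p.radialLaplace_pos _ _).le (p.fHatT_nonneg N.AT_pos.le r))
  have key := N.lintegral_condT_laplace_comp hσ hσ0 (w := fun r => ENNReal.ofReal (v r))
    hv.ennreal_ofReal (fun r => ENNReal.ofReal_le_one.2 (hv1 r))
  have e1 : ∫⁻ ω, ENNReal.ofReal (Real.exp (-(κ * N.thr z ω))) ∂N.condT =
      ∫⁻ r, ENNReal.ofReal (g r) := by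
    refine Eq.trans (lintegral_congr_ae ?_) (key.trans (lintegral_congr fun r => ?_))
    · filter_upwards [N.ae_RT_mem] with ω hω
      rw [← ENNReal.ofReal_mul (hv0 _), ← Real.exp_add]
      congr 2
      simp only [hσd, thr, abs_of_pos hω.1]
      ring
    · rw [← ENNReal.ofReal_mul (hv0 _)]
  have hthr := N.measurable_thr z
  have hfin : ∫⁻ r, ENNReal.ofReal (g r) ≠ ⊤ := by
    rw [← e1]
    refine ne_top_of_le_ne_top (b := ∫⁻ ω, 1 ∂N.condT) (by simp) (lintegral_mono fun ω => ?_)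
    exact ENNReal.ofReal_le_one.2 (Real.exp_le_one_iff.2
      (neg_nonpos.2 (mul_nonneg hκ (N.thr_nonneg hz ω))))
  have hgi : Integrable g := ⟨hg.aestronglyMeasurable, by
    rw [hasFiniteIntegral_iff_ofReal (ae_of_all _ hg0)]; exact hfin.lt_top⟩
  have heq : EqOn g (fun r => Real.exp (-(κ * (z * r ^ p.alphaT * p.sigma2T /
        (p.GM * p.PT * p.CT)))) * p.laplaceI (κ * (z * r ^ p.alphaT / (p.GM * p.PT * p.CT))) r *
        p.fHatT N.AT r) (Ioc 0 p.RB) := fun r hr => by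
    have hL : p.laplaceI (σ r) r = p.radialLaplace (σ r) r := p.laplaceI_eq (hσ0 r) hr.1.le hr.2
    simp only [hgd]
    rw [← hL]
    simp only [hvd, hσd, abs_of_pos hr.1]
    rw [mul_assoc (Real.exp _)]
    congr 3
    ring
  constructor
  · rw [intervalIntegrable_iff_integrableOn_Ioc_of_le hRB.le]
    exact hgi.integrableOn.congr_fun heq measurableSet_Ioc
  · rw [integral_eq_lintegral_of_nonneg_ae (ae_of_all _ fun ω => (Real.exp_pos _).le) (by fun_prop),
      e1, ← integral_eq_lintegral_of_nonneg_ae (ae_of_all _ hg0) hg.aestronglyMeasurable,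
      intervalIntegral.integral_of_le hRB.le, ← setIntegral_congr_fun measurableSet_Ioc heq,
      setIntegral_eq_integral_of_forall_compl_eq_zero fun r hr => ?_]
    simp only [hgd, p.fHatT_eq_zero hr, mul_zero]

lemma integrable_exp_thr {κ z : ℝ} (hκ : 0 ≤ κ) (hz : 0 ≤ z) :
    Integrable (fun ω => Real.exp (-(κ * N.thr z ω))) N.condT := by
  have hthr := N.measurable_thr z
  refine Integrable.of_bound (C := 1) (by fun_prop) (ae_of_all _ fun ω => ?_)
  rw [Real.norm_eq_abs, abs_of_pos (N.exp_thr_mem hκ hz ω).1]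
  exact (N.exp_thr_mem hκ hz ω).2

lemma integrable_one_sub_exp_thr_pow {c z : ℝ} (hc : 0 ≤ c) (hz : 0 ≤ z) (m : ℕ) :
    Integrable (fun ω => (1 - Real.exp (-(c * N.thr z ω))) ^ m) N.condT := by
  have hthr := N.measurable_thr z
  refine Integrable.of_bound (C := 1) (by fun_prop) (ae_of_all _ fun ω => ?_)
  have := N.exp_thr_mem hc hz ω
  rw [Real.norm_eq_abs, abs_of_nonneg (pow_nonneg (sub_nonneg.2 this.2) _)]
  exact pow_le_one₀ (sub_nonneg.2 this.2) (by linarith [this.1])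

/-- Expand the power by the binomial theorem and apply `integral_exp_thr` with κ = kc to every term.
-/
lemma approxCCDF_eq {c z : ℝ} (hc : 0 ≤ c) (hz : 0 ≤ z) :
    p.approxCCDF N.AT c z = ∫ ω, (1 - (1 - Real.exp (-(c * N.thr z ω))) ^ p.mT) ∂N.condT := by
  have hk : ∀ k : ℕ, 0 ≤ (k : ℝ) * c := fun k => by positivity
  simp only [one_sub_one_sub_pow, ← Real.exp_nat_mul, Params.approxCCDF, Finset.sum_mul]
  rw [integral_finsetSum, intervalIntegral.integral_finsetSum]
  · refine Finset.sum_congr rfl fun k _ => ?_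
    have h := (N.integral_exp_thr (hk k) hz).2
    have e : ∀ ω, (k : ℝ) * -(c * N.thr z ω) = -(k * c * N.thr z ω) := fun ω => by ring
    simp_rw [e]
    rw [integral_const_mul, h, ← intervalIntegral.integral_const_mul]
    congr 1 with r
    ring
  · intro k _
    convert ((N.integral_exp_thr (hk k) hz).1.const_mul ((-1 : ℝ) ^ (k + 1) * (p.mT.choose k : ℝ)))
      using 1
    ext r
    ring
  · intro k _
    refine Integrable.const_mul ?_ _
    refine (N.integrable_exp_thr (hk k) hz).congr (ae_of_all _ fun ω => ?_)
    beta_reduce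
    congr 1
    ring

end Network

/-! ### Independence of the serving station's channel gain. -/

/-- Positions of all stations, and interference gains of the terrestrial stations. -/
abbrev Outer := ((ℕ → Plane) × (ℕ → Plane) × (ℕ → Plane)) × (ℕ → ℝ)

/-- Serving distance and interference. -/
noncomputable def distInterf (p : Params) (q : Outer) (h : ℕ → ℝ) : ℝ × ℝ :=
  (nearestDist q.1.1, (p.interferenceENN q.1.1 q.2 h).toReal)

lemma measurable_distInterf (p : Params) :
    Measurable fun z : Outer × (ℕ → ℝ) => distInterf p z.1 z.2 := by
  have hm : Measurable fun z : Outer × (ℕ → ℝ) => ((z.1.1.1, z.1.2), z.2) := by fun_prop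
  have hx : Measurable fun z : Outer × (ℕ → ℝ) => z.1.1.1 := by fun_prop
  have h1 := measurable_nearestDist.comp hx
  have h2 := (p.measurable_interferenceENN.comp hm).ennreal_toReal
  exact h1.prodMk h2

lemma measurable_nearest_mark :
    Measurable fun z : Outer × (ℕ → ℝ) => z.2 (nearestIdx z.1.1.1) := by
  have hx : Measurable fun z : Outer × (ℕ → ℝ) => z.1.1.1 := by fun_prop
  have h1 := measurable_nearestIdx.comp hx
  have h2 : Measurable fun z : (Outer × (ℕ → ℝ)) × ℕ => z.1.2 z.2 :=
    measurable_from_prod_countable_left fun k => (measurable_pi_apply k).comp measurable_snd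
  have := h2.comp (measurable_id.prodMk h1)
  exact this

/-- The serving station does not interfere, so its channel gain may be overwritten. The interference
is thereby a function of gains independent of the serving one. -/
lemma interferenceENN_update (p : Params) (x : ℕ → Plane) (g h : ℕ → ℝ) :
    p.interferenceENN x g (Function.update h (nearestIdx x) 0) = p.interferenceENN x g h := by
  unfold Params.interferenceENN
  refine tsum_congr fun i => ?_
  split_ifs with hi
  · rw [Function.update_of_ne hi.1]
  · rfl

namespace Network

variable {p : Params} {Ω : Type*} [MeasurableSpace Ω] {μ : Measure Ω} (N : Network p μ)

lemma measurable_update_H (k : ℕ) :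
    Measurable fun ω => Function.update (fun i => N.H i ω) k 0 := by
  refine measurable_pi_iff.2 fun i => ?_
  by_cases hi : i = k
  · subst hi; simp
  · simpa [Function.update_of_ne hi] using N.measurable_H i

lemma indepFun_update_H (k : ℕ) :
    IndepFun (fun ω => Function.update (fun i => N.H i ω) k 0) (N.H k) μ := by
  have h := N.indep_H
  rw [iIndepFun_iff_iIndep] at h
  refine indepFun_of_iIndep (fun i => (N.measurable_H i).comap_le) h (S := {k}ᶜ) (T := {k})
    (by simp) ?_ ?_
  · refine (@measurable_pi_iff _ _ _ (_) _ _).2 fun i => ?_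
    by_cases hi : i = k
    · subst hi
      simp only [Function.update_self]
      exact @measurable_const _ _ _ (_) _
    · simp only [Function.update_of_ne hi]
      exact Measurable.mono (comap_measurable (N.H i)) (le_iSup₂_of_le i (by simpa using hi) le_rfl)
        le_rfl
  · exact Measurable.mono (comap_measurable (N.H k)) (le_iSup₂_of_le k (by simp) le_rfl) le_rfl

lemma measurable_H_serving : Measurable fun ω => N.H (N.serving ω) ω := by
  have h1 : Measurable N.serving := measurable_nearestIdx.comp N.measurable_XSeq
  have h2 : Measurable fun z : Ω × ℕ => N.H z.2 z.1 :=
    measurable_from_prod_countable_left fun k => N.measurable_H k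
  have := h2.comp (measurable_id.prodMk h1)
  exact this

instance isProbabilityMeasure_fadingLaw : IsProbabilityMeasure p.fadingLaw := by
  have : (0 : ℝ) < p.mT := Nat.cast_pos.2 p.one_le_mT
  exact isProbabilityMeasure_gammaMeasure this this

variable [IsProbabilityMeasure μ]

/-- Once positions are fixed the serving index `k` is deterministic, and the gain `H k` is
independent of the sequence with its `k`-th entry erased, which determines the interference. -/
lemma lintegral_nearest_mark {K : ℝ → ℝ × ℝ → ENNReal}
    (hK : Measurable fun z : ℝ × ℝ × ℝ => K z.1 z.2) (q : Outer) :
    ∫⁻ ω', K (N.H (nearestIdx q.1.1) ω') (distInterf p q fun i => N.H i ω') ∂μ =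
      ∫⁻ ω', ∫⁻ y, K y (distInterf p q fun i => N.H i ω') ∂p.fadingLaw ∂μ := by
  set k := nearestIdx q.1.1
  have hDk : ∀ ω', distInterf p q (Function.update (fun i => N.H i ω') k 0) =
      distInterf p q fun i => N.H i ω' := fun ω' => by
    rw [distInterf, interferenceENN_update]; rfl
  have hDq : Measurable fun h => distInterf p q h := by
    have hm : Measurable fun h : ℕ → ℝ => (q, h) := measurable_const.prodMk measurable_id
    have := (measurable_distInterf p).comp hm
    exact this
  have hF : Measurable fun z : (ℕ → ℝ) × ℝ => K z.2 (distInterf p q z.1) := by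
    have hm : Measurable fun z : (ℕ → ℝ) × ℝ => (z.2, distInterf p q z.1) :=
      measurable_snd.prodMk (hDq.comp measurable_fst)
    have := hK.comp hm
    exact this
  have := lintegral_comp_of_indepFun (N.measurable_update_H k) (N.measurable_H k)
    (N.indepFun_update_H k) (F := fun h y => K y (distInterf p q h)) hF
  simp only [hDk] at this
  rw [this]
  refine lintegral_congr fun ω' => ?_
  rw [← lintegral_map (f := fun y => K y (distInterf p q fun i => N.H i ω'))
    (hK.comp measurable_prodMk_right) (N.measurable_H k), N.law_H k]

/-- The channel gain of the serving station is independent of the serving distance and of the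
interference. -/
theorem lintegral_serving {K : ℝ → ℝ × ℝ → ENNReal}
    (hK : Measurable fun z : ℝ × ℝ × ℝ => K z.1 z.2) :
    ∫⁻ ω, K (N.H (N.serving ω) ω) (N.RT ω, N.interf ω) ∂N.condT =
      ∫⁻ ω, ∫⁻ y, K y (N.RT ω, N.interf ω) ∂p.fadingLaw ∂N.condT := by
  have hD := measurable_distInterf p
  have hS := measurable_nearest_mark
  have hB : Measurable fun z : Outer × (ℕ → ℝ) => p.assocSet.indicator (fun _ => (1 : ENNReal)) z.1.1 :=
    (measurable_const.indicator p.measurableSet_assocSet).comp (measurable_fst.comp measurable_fst)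
  have hKS : Measurable fun z : Outer × (ℕ → ℝ) => K (z.2 (nearestIdx z.1.1.1)) (distInterf p z.1 z.2) :=
    hK.comp (hS.prodMk hD)
  have hKI : Measurable fun u : ℝ × ℝ => ∫⁻ y, K y u ∂p.fadingLaw :=
    Measurable.lintegral_prod_left' (f := fun z : ℝ × ℝ × ℝ => K z.1 z.2) hK
  have hKD : Measurable fun z : Outer × (ℕ → ℝ) => ∫⁻ y, K y (distInterf p z.1 z.2) ∂p.fadingLaw := hKI.comp hD
  have hq : Measurable fun ω => ((N.positions ω, fun i => N.G i ω) : Outer) :=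
    N.measurable_positions.prodMk N.measurable_GSeq
  have e1 := lintegral_comp_of_indepFun hq N.measurable_HSeq N.indepFun_H
    (F := fun q h => p.assocSet.indicator (fun _ => (1 : ENNReal)) q.1 *
      K (h (nearestIdx q.1.1)) (distInterf p q h)) (hB.mul hKS)
  have e2 := lintegral_comp_of_indepFun hq N.measurable_HSeq N.indepFun_H
    (F := fun q h => p.assocSet.indicator (fun _ => (1 : ENNReal)) q.1 *
      ∫⁻ y, K y (distInterf p q h) ∂p.fadingLaw) (hB.mul hKD)
  -- The association indicator depends on positions only, so it factors out of the integral over the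
  -- fading.
  have ind : ∀ ω (f : Ω → ENNReal), N.assocT.indicator f ω =
      p.assocSet.indicator (fun _ => (1 : ENNReal)) (N.positions ω) * f ω := by
    intro ω f
    by_cases h : ω ∈ N.assocT
    · rw [indicator_of_mem h, indicator_of_mem (by exact N.mem_assocT.1 h), one_mul]
    · rw [indicator_of_notMem h, indicator_of_notMem (by exact fun h' => h (N.mem_assocT.2 h')),
        zero_mul]
  rw [N.lintegral_condT, N.lintegral_condT, ← lintegral_indicator N.measurableSet_assocT,
    ← lintegral_indicator N.measurableSet_assocT]
  simp only [ind]
  congr 1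
  refine Eq.trans e1 (Eq.trans (lintegral_congr fun ω => ?_) e2.symm)
  have hm1 : Measurable fun ω' => K (N.H (nearestIdx (N.positions ω).1) ω')
      (distInterf p (N.positions ω, fun i => N.G i ω) fun i => N.H i ω') := by
    have := hKS.comp ((measurable_const (a := ((N.positions ω, fun i => N.G i ω) : Outer))).prodMk
      N.measurable_HSeq)
    exact this
  have hm2 : Measurable fun ω' => ∫⁻ y, K y
      (distInterf p (N.positions ω, fun i => N.G i ω) fun i => N.H i ω') ∂p.fadingLaw := by
    have := hKD.comp ((measurable_const (a := ((N.positions ω, fun i => N.G i ω) : Outer))).prodMk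
      N.measurable_HSeq)
    exact this
  refine (lintegral_const_mul _ hm1).trans (Eq.trans ?_ (lintegral_const_mul _ hm2).symm)
  congr 1
  exact N.lintegral_nearest_mark hK (N.positions ω, fun i => N.G i ω)

end Network

/-! ### The tail of the SINR and its two bounds. -/

namespace Params
variable (p : Params)

lemma monotone_fadingLaw_Iic : Monotone fun t => p.fadingLaw.real (Iic t) := by
  intro s t hst
  exact measureReal_mono (Iic_subset_Iic.2 hst)

lemma measurable_fadingLaw_Iic : Measurable fun t => p.fadingLaw.real (Iic t) :=
  p.monotone_fadingLaw_Iic.measurable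

lemma fadingLaw_Ioi (t : ℝ) : p.fadingLaw.real (Ioi t) = 1 - p.fadingLaw.real (Iic t) := by
  rw [← compl_Iic, probReal_compl_eq_one_sub measurableSet_Iic]

end Params

namespace Network

variable {p : Params} {Ω : Type*} [MeasurableSpace Ω] {μ : Measure Ω} (N : Network p μ)

/-- The SINR, as a measurable random variable. -/
noncomputable def msinr (ω : Ω) : ℝ :=
  p.GM * p.PT * p.CT * N.RT ω ^ (-p.alphaT) * N.H (N.serving ω) ω / (N.interf ω + p.sigma2T)

lemma measurable_msinr : Measurable N.msinr := by
  have := N.measurable_RT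
  have := N.measurable_interf
  have := N.measurable_H_serving
  unfold msinr
  fun_prop

lemma lt_msinr_iff (z : ℝ) {ω : Ω} (h : 0 < N.RT ω) :
    z < N.msinr ω ↔ N.thr z ω < N.H (N.serving ω) ω := by
  have h1 := p.GM_pos
  have h2 := p.PT_pos
  have h3 := p.CT_pos
  have h4 := p.sigma2T_pos
  have h5 := N.interf_nonneg ω
  have h6 := Real.rpow_pos_of_pos h p.alphaT
  rw [msinr, thr, Real.rpow_neg h.le, lt_div_iff₀ (by positivity), div_lt_iff₀ (by positivity)]
  have e : p.GM * p.PT * p.CT * (N.RT ω ^ p.alphaT)⁻¹ * N.H (N.serving ω) ω =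
      N.H (N.serving ω) ω * (p.GM * p.PT * p.CT) / N.RT ω ^ p.alphaT := by
    field_simp
  rw [e, lt_div_iff₀ h6]
  constructor <;> intro h <;> linarith

lemma sinr_ae : N.sinr =ᵐ[N.condT] N.msinr := by
  filter_upwards [N.interference_ae_condT] with ω hω
  rw [sinr, msinr, hω]

lemma ccdf_eq_msinr (z : ℝ) : N.ccdf z = N.condT.real {ω | z < N.msinr ω} := by
  refine measureReal_congr ?_
  filter_upwards [N.sinr_ae] with ω hω
  exact propext (by change z < N.sinr ω ↔ z < N.msinr ω; rw [hω])

variable [IsProbabilityMeasure μ]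

lemma integrable_fadingLaw_Iic (z : ℝ) :
    Integrable (fun ω => p.fadingLaw.real (Iic (N.thr z ω))) N.condT := by
  refine Integrable.of_bound (C := 1)
    (p.measurable_fadingLaw_Iic.comp (N.measurable_thr z)).aestronglyMeasurable
    (ae_of_all _ fun ω => ?_)
  rw [Real.norm_eq_abs, abs_of_nonneg measureReal_nonneg]
  exact measureReal_le_one

/-- The event is that the serving gain exceeds the threshold; by `lintegral_serving` the gain can be
integrated out with the threshold held fixed. -/
lemma ccdf_eq (z : ℝ) : N.ccdf z = ∫ ω, p.fadingLaw.real (Ioi (N.thr z ω)) ∂N.condT := by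
  have hm : MeasurableSet {ω | N.thr z ω < N.H (N.serving ω) ω} :=
    measurableSet_lt (N.measurable_thr z) N.measurable_H_serving
  have hK : Measurable fun u : ℝ × ℝ × ℝ =>
      (Ioi (z * u.2.1 ^ p.alphaT * (u.2.2 + p.sigma2T) / (p.GM * p.PT * p.CT))).indicator
        (fun _ => (1 : ENNReal)) u.1 := by
    have hs : MeasurableSet {u : ℝ × ℝ × ℝ |
        z * u.2.1 ^ p.alphaT * (u.2.2 + p.sigma2T) / (p.GM * p.PT * p.CT) < u.1} :=
      measurableSet_lt (by fun_prop) (by fun_prop)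
    exact (measurable_const (a := (1 : ENNReal))).indicator hs
  have key := N.lintegral_serving (K := fun y u =>
    (Ioi (z * u.1 ^ p.alphaT * (u.2 + p.sigma2T) / (p.GM * p.PT * p.CT))).indicator
      (fun _ => (1 : ENNReal)) y) hK
  have e1 : N.condT {ω | z < N.msinr ω} = ∫⁻ ω, p.fadingLaw (Ioi (N.thr z ω)) ∂N.condT := by
    have : ({ω | z < N.msinr ω} : Set Ω) =ᵐ[N.condT] {ω | N.thr z ω < N.H (N.serving ω) ω} := by
      filter_upwards [N.ae_RT_mem] with ω hω
      exact propext (N.lt_msinr_iff z hω.1)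
    rw [measure_congr this, ← lintegral_indicator_one hm]
    refine Eq.trans ?_ (key.trans (lintegral_congr fun ω => ?_))
    · rfl
    · rw [lintegral_indicator_const measurableSet_Ioi, one_mul]
      rfl
  have hi : Measurable fun ω => p.fadingLaw.real (Ioi (N.thr z ω)) := by
    simp only [p.fadingLaw_Ioi]
    exact measurable_const.sub (p.measurable_fadingLaw_Iic.comp (N.measurable_thr z))
  rw [N.ccdf_eq_msinr, measureReal_def, e1,
    integral_eq_lintegral_of_nonneg_ae (ae_of_all _ fun ω => measureReal_nonneg)
      hi.aestronglyMeasurable]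
  exact congrArg _ (lintegral_congr fun ω => (ofReal_measureReal (by finiteness)).symm)

lemma one_sub_ccdf_eq (z : ℝ) :
    1 - N.ccdf z = ∫ ω, p.fadingLaw.real (Iic (N.thr z ω)) ∂N.condT := by
  rw [N.ccdf_eq]
  simp only [p.fadingLaw_Ioi]
  rw [integral_sub (integrable_const _) (N.integrable_fadingLaw_Iic z)]
  simp

lemma one_sub_approxCCDF_eq {c z : ℝ} (hc : 0 ≤ c) (hz : 0 ≤ z) :
    1 - p.approxCCDF N.AT c z = ∫ ω, (1 - Real.exp (-(c * N.thr z ω))) ^ p.mT ∂N.condT := by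
  rw [N.approxCCDF_eq hc hz,
    integral_sub (integrable_const _) (N.integrable_one_sub_exp_thr_pow hc hz _)]
  simp

theorem approxCCDF_le_ccdf {z : ℝ} (hz : 0 ≤ z) : p.approxCCDF N.AT p.mT z ≤ N.ccdf z := by
  have h : 1 - N.ccdf z ≤ 1 - p.approxCCDF N.AT p.mT z := by
    rw [N.one_sub_ccdf_eq, N.one_sub_approxCCDF_eq (Nat.cast_nonneg _) hz]
    exact integral_mono (N.integrable_fadingLaw_Iic z)
      (N.integrable_one_sub_exp_thr_pow (Nat.cast_nonneg _) hz _)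
      fun ω => gammaMeasure_real_Iic_le_pow p.one_le_mT (N.thr_nonneg hz ω)
  linarith

theorem one_sub_approxCCDF_le {z : ℝ} (hz : 0 ≤ z) :
    1 - p.approxCCDF N.AT p.bT z ≤ 1 - N.ccdf z := by
  rw [N.one_sub_ccdf_eq, N.one_sub_approxCCDF_eq p.bT_pos.le hz]
  exact integral_mono (N.integrable_one_sub_exp_thr_pow p.bT_pos.le hz _)
    (N.integrable_fadingLaw_Iic z)
    fun ω => pow_le_gammaMeasure_real_Iic p (N.thr_nonneg hz ω)

end Network

/-! ### The ergodic rate. -/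

/-- With u the inverse serving distance, this trades an arbitrary path loss exponent for a bound
linear in u, so integrability of u alone suffices. -/
lemma log_one_add_rpow_le {u α : ℝ} (hu : 0 ≤ u) (hα : 0 ≤ α) :
    Real.log (1 + u ^ α) ≤ Real.log 2 + α * u := by
  have h0 : 0 ≤ u ^ α := Real.rpow_nonneg hu _
  have h1 : u ^ α ≤ (1 + u) ^ α := Real.rpow_le_rpow hu (by linarith) hα
  have h2 : 1 ≤ (1 + u) ^ α := Real.one_le_rpow (by linarith) hα
  calc Real.log (1 + u ^ α) ≤ Real.log (2 * (1 + u) ^ α) :=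
        Real.log_le_log (by linarith) (by linarith)
    _ = Real.log 2 + α * Real.log (1 + u) := by
        rw [Real.log_mul (by norm_num) (by linarith), Real.log_rpow (by linarith)]
    _ ≤ _ := by
        have := Real.log_le_sub_one_of_pos (show 0 < 1 + u by linarith)
        have := mul_le_mul_of_nonneg_left this hα
        linarith

lemma integral_inv_one_add {x : ℝ} (hx : 0 ≤ x) :
    ∫ t in (0)..x, (1 + t)⁻¹ = Real.log (1 + x) := by
  have h := intervalIntegral.integral_comp_add_left (a := 0) (b := x) (fun t : ℝ => t⁻¹) 1
  rw [h, add_zero, integral_inv_of_pos one_pos (by linarith), div_one]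

namespace Params
variable (p : Params)

lemma assocProb_le_one (r : ℝ) : p.assocProb r ≤ 1 := by
  have hl := p.lamA_pos
  have hp := Real.pi_pos
  have aux : ∀ (F : ℝ → ℝ) (R : ℝ), (∀ x, 0 ≤ F x) → 0 ≤ R →
      Real.exp (-2 * Real.pi * p.lamA * ∫ x in (0)..R, x * F x) ≤ 1 := by
    intro F R hF hR
    have : 0 ≤ ∫ x in (0)..R, x * F x :=
      intervalIntegral.integral_nonneg hR fun x hx => mul_nonneg hx.1 (hF x)
    rw [Real.exp_le_one_iff]
    have : 0 ≤ 2 * Real.pi * p.lamA * ∫ x in (0)..R, x * F x := by positivity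
    linarith
  exact mul_le_one₀ (aux _ _ (fun x => (p.PL_mem x).1) (Real.sqrt_nonneg _)) (Real.exp_pos _).le
    (aux _ _ (fun x => (p.PN_mem x).1) (Real.sqrt_nonneg _))

end Params

namespace Network

variable {p : Params} {Ω : Type*} [MeasurableSpace Ω] {μ : Measure Ω} (N : Network p μ)

lemma ccdf_div_nonneg {z : ℝ} (hz : 0 < z) : 0 ≤ N.ccdf z / (1 + z) :=
  div_nonneg measureReal_nonneg (by linarith)

lemma H_serving_nonneg : ∀ᵐ ω ∂N.condT, 0 ≤ N.H (N.serving ω) ω := by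
  have h : ∀ᵐ ω ∂N.condT, ∀ i, 0 ≤ N.H i ω := N.condT_absolutelyContinuous.ae_le N.ae_nonneg_H
  exact h.mono fun ω hω => hω _

lemma msinr_nonneg : ∀ᵐ ω ∂N.condT, 0 ≤ N.msinr ω := by
  filter_upwards [N.H_serving_nonneg] with ω hω
  have h1 := p.GM_pos
  have h2 := p.PT_pos
  have h3 := p.CT_pos
  have h4 := p.sigma2T_pos
  have h5 := N.interf_nonneg ω
  have h6 := N.RT_nonneg ω
  unfold msinr
  positivity

lemma logb_sinr_ae : (fun ω => Real.logb 2 (1 + N.sinr ω)) =ᵐ[N.condT]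
    fun ω => 1 / Real.log 2 * Real.log (1 + N.msinr ω) := by
  filter_upwards [N.sinr_ae] with ω hω
  rw [hω, Real.logb]; ring

variable [IsProbabilityMeasure μ]

/-- The density of the serving distance carries a factor r from planar polar coordinates, which
cancels 1/r and leaves a bounded function on (0, RB]. -/
lemma integrable_inv_RT : Integrable (fun ω => (N.RT ω)⁻¹) N.condT := by
  refine ⟨N.measurable_RT.inv.aestronglyMeasurable, ?_⟩
  rw [hasFiniteIntegral_iff_ofReal (ae_of_all _ fun ω => inv_nonneg.2 (N.RT_nonneg ω)),
    N.lintegral_RT (w := fun r => ENNReal.ofReal r⁻¹) measurable_inv.ennreal_ofReal]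
  have hA := N.AT_pos
  have hl := p.lamT_pos
  have hp := Real.pi_pos
  calc ∫⁻ r, ENNReal.ofReal r⁻¹ * ENNReal.ofReal (p.fHatT N.AT r)
      ≤ ∫⁻ r, (Ioc 0 p.RB).indicator
          (fun _ => ENNReal.ofReal (2 * Real.pi * p.lamT / N.AT)) r := by
        refine lintegral_mono fun r => ?_
        by_cases hr : r ∈ Ioc 0 p.RB
        · rw [indicator_of_mem hr, ← ENNReal.ofReal_mul (inv_nonneg.2 hr.1.le)]
          refine ENNReal.ofReal_le_ofReal ?_
          have hr0 := hr.1
          rw [p.fHatT_eq, Params.fT, if_pos ⟨hr.1.le, hr.2⟩]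
          have h1 : Real.exp (-Real.pi * p.lamT * r ^ 2) ≤ 1 := by
            rw [Real.exp_le_one_iff]
            have : 0 ≤ Real.pi * p.lamT * r ^ 2 := by positivity
            linarith
          have h2 := p.assocProb_le_one r
          have h3 := p.assocProb_pos r
          have e : r⁻¹ * (2 * Real.pi * p.lamT * r * Real.exp (-Real.pi * p.lamT * r ^ 2) *
              p.assocProb r / N.AT) = 2 * Real.pi * p.lamT / N.AT *
              (Real.exp (-Real.pi * p.lamT * r ^ 2) * p.assocProb r) := by
            field_simp
          rw [e]
          exact mul_le_of_le_one_right (by positivity) (mul_le_one₀ h1 h3.le h2)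
        · rw [indicator_of_notMem hr, p.fHatT_eq_zero hr]; simp
    _ < ⊤ := by
        rw [lintegral_indicator_const measurableSet_Ioc]
        simp [ENNReal.mul_lt_top_iff]

lemma integrable_H_serving : Integrable (fun ω => N.H (N.serving ω) ω) N.condT := by
  refine ⟨N.measurable_H_serving.aestronglyMeasurable, ?_⟩
  rw [hasFiniteIntegral_iff_ofReal N.H_serving_nonneg]
  have key := N.lintegral_serving (K := fun y _ => ENNReal.ofReal y)
    (measurable_fst.ennreal_ofReal)
  rw [key, lintegral_const, measure_univ, mul_one]
  have := lintegral_pow_gammaMeasure_lt_top p.one_le_mT 1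
  simp only [pow_one] at this
  exact this

lemma integrable_log : Integrable (fun ω => Real.log (1 + N.msinr ω)) N.condT := by
  have h1 := p.GM_pos
  have h2 := p.PT_pos
  have h3 := p.CT_pos
  have h4 := p.sigma2T_pos
  set c := p.GM * p.PT * p.CT / p.sigma2T with hc
  have hc0 : 0 < c := by positivity
  have hm := N.measurable_msinr
  refine Integrable.mono' (g := fun ω => Real.log (1 + c) + (Real.log 2 + p.alphaT * (N.RT ω)⁻¹) +
    N.H (N.serving ω) ω) ?_
    (Real.measurable_log.comp (hm.const_add 1)).aestronglyMeasurable ?_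
  · exact ((integrable_const _).add ((integrable_const _).add
      (N.integrable_inv_RT.const_mul _))).add N.integrable_H_serving
  · filter_upwards [N.msinr_nonneg, N.H_serving_nonneg] with ω hS hH
    have hR := N.RT_nonneg ω
    have hJ := N.interf_nonneg ω
    rw [Real.norm_eq_abs, abs_of_nonneg (Real.log_nonneg (by linarith))]
    set u := (N.RT ω)⁻¹ with hu
    have hu0 : 0 ≤ u := inv_nonneg.2 hR
    have hua : 0 ≤ u ^ p.alphaT := Real.rpow_nonneg hu0 _
    have hle : N.msinr ω ≤ c * u ^ p.alphaT * N.H (N.serving ω) ω := by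
      rw [msinr, hc, hu, Real.inv_rpow hR, ← Real.rpow_neg hR, div_mul_eq_mul_div,
        div_mul_eq_mul_div]
      exact div_le_div_of_nonneg_left (by positivity) h4 (by linarith)
    -- Dropping the interference from the denominator lets the logarithm split into a constant, a
    -- distance term and a gain term, each integrable.
    have h5 : 1 + N.msinr ω ≤ (1 + c) * (1 + u ^ p.alphaT) * (1 + N.H (N.serving ω) ω) := by
      have : 0 ≤ c * N.H (N.serving ω) ω := by positivity
      have : 0 ≤ u ^ p.alphaT * N.H (N.serving ω) ω := by positivity
      have : 0 ≤ c * u ^ p.alphaT := by positivity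
      nlinarith
    have h6 := log_one_add_rpow_le hu0 p.alphaT_pos.le
    have h7 := Real.log_le_sub_one_of_pos (show 0 < 1 + N.H (N.serving ω) ω by linarith)
    calc Real.log (1 + N.msinr ω) ≤ _ := Real.log_le_log (by linarith) h5
      _ = Real.log (1 + c) + Real.log (1 + u ^ p.alphaT) + Real.log (1 + N.H (N.serving ω) ω) := by
        rw [Real.log_mul (by positivity) (by linarith), Real.log_mul (by linarith) (by linarith)]
      _ ≤ _ := by linarith

/-- The layer-cake formula, with log(1 + x) as the integral of 1/(1 + t) over [0, x]. -/
lemma lintegral_log : ∫⁻ ω, ENNReal.ofReal (Real.log (1 + N.msinr ω)) ∂N.condT =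
    ∫⁻ z in Ioi (0 : ℝ), ENNReal.ofReal (N.ccdf z / (1 + z)) := by
  have h := lintegral_comp_eq_lintegral_meas_lt_mul N.condT N.msinr_nonneg
    N.measurable_msinr.aemeasurable (g := fun t : ℝ => (1 + t)⁻¹) (fun t ht => ?_) ?_
  · refine Eq.trans (lintegral_congr_ae ?_) (h.trans ?_)
    · filter_upwards [N.msinr_nonneg] with ω hω
      rw [integral_inv_one_add hω]
    · refine setLIntegral_congr_fun measurableSet_Ioi fun z hz => ?_
      rw [N.ccdf_eq_msinr, div_eq_mul_inv, ENNReal.ofReal_mul measureReal_nonneg,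
        ofReal_measureReal]
  · refine ContinuousOn.intervalIntegrable_of_Icc (le_of_lt ht) ?_
    refine ContinuousOn.inv₀ (by fun_prop) fun x hx => ?_
    have := hx.1
    positivity
  · refine (ae_restrict_mem measurableSet_Ioi).mono fun t ht => ?_
    have : (0 : ℝ) < t := ht
    show (0 : ℝ) ≤ (1 + t)⁻¹
    positivity

lemma measurable_ccdf : Measurable N.ccdf := by
  have : Antitone N.ccdf := by
    intro s t hst
    simp only [N.ccdf_eq_msinr]
    exact measureReal_mono fun ω hω => lt_of_le_of_lt hst hω
  exact this.measurable

theorem integrableOn_ccdf_div : IntegrableOn (fun z => N.ccdf z / (1 + z)) (Ioi 0) := by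
  have hm := N.measurable_ccdf
  refine ⟨(hm.div (measurable_id.const_add 1)).aestronglyMeasurable, ?_⟩
  rw [hasFiniteIntegral_iff_ofReal ((ae_restrict_mem measurableSet_Ioi).mono fun z hz =>
    N.ccdf_div_nonneg hz), ← N.lintegral_log]
  exact (hasFiniteIntegral_iff_ofReal (N.msinr_nonneg.mono fun ω hω =>
    Real.log_nonneg (by linarith))).1 N.integrable_log.2

lemma integral_log : ∫ ω, Real.log (1 + N.msinr ω) ∂N.condT =
    ∫ z in Ioi (0 : ℝ), N.ccdf z / (1 + z) := by
  rw [integral_eq_lintegral_of_nonneg_ae (N.msinr_nonneg.mono fun ω hω =>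
      Real.log_nonneg (by linarith)) N.integrable_log.1, N.lintegral_log,
    integral_eq_lintegral_of_nonneg_ae ((ae_restrict_mem measurableSet_Ioi).mono fun z hz =>
      N.ccdf_div_nonneg hz) N.integrableOn_ccdf_div.1]

theorem integrable_logb : Integrable (fun ω => Real.logb 2 (1 + N.sinr ω)) N.condT :=
  (N.integrable_log.const_mul _).congr N.logb_sinr_ae.symm

theorem rate_eq : N.rate = 1 / Real.log 2 * ∫ z in Ioi (0 : ℝ), N.ccdf z / (1 + z) := by
  rw [rate, integral_congr_ae N.logb_sinr_ae, integral_const_mul, N.integral_log]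

end Network

/-! ### Moments of the threshold and the limit at small thresholds. -/

lemma sum_pow_le_card_pow_mul {ι : Type*} (s : Finset ι) (f : ι → ENNReal) (m : ℕ) (hm : m ≠ 0) :
    (∑ i ∈ s, f i) ^ m ≤ (s.card : ENNReal) ^ m * ∑ i ∈ s, f i ^ m := by
  rcases s.eq_empty_or_nonempty with rfl | hs
  · simp [hm]
  obtain ⟨j, hj, hmax⟩ := s.exists_max_image f hs
  calc (∑ i ∈ s, f i) ^ m ≤ (s.card • f j) ^ m := by
        gcongr
        exact Finset.sum_le_card_nsmul _ _ _ hmax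
    _ = (s.card : ENNReal) ^ m * f j ^ m := by rw [nsmul_eq_mul, mul_pow]
    _ ≤ _ := by
        gcongr
        exact Finset.single_le_sum (f := fun i => f i ^ m) (fun _ _ => zero_le) hj

lemma add_pow_le_two_pow_mul (a b : ENNReal) (m : ℕ) : (a + b) ^ m ≤ 2 ^ m * (a ^ m + b ^ m) := by
  rcases le_total a b with h | h
  · calc (a + b) ^ m ≤ (2 * b) ^ m := by gcongr; rw [two_mul]; gcongr
      _ ≤ _ := by rw [mul_pow]; gcongr; exact le_add_self
  · calc (a + b) ^ m ≤ (2 * a) ^ m := by gcongr; rw [two_mul]; gcongr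
      _ ≤ _ := by rw [mul_pow]; gcongr; exact le_self_add

lemma tsum_pow_mul_poisson_lt_top (k : ℕ) {l : ℝ} (hl : 0 ≤ l) :
    ∑' n : ℕ, (n : ENNReal) ^ k * ENNReal.ofReal (Real.exp (-l) * l ^ n / (n.factorial : ℝ)) < ⊤ := by
  have hs : Summable fun n : ℕ => (n : ℝ) ^ k * (Real.exp (-l) * l ^ n / (n.factorial : ℝ)) := by
    have h1 := ((Real.summable_pow_div_factorial (Real.exp 1 * l)).mul_left
      ((k.factorial : ℝ) * Real.exp (-l)))
    refine Summable.of_nonneg_of_le (fun n => by positivity) (fun n => ?_) h1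
    -- The bound n^k ≤ k!·e^n replaces `l` by e·l in the exponential series, which still converges.
    have h2 : (n : ℝ) ^ k ≤ k.factorial * Real.exp 1 ^ n := by
      have := Real.pow_div_factorial_le_exp (n : ℝ) (Nat.cast_nonneg n) k
      rw [div_le_iff₀ (by positivity), ← mul_one (n : ℝ), Real.exp_nat_mul] at this
      simp only [mul_one] at this
      linarith
    calc (n : ℝ) ^ k * (Real.exp (-l) * l ^ n / (n.factorial : ℝ))
        ≤ (k.factorial * Real.exp 1 ^ n) * (Real.exp (-l) * l ^ n / (n.factorial : ℝ)) := by gcongr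
      _ = _ := by rw [mul_pow]; ring
  have e : ∀ n : ℕ, (n : ENNReal) ^ k * ENNReal.ofReal (Real.exp (-l) * l ^ n / (n.factorial : ℝ)) =
      ENNReal.ofReal ((n : ℝ) ^ k * (Real.exp (-l) * l ^ n / (n.factorial : ℝ))) := fun n => by
    rw [ENNReal.ofReal_mul (by positivity), ENNReal.ofReal_pow (Nat.cast_nonneg n),
      ENNReal.ofReal_natCast]
  simp only [e]
  exact hs.tsum_ofReal_lt_top

/-- Sum of the marks of the points in a ball. -/
noncomputable def ballSum (R : ℝ) (x : ℕ → Plane) (h : ℕ → ℝ) : ENNReal :=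
  ∑' i, if ‖x i‖ ≤ R then ENNReal.ofReal (h i) else 0

lemma measurable_ballSum (R : ℝ) :
    Measurable fun z : (ℕ → Plane) × (ℕ → ℝ) => ballSum R z.1 z.2 := by
  refine Measurable.tsum fun i => Measurable.ite ?_ (by fun_prop) measurable_const
  exact measurableSet_le (by fun_prop) measurable_const

namespace Network

variable {p : Params} {Ω : Type*} [MeasurableSpace Ω] {μ : Measure Ω} (N : Network p μ)

/-- For fixed positions, `m` powers of the number of points come from bounding the power of the sum
and one more from summing equal moments. Only polynomial growth matters, as Poisson moments are
finite. -/
lemma lintegral_ballSum_pow_le {x : ℕ → Plane} (hx : LocallyFinite x) (R : ℝ) {m : ℕ} (hm : m ≠ 0) :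
    ∫⁻ ω, ballSum R x (fun i => N.H i ω) ^ m ∂μ ≤
      ({i | x i ∈ Metric.closedBall 0 R}.encard.toNat : ENNReal) ^ (m + 1) *
        ∫⁻ y, ENNReal.ofReal y ^ m ∂p.fadingLaw := by
  have hfs : {i | x i ∈ Metric.closedBall 0 R}.Finite := hx R
  set S := hfs.toFinset with hS
  have hcard : {i | x i ∈ Metric.closedBall 0 R}.encard.toNat = S.card := by
    rw [hfs.encard_eq_coe_toFinset_card]; rfl
  have hsum : ∀ ω, ballSum R x (fun i => N.H i ω) = ∑ i ∈ S, ENNReal.ofReal (N.H i ω) := by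
    intro ω
    unfold ballSum
    rw [tsum_eq_sum (s := S) fun i hi => if_neg fun hc => hi (by simpa [hS] using hc)]
    exact Finset.sum_congr rfl fun i hi => if_pos (by simpa [hS] using hi)
  have hHi : ∀ i, Measurable fun ω => ENNReal.ofReal (N.H i ω) ^ m := fun i => by
    have := N.measurable_H i; fun_prop
  calc ∫⁻ ω, ballSum R x (fun i => N.H i ω) ^ m ∂μ
      ≤ ∫⁻ ω, (S.card : ENNReal) ^ m * ∑ i ∈ S, ENNReal.ofReal (N.H i ω) ^ m ∂μ := by
        refine lintegral_mono fun ω => ?_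
        rw [hsum]
        exact sum_pow_le_card_pow_mul _ _ _ hm
    _ = (S.card : ENNReal) ^ m * ∑ i ∈ S, ∫⁻ y, ENNReal.ofReal y ^ m ∂p.fadingLaw := by
        rw [lintegral_const_mul _ (Finset.measurable_fun_sum _ fun i _ => hHi i),
          lintegral_finsetSum _ fun i _ => hHi i]
        congr 1
        refine Finset.sum_congr rfl fun i _ => ?_
        rw [← N.law_H i, lintegral_map (by fun_prop) (N.measurable_H i)]
    _ = _ := by
        rw [Finset.sum_const, nsmul_eq_mul, hcard, pow_succ, mul_assoc]

/-- Interference, relative to the power received from the serving station, is at most the sum of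
the channel gains up to a constant. -/
lemma ofReal_RT_mul_interf_le {ω : Ω} (hR : 0 < N.RT ω) (hG : ∀ i, N.G i ω = p.GM ∨ N.G i ω = p.Gm)
    (hH : ∀ i, 0 ≤ N.H i ω) :
    ENNReal.ofReal (N.RT ω ^ p.alphaT * N.interf ω) ≤
      ENNReal.ofReal (max p.GM p.Gm * p.PT * p.CT) *
        ballSum p.RB (fun i => N.X i ω) (fun i => N.H i ω) := by
  have hPT := p.PT_pos
  have hCT := p.CT_pos
  have hGM := p.GM_pos
  have ha : 0 ≤ N.RT ω ^ p.alphaT := Real.rpow_nonneg hR.le _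
  rw [ENNReal.ofReal_mul ha, interf, ballSum, ← ENNReal.tsum_mul_left]
  refine (mul_le_mul_right ENNReal.ofReal_toReal_le _).trans ?_
  rw [Params.interferenceENN, ← ENNReal.tsum_mul_left]
  refine ENNReal.tsum_le_tsum fun i => ?_
  split_ifs with h1 h2 h2
  · have hRi : N.RT ω ≤ ‖N.X i ω‖ := nearestDist_le _ i
    have hG0 : 0 ≤ N.G i ω ∧ N.G i ω ≤ max p.GM p.Gm := by
      rcases hG i with h | h <;> rw [h]
      exacts [⟨hGM.le, le_max_left _ _⟩, ⟨p.Gm_nonneg, le_max_right _ _⟩]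
    have hHi := hH i
    have hX : 0 < ‖N.X i ω‖ ^ p.alphaT := Real.rpow_pos_of_pos (hR.trans_le hRi) _
    -- Interferers are no closer than the serving station, so multiplying by `RT ^ α` removes the
    -- singularity of the path loss.
    have hq : N.RT ω ^ p.alphaT * ‖N.X i ω‖ ^ (-p.alphaT) ≤ 1 := by
      rw [Real.rpow_neg (norm_nonneg _), ← div_eq_mul_inv, div_le_one hX]
      exact Real.rpow_le_rpow hR.le hRi p.alphaT_pos.le
    have hq0 : 0 ≤ N.RT ω ^ p.alphaT * ‖N.X i ω‖ ^ (-p.alphaT) := by positivity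
    rw [← ENNReal.ofReal_mul ha, ← ENNReal.ofReal_mul (by positivity)]
    refine ENNReal.ofReal_le_ofReal ?_
    calc N.RT ω ^ p.alphaT * (N.G i ω * p.PT * p.CT * ‖N.X i ω‖ ^ (-p.alphaT) * N.H i ω)
        = (N.G i ω * p.PT * p.CT * N.H i ω) * (N.RT ω ^ p.alphaT * ‖N.X i ω‖ ^ (-p.alphaT)) := by
          ring
      _ ≤ N.G i ω * p.PT * p.CT * N.H i ω := by
          have := hG0.1
          exact mul_le_of_le_one_right (by positivity) hq
      _ ≤ max p.GM p.Gm * p.PT * p.CT * N.H i ω := by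
          have := hG0.2
          gcongr
  · exact absurd h1.2 h2
  · simp
  · simp

lemma thr_pos {ω : Ω} (h : 0 < N.RT ω) : 0 < N.thr 1 ω := by
  have := Real.rpow_pos_of_pos h p.alphaT
  have := N.interf_nonneg ω
  have := p.sigma2T_pos
  have := p.GM_pos
  have := p.PT_pos
  have := p.CT_pos
  unfold thr
  positivity

variable [IsProbabilityMeasure μ]

lemma lintegral_ballSum_pow_lt_top (R : ℝ) {m : ℕ} (hm : m ≠ 0) :
    ∫⁻ ω, ballSum R (fun i => N.X i ω) (fun i => N.H i ω) ^ m ∂μ < ⊤ := by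
  have hind : IndepFun (fun ω i => N.X i ω) (fun ω i => N.H i ω) μ :=
    N.indepFun_H.comp (φ := fun q : ((ℕ → Plane) × (ℕ → Plane) × (ℕ → Plane)) × (ℕ → ℝ) => q.1.1)
      (ψ := id) (by fun_prop) measurable_id
  rw [lintegral_comp_of_indepFun N.measurable_XSeq N.measurable_HSeq hind
    (F := fun x h => ballSum R x h ^ m) ((measurable_ballSum R).pow_const m)]
  refine lt_of_le_of_lt (lintegral_mono_ae (N.ae_locallyFinite_X.mono fun ω hω =>
    N.lintegral_ballSum_pow_le hω R hm)) ?_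
  have hM : ∫⁻ y, ENNReal.ofReal y ^ m ∂p.fadingLaw < ⊤ :=
    lintegral_pow_gammaMeasure_lt_top p.one_le_mT m
  rw [lintegral_mul_const' _ _ hM.ne, N.poissonT.lintegral_count measurableSet_closedBall
    (intensityT_closedBall_ne_top p R) fun n => (n : ENNReal) ^ (m + 1)]
  exact ENNReal.mul_lt_top (tsum_pow_mul_poisson_lt_top _ ENNReal.toReal_nonneg) hM

lemma lintegral_thr_pow_lt_top {m : ℕ} (hm : m ≠ 0) :
    ∫⁻ ω, ENNReal.ofReal (N.thr 1 ω) ^ m ∂N.condT < ⊤ := by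
  have hPT := p.PT_pos
  have hCT := p.CT_pos
  have hGM := p.GM_pos
  have hs2 := p.sigma2T_pos
  set η := p.GM * p.PT * p.CT with hη
  have hη0 : 0 < η := by positivity
  set a := ENNReal.ofReal (p.RB ^ p.alphaT * p.sigma2T / η) with had
  set c := ENNReal.ofReal η⁻¹ * ENNReal.ofReal (max p.GM p.Gm * p.PT * p.CT) with hcd
  have ha : a ≠ ⊤ := ENNReal.ofReal_ne_top
  have hc : c ≠ ⊤ := ENNReal.mul_ne_top ENNReal.ofReal_ne_top ENNReal.ofReal_ne_top
  let S : Ω → ENNReal := fun ω => ballSum p.RB (fun i => N.X i ω) (fun i => N.H i ω)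
  have hSm : Measurable fun ω => S ω ^ m := by
    have := (measurable_ballSum p.RB).comp (N.measurable_XSeq.prodMk N.measurable_HSeq)
    exact this.pow_const m
  have hG : ∀ᵐ ω ∂N.condT, ∀ i, N.G i ω = p.GM ∨ N.G i ω = p.Gm :=
    N.condT_absolutelyContinuous.ae_le N.ae_G
  have hH : ∀ᵐ ω ∂N.condT, ∀ i, 0 ≤ N.H i ω := N.condT_absolutelyContinuous.ae_le N.ae_nonneg_H
  have hle : ∀ᵐ ω ∂N.condT, ENNReal.ofReal (N.thr 1 ω) ^ m ≤
      2 ^ m * (a ^ m + c ^ m * S ω ^ m) := by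
    filter_upwards [N.ae_RT_mem, hG, hH] with ω hR hG hH
    have h1 := N.ofReal_RT_mul_interf_le hR.1 hG hH
    have hJ := N.interf_nonneg ω
    have hRa : N.RT ω ^ p.alphaT ≤ p.RB ^ p.alphaT :=
      Real.rpow_le_rpow hR.1.le hR.2 p.alphaT_pos.le
    have hR0 := Real.rpow_nonneg hR.1.le p.alphaT
    have e : N.thr 1 ω = N.RT ω ^ p.alphaT * p.sigma2T / η +
        η⁻¹ * (N.RT ω ^ p.alphaT * N.interf ω) := by
      rw [thr, ← hη]; field_simp; ring
    have h2 : ENNReal.ofReal (N.thr 1 ω) ≤ a + c * S ω := by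
      rw [e, ENNReal.ofReal_add (by positivity) (by positivity),
        ENNReal.ofReal_mul (p := η⁻¹) (by positivity), hcd, mul_assoc, had]
      gcongr
    rw [← mul_pow]
    exact (pow_le_pow_left₀ zero_le h2 m).trans (add_pow_le_two_pow_mul _ _ _)
  have hS : ∫⁻ ω, S ω ^ m ∂N.condT < ⊤ := by
    rw [N.lintegral_condT]
    exact ENNReal.mul_lt_top (ENNReal.inv_lt_top.2 N.measure_assocT_pos)
      ((setLIntegral_le_lintegral _ _).trans_lt (N.lintegral_ballSum_pow_lt_top p.RB hm))
  refine (lintegral_mono_ae hle).trans_lt ?_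
  rw [lintegral_const_mul' _ _ (by finiteness), lintegral_add_left measurable_const,
    lintegral_const_mul _ hSm, lintegral_const, measure_univ, mul_one]
  have := hS.ne
  finiteness

lemma integrable_thr_pow {m : ℕ} (hm : m ≠ 0) : Integrable (fun ω => N.thr 1 ω ^ m) N.condT := by
  have hthr := N.measurable_thr 1
  refine ⟨by fun_prop, ?_⟩
  have h0 := fun ω => N.thr_nonneg zero_le_one ω
  rw [hasFiniteIntegral_iff_ofReal (ae_of_all _ fun ω => pow_nonneg (h0 ω) m)]
  simp only [fun ω => ENNReal.ofReal_pow (h0 ω) m]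
  exact N.lintegral_thr_pow_lt_top hm

/-- The ratio is at most 1 by the upper bound on the tail. For the lower estimate, with L =
E[(bτ_1)^m], the numerator divided by z^m tends to L and the denominator is at most z^m·L. Here 0 <
L < ∞, since τ_1 is almost surely positive with finite moments. -/
theorem tendsto_ratio :
    Tendsto (fun z => (1 - p.approxCCDF N.AT p.bT z) / (1 - N.ccdf z)) (𝓝[>] 0) (𝓝 1) := by
  have hb := p.bT_pos
  have hm : p.mT ≠ 0 := (Nat.pos_of_ne_zero (by have := p.one_le_mT; omega)).ne'
  have hthr := N.measurable_thr 1
  have hT0 := fun ω => N.thr_nonneg zero_le_one ω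
  set L : ℝ := ∫ ω, (p.bT * N.thr 1 ω) ^ p.mT ∂N.condT with hL
  have hi : Integrable (fun ω => (p.bT * N.thr 1 ω) ^ p.mT) N.condT := by
    simp only [mul_pow]
    exact (N.integrable_thr_pow hm).const_mul _
  have hL0 : 0 < L := by
    rw [hL, integral_pos_iff_support_of_nonneg (fun ω => pow_nonneg
      (mul_nonneg hb.le (hT0 ω)) _) hi]
    have : Function.support (fun ω => (p.bT * N.thr 1 ω) ^ p.mT) =ᵐ[N.condT] univ := by
      refine eventuallyEq_univ.2 ?_
      filter_upwards [N.ae_RT_mem] with ω hω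
      exact (pow_pos (mul_pos hb (N.thr_pos hω.1)) _).ne'
    rw [measure_congr this]
    simp
  -- The quotient (1 - e^{-bτ_1 z})/z tends to bτ_1 and never exceeds it for z > 0, so (bτ_1)^m
  -- dominates.
  have num : Tendsto (fun z => (1 - p.approxCCDF N.AT p.bT z) / z ^ p.mT) (𝓝[>] 0) (𝓝 L) := by
    have e : ∀ᶠ z in 𝓝[>] (0 : ℝ), ∫ ω, ((1 - Real.exp (-(p.bT * N.thr 1 ω * z))) / z) ^ p.mT
        ∂N.condT = (1 - p.approxCCDF N.AT p.bT z) / z ^ p.mT := by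
      filter_upwards [self_mem_nhdsWithin] with z hz
      rw [N.one_sub_approxCCDF_eq hb.le (le_of_lt hz), ← integral_div]
      refine integral_congr_ae (ae_of_all _ fun ω => ?_)
      beta_reduce
      rw [N.thr_eq_mul z, div_pow]
      congr 4
      ring
    refine Tendsto.congr' e ?_
    refine tendsto_integral_filter_of_dominated_convergence
      (fun ω => (p.bT * N.thr 1 ω) ^ p.mT) (Eventually.of_forall fun z => by fun_prop) ?_ hi ?_
    · filter_upwards [self_mem_nhdsWithin] with z hz
      refine ae_of_all _ fun ω => ?_
      have hz0 : (0 : ℝ) < z := hz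
      have h0 : 0 ≤ p.bT * N.thr 1 ω * z := mul_nonneg (mul_nonneg hb.le (hT0 ω)) hz0.le
      have h1 : 0 ≤ 1 - Real.exp (-(p.bT * N.thr 1 ω * z)) :=
        sub_nonneg.2 (Real.exp_le_one_iff.2 (neg_nonpos.2 h0))
      rw [Real.norm_eq_abs, abs_of_nonneg (by positivity)]
      refine pow_le_pow_left₀ (by positivity) ?_ _
      rw [div_le_iff₀ hz0]
      have := Real.add_one_le_exp (-(p.bT * N.thr 1 ω * z))
      linarith
    · refine ae_of_all _ fun ω => Tendsto.pow ?_ _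
      have hd : HasDerivAt (fun z : ℝ => 1 - Real.exp (-(p.bT * N.thr 1 ω * z)))
          (p.bT * N.thr 1 ω) 0 := by
        have h1 : HasDerivAt (fun z : ℝ => -(p.bT * N.thr 1 ω * z)) (-(p.bT * N.thr 1 ω)) 0 := by
          have := (hasDerivAt_mul_const (-(p.bT * N.thr 1 ω)) (x := (0 : ℝ)))
          refine this.congr_of_eventuallyEq (Eventually.of_forall fun z => ?_)
          ring
        have h2 := h1.exp.const_sub 1
        simpa using h2
      have := hd.tendsto_slope.mono_left (nhdsWithin_mono 0 fun z (hz : 0 < z) => hz.ne')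
      refine this.congr fun z => ?_
      simp [slope_def_field]
  have den : ∀ z : ℝ, 0 < z → 1 - N.ccdf z ≤ z ^ p.mT * L := by
    intro z hz
    rw [N.one_sub_ccdf_eq, hL, ← integral_const_mul]
    refine integral_mono (N.integrable_fadingLaw_Iic z) (hi.const_mul _) fun ω => ?_
    refine (gammaMeasure_real_Iic_le_mul_pow p (N.thr_nonneg hz.le ω)).trans (le_of_eq ?_)
    rw [N.thr_eq_mul z, ← mul_pow]
    ring
  have low : Tendsto (fun z => (1 - p.approxCCDF N.AT p.bT z) / z ^ p.mT / L) (𝓝[>] 0) (𝓝 1) := by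
    have := num.div_const L
    rwa [div_self hL0.ne'] at this
  -- Near 0 the numerator is positive, hence so is the larger denominator, and the divisions below
  -- are genuine.
  have hpos : ∀ᶠ z in 𝓝[>] (0 : ℝ), 0 < (1 - p.approxCCDF N.AT p.bT z) / z ^ p.mT :=
    num.eventually (eventually_gt_nhds hL0)
  refine tendsto_of_tendsto_of_tendsto_of_le_of_le' low tendsto_const_nhds ?_ ?_
  · filter_upwards [hpos, self_mem_nhdsWithin] with z hz hz0
    have hzp : 0 < z ^ p.mT := pow_pos hz0 _
    have hn : 0 < 1 - p.approxCCDF N.AT p.bT z := (div_pos_iff_of_pos_right hzp).1 hz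
    have hle := N.one_sub_approxCCDF_le (le_of_lt hz0)
    rw [div_div]
    exact div_le_div_of_nonneg_left hn.le (hn.trans_le hle) (den z hz0)
  · filter_upwards [hpos, self_mem_nhdsWithin] with z hz hz0
    have hzp : 0 < z ^ p.mT := pow_pos hz0 _
    have hn : 0 < 1 - p.approxCCDF N.AT p.bT z := (div_pos_iff_of_pos_right hzp).1 hz
    have hle := N.one_sub_approxCCDF_le (le_of_lt hz0)
    exact div_le_one_of_le₀ hle (hn.le.trans hle)

end Network

end HetNet

theorem mainTheorem11 (p : HetNet.Params) {Ω : Type*} [MeasurableSpace Ω] (μ : Measure Ω)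
    [IsProbabilityMeasure μ] (N : HetNet.Network p μ) :
    -- association with the mmWave tier has positive probability
    0 < N.AT ∧
    -- `fHatT` is the density of the serving distance
    N.condT.map N.RT = volume.withDensity (fun r => ENNReal.ofReal (p.fHatT N.AT r)) ∧
    -- `laplaceI` is the Laplace transform of the interference given the serving distance
    (∀ s : ℝ, 0 ≤ s →
      condExp (MeasurableSpace.comap N.RT inferInstance) N.condT
          (fun ω => Real.exp (-(s * N.interference ω)))
        =ᵐ[N.condT] fun ω => p.laplaceI s (N.RT ω)) ∧
    -- the ergodic rate, with convergence of the expectation and of the integral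
    Integrable (fun ω => Real.logb 2 (1 + N.sinr ω)) N.condT ∧
    IntegrableOn (fun z => N.ccdf z / (1 + z)) (Ioi 0) ∧
    N.rate = 1 / Real.log 2 * ∫ z in Ioi (0 : ℝ), N.ccdf z / (1 + z) ∧
    -- the approximation replaces the tail `P(H > t)` of the channel gain by `1 - (1 - e^{-bt})^m`
    (∀ z : ℝ, 0 ≤ z →
      N.ccdf z = ∫ ω, p.fadingLaw.real (Ioi (N.threshold z ω)) ∂N.condT ∧
      p.approxCCDF N.AT p.bT z =
        ∫ ω, (1 - (1 - Real.exp (-(p.bT * N.threshold z ω))) ^ p.mT) ∂N.condT) ∧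
    -- it is an upper bound, and the same expression with `m` for `b` is a lower bound
    (∀ z : ℝ, 0 ≤ z →
      p.approxCCDF N.AT p.mT z ≤ N.ccdf z ∧ N.ccdf z ≤ p.approxCCDF N.AT p.bT z) ∧
    -- it is asymptotically exact for the outage probability at small thresholds
    Tendsto (fun z => (1 - p.approxCCDF N.AT p.bT z) / (1 - N.ccdf z)) (𝓝[>] 0) (𝓝 1) 
:= by
  have hthr : ∀ z, N.threshold z =ᵐ[N.condT] N.thr z := N.threshold_ae
  refine ⟨N.AT_pos, N.map_RT, fun s hs => N.condExp_interference hs, N.integrable_logb,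
    N.integrableOn_ccdf_div, N.rate_eq, fun z hz => ⟨?_, ?_⟩, fun z hz =>
    ⟨N.approxCCDF_le_ccdf hz, by linarith [N.one_sub_approxCCDF_le hz]⟩, N.tendsto_ratio⟩
  · rw [N.ccdf_eq]
    refine integral_congr_ae ((hthr z).mono fun ω hω => ?_)
    beta_reduce
    rw [hω]
  · rw [N.approxCCDF_eq p.bT_pos.le hz]
    refine integral_congr_ae ((hthr z).mono fun ω hω => ?_)
    beta_reduce
    rw [hω]
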